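/- Let $\mathcal H$ and $\mathcal X$ be (real or complex) Hilbert spaces and let $Y(t,s)\in\mathcal L(\mathcal H)$, $0\le s\le t<\infty$, be the evolution operator generated by $A_c(t)$: $Y(t,t)=I$, $Y(t,r)Y(r,s)=Y(t,s)$ for $0\le s\le r\le t$, $Y(\cdot,s)$ is strongly continuous on $[s,\infty)$ and $Y(t,\cdot)$ is strongly continuous on $[0,t]$. For $D:[0,\infty)\to\mathcal L(\mathcal H)$, the evolution operator generated by $A_c(t)+D(t)$ is an evolution operator $Y_D$ with $$Y_D(t,s)w=Y(t,s)w+\int_s^tY(t,r)D(r)Y_D(r,s)w\,dr,\qquad w\in\mathcal H,\ 0\le s\le t,$$ where the integrand is required to be integrable. An evolution operator $U$ is exponentially stable if there are $M\ge0$, $\alpha>0$ with $\|U(t,s)\|\le Me^{-\alpha(t-s)}$ for all $0\le s\le t$. Let $B_c:[0,\infty)\to\mathcal L(\mathcal X,\mathcal H)$, $W_c:[0,\infty)\to\mathcal L(\mathcal H)$ and $R_c:[0,\infty)\to\mathcal L(\mathcal X)$ be norm continuous and uniformly bounded, with $W_c(t)$ self-adjoint and nonnegative, $R_c(t)$ self-adjoint,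 and $(v,R_c(t)v)\ge\delta\|v\|^2$ for all $t\ge0$, $v\in\mathcal X$ and some $\delta>0$. Assume that * $(A_c(t),B_c(t))$ is uniformly stabilizable: for some norm continuous, uniformly bounded $K:[0,\infty)\to\mathcal L(\mathcal H,\mathcal X)$ there is an exponentially stable evolution operator generated by $A_c(t)+B_c(t)K(t)$; * $(A_c(t),W_c^{1/2}(t))$ is uniformly detectable: for some norm continuous, uniformly bounded $L:[0,\infty)\to\mathcal L(\mathcal H)$ there is an exponentially stable evolution operator generated by $A_c(t)+L(t)W_c^{1/2}(t)$. For $s\ge0$, $z_0\in\mathcal H$ and strongly measurable $u:[s,\infty)\to\mathcal X$ let $$J_\infty(u;z_0,s)=\int_s^\infty\big((z(r),W_c(r)z(r))+(u(r),R_c(r)u(r))\big)\,dr\in[0,\infty],\qquad z(t)=Y(t,s)z_0+\int_s^tY(t,r)B_c(r)u(r)\,dr$$ (the cost is $+\infty$ if $u$ is not square integrable). Then there are nonnegative self-adjoint operators $P_\infty(s)\in\mathcal L(\mathcal H)$, $s\ge0$, with $$\min_uJ_\infty(u;z_0,s)=(P_\infty(s)z_0,z_0)\qquad\text{for all }z_0\in\mathcal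 H,\ s\ge0.$$ For every such family $P_\infty$ and the optimal feedback $K_\infty(t)=R_c^{-1}(t)B_c^*(t)P_\infty(t)$, there is an evolution operator $Y_{-B_cK_\infty}(t,s)$ generated by $A_c(t)-B_c(t)K_\infty(t)$, and every such evolution operator is exponentially stable. -/

import Mathlib

open MeasureTheory Filter Topology

noncomputable section

namespace InfiniteHorizonLQ

/-! ### The nonnegative square root of a bounded nonnegative self-adjoint operator -/

/-- The coefficients of the power series `(1 - √(1 - x)) / 2 = ∑ c n * x ^ (n + 1)`. -/
def sqrtCoeff (n : ℕ) : ℝ := (catalan n : ℝ) / 4 ^ (n + 1)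

lemma sqrtCoeff_nonneg (n : ℕ) : 0 ≤ sqrtCoeff n := by
  unfold sqrtCoeff; positivity

lemma sqrtCoeff_succ (n : ℕ) :
    sqrtCoeff (n + 1) = ∑ p ∈ Finset.HasAntidiagonal.antidiagonal n, sqrtCoeff p.1 * sqrtCoeff p.2 := by
  unfold sqrtCoeff
  rw [catalan_succ', Nat.cast_sum, Finset.sum_div]
  refine Finset.sum_congr rfl fun p hp => ?_
  have h : p.1 + p.2 = n := Finset.HasAntidiagonal.mem_antidiagonal.1 hp
  rw [← h, Nat.cast_mul, div_mul_div_comm, ← pow_add]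
  congr 2
  ring

lemma sqrtCoeff_sum_le (N : ℕ) : ∑ n ∈ Finset.range N, sqrtCoeff n ≤ 1 / 2 := by
  induction N with
  | zero => simp
  | succ N ih =>
    have h0 : 0 ≤ ∑ n ∈ Finset.range N, sqrtCoeff n :=
      Finset.sum_nonneg fun n _ => sqrtCoeff_nonneg n
    have h1 : ∑ n ∈ Finset.range N, sqrtCoeff (n + 1)
        ≤ (∑ n ∈ Finset.range N, sqrtCoeff n) * ∑ n ∈ Finset.range N, sqrtCoeff n := by
      simp_rw [sqrtCoeff_succ]
      rw [Finset.sum_mul_sum, ← Finset.sum_product', ← Finset.sum_biUnion]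
      · refine Finset.sum_le_sum_of_subset_of_nonneg ?_ fun p _ _ =>
          mul_nonneg (sqrtCoeff_nonneg _) (sqrtCoeff_nonneg _)
        intro p hp
        simp only [Finset.mem_biUnion, Finset.mem_range, Finset.HasAntidiagonal.mem_antidiagonal,
          Finset.mem_product] at hp ⊢
        obtain ⟨a, ha, hp⟩ := hp
        omega
      · intro a _ b _ hab
        refine Finset.disjoint_left.2 fun p hp hq => hab ?_
        rw [Finset.HasAntidiagonal.mem_antidiagonal] at hp hq
        omega
    rw [Finset.sum_range_succ']
    have h2 : sqrtCoeff 0 = 1 / 4 := by norm_num [sqrtCoeff]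
    nlinarith

section Sqrt

variable {𝕜 H : Type*} [RCLike 𝕜] [NormedAddCommGroup H] [InnerProductSpace 𝕜 H] [CompleteSpace H]

lemma exists_sqrt_one_sub (A : H →L[𝕜] H) (hA : IsSelfAdjoint A) (hn : ‖A‖ ≤ 1) :
    ∃ S : H →L[𝕜] H, S.IsPositive ∧ S * S = 1 - A := by
  set f : ℕ → H →L[𝕜] H := fun n => (sqrtCoeff n : 𝕜) • A ^ (n + 1) with hf
  have hfn : ∀ n, ‖f n‖ ≤ sqrtCoeff n := fun n => by
    have h1 : ‖A ^ (n + 1)‖ ≤ 1 :=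
      (norm_pow_le' A n.succ_pos).trans (pow_le_one₀ (norm_nonneg _) hn)
    have h2 : ‖(sqrtCoeff n : 𝕜)‖ = sqrtCoeff n := by
      rw [RCLike.norm_ofReal, abs_of_nonneg (sqrtCoeff_nonneg n)]
    rw [hf]
    simp only [norm_smul, h2]
    nlinarith [sqrtCoeff_nonneg n]
  have hc : Summable sqrtCoeff := summable_of_sum_range_le sqrtCoeff_nonneg sqrtCoeff_sum_le
  have hfs : Summable fun n => ‖f n‖ := hc.of_nonneg_of_le (fun _ => norm_nonneg _) hfn
  set t : H →L[𝕜] H := ∑' n, f n with ht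
  have htn : ‖t‖ ≤ 1 / 2 :=
    (tsum_of_norm_bounded hc.hasSum hfn).trans
      (hc.tsum_le_of_sum_range_le sqrtCoeff_sum_le)
  have htt : t * t = ∑' n, f (n + 1) := by
    rw [ht, tsum_mul_tsum_eq_tsum_sum_antidiagonal_of_summable_norm hfs hfs]
    congr 1
    ext1 n
    simp only [hf]
    rw [sqrtCoeff_succ, RCLike.ofReal_sum, Finset.sum_smul]
    refine Finset.sum_congr rfl fun p hp => ?_
    have h : p.1 + p.2 = n := Finset.HasAntidiagonal.mem_antidiagonal.1 hp
    rw [smul_mul_smul_comm, ← pow_add, RCLike.ofReal_mul, ← h]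
    congr 2
    ring
  have ht1 : t = ((1 / 4 : ℝ) : 𝕜) • A + t * t := by
    rw [htt, ht, hfs.of_norm.tsum_eq_zero_add]
    have h2 : sqrtCoeff 0 = 1 / 4 := by norm_num [sqrtCoeff]
    simp only [hf, h2, zero_add, pow_one]
  have hts : IsSelfAdjoint t := by
    rw [IsSelfAdjoint, ht, tsum_star]
    congr 1
    ext1 n
    have : IsSelfAdjoint (f n) :=
      IsSelfAdjoint.smul (by simp [isSelfAdjoint_iff]) (hA.pow _)
    exact this
  refine ⟨1 - (t + t), ?_, ?_⟩
  · rw [ContinuousLinearMap.isPositive_def']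
    refine ⟨(IsSelfAdjoint.one _).sub (hts.add hts), fun x => ?_⟩
    rw [ContinuousLinearMap.reApplyInnerSelf_apply]
    have h1 : ‖inner 𝕜 (t x) x‖ ≤ 1 / 2 * ‖x‖ * ‖x‖ :=
      (norm_inner_le_norm _ _).trans
        (mul_le_mul_of_nonneg_right ((t.le_opNorm x).trans
          (mul_le_mul_of_nonneg_right htn (norm_nonneg _))) (norm_nonneg _))
    have h2 := (RCLike.re_le_norm (inner 𝕜 (t x) x)).trans h1
    simp only [sub_apply, add_apply, one_apply_eq_self, inner_sub_left,
      inner_add_left, map_sub, map_add, inner_self_eq_norm_sq]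
    nlinarith
  · have h4 : A = (4 : 𝕜) • (t - t * t) := by
      have : t - t * t = ((1 / 4 : ℝ) : 𝕜) • A := by
        nth_rewrite 1 [ht1]
        abel
      have h : (4 : 𝕜) * ((1 / 4 : ℝ) : 𝕜) = 1 := by
        rw [← RCLike.ofReal_ofNat 4, ← RCLike.ofReal_mul]
        norm_num
      rw [this, smul_smul, h, one_smul]
    rw [h4, show (4 : 𝕜) = ((4 : ℕ) : 𝕜) by norm_num, Nat.cast_smul_eq_nsmul]
    noncomm_ring

/-- Every bounded nonnegative self-adjoint operator has a nonnegative self-adjoint square root. -/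
theorem exists_isPositive_sqrt (T : H →L[𝕜] H) (hT : T.IsPositive) :
    ∃ S : H →L[𝕜] H, S.IsPositive ∧ S * S = T := by
  set c : ℝ := ‖T‖ + 1 with hc
  have hc0 : 0 < c := by positivity
  have hA : IsSelfAdjoint (1 - ((c⁻¹ : ℝ) : 𝕜) • T) :=
    (IsSelfAdjoint.one _).sub (IsSelfAdjoint.smul (by simp [isSelfAdjoint_iff]) hT.isSelfAdjoint)
  have hn : ‖1 - ((c⁻¹ : ℝ) : 𝕜) • T‖ ≤ 1 := by
    rw [ContinuousLinearMap.norm_eq_iSup_rayleighQuotient _ hA.isSymmetric]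
    refine ciSup_le fun x => ?_
    rcases eq_or_ne x 0 with rfl | hx
    · simp
    have hx0 : 0 < ‖x‖ ^ 2 := by positivity
    have h1 : 0 ≤ RCLike.re (inner 𝕜 (T x) x) := hT.re_inner_nonneg_left x
    have h2 : RCLike.re (inner 𝕜 (T x) x) ≤ c * ‖x‖ ^ 2 := by
      have := (RCLike.re_le_norm (inner 𝕜 (T x) x)).trans
        ((norm_inner_le_norm _ _).trans
          (mul_le_mul_of_nonneg_right (T.le_opNorm x) (norm_nonneg _)))
      nlinarith
    have h3 : c⁻¹ * RCLike.re (inner 𝕜 (T x) x) ≤ ‖x‖ ^ 2 := by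
      rw [inv_mul_le_iff₀ hc0]; exact h2
    have h4 : 0 ≤ c⁻¹ * RCLike.re (inner 𝕜 (T x) x) := by positivity
    have h5 : (1 - ((c⁻¹ : ℝ) : 𝕜) • T).reApplyInnerSelf x
        = ‖x‖ ^ 2 - c⁻¹ * RCLike.re (inner 𝕜 (T x) x) := by
      rw [ContinuousLinearMap.reApplyInnerSelf_apply]
      simp only [sub_apply, smul_apply, one_apply_eq_self, inner_sub_left,
        inner_smul_left, map_sub, inner_self_eq_norm_sq, RCLike.conj_ofReal, RCLike.re_ofReal_mul]
    rw [ContinuousLinearMap.rayleighQuotient, h5, abs_of_nonneg (div_nonneg (by linarith) hx0.le),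
      div_le_one hx0]
    linarith
  obtain ⟨S, hS, hSS⟩ := exists_sqrt_one_sub _ hA hn
  refine ⟨((√c : ℝ) : 𝕜) • S, hS.smul_of_nonneg (by simp), ?_⟩
  rw [smul_mul_smul_comm, hSS, sub_sub_cancel, smul_smul, ← RCLike.ofReal_mul, ← RCLike.ofReal_mul,
    Real.mul_self_sqrt hc0.le, mul_inv_cancel₀ hc0.ne', RCLike.ofReal_one, one_smul]

/-- The nonnegative self-adjoint square root `T ^ (1/2)` of a nonnegative self-adjoint bounded
operator `T` (which is unique), and `0` if `T` is not nonnegative. -/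
def posSqrt (T : H →L[𝕜] H) : H →L[𝕜] H :=
  open scoped Classical in
  if hT : T.IsPositive then (exists_isPositive_sqrt T hT).choose else 0

lemma posSqrt_isPositive {T : H →L[𝕜] H} (hT : T.IsPositive) : (posSqrt T).IsPositive := by
  rw [posSqrt, dif_pos hT]
  exact (exists_isPositive_sqrt T hT).choose_spec.1

lemma posSqrt_mul_self {T : H →L[𝕜] H} (hT : T.IsPositive) : posSqrt T * posSqrt T = T := by
  rw [posSqrt, dif_pos hT]
  exact (exists_isPositive_sqrt T hT).choose_spec.2

end Sqrt

/-! ### Evolution operators on `0 ≤ s ≤ t < ∞` -/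

section Evolution

variable {𝕜 H : Type*} [RCLike 𝕜] [NormedAddCommGroup H] [InnerProductSpace 𝕜 H]

/-- `U t s`, `0 ≤ s ≤ t`, is an evolution operator (values at other `(t, s)` are irrelevant). -/
structure IsEvolutionOperator (U : ℝ → ℝ → H →L[𝕜] H) : Prop where
  refl : ∀ t, 0 ≤ t → U t t = ContinuousLinearMap.id 𝕜 H
  comp : ∀ s r t, 0 ≤ s → s ≤ r → r ≤ t → U t r ∘L U r s = U t s
  continuousOn_left : ∀ s, 0 ≤ s → ∀ x, ContinuousOn (fun t => U t s x) (Set.Ici s)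
  continuousOn_right : ∀ t, 0 ≤ t → ∀ x, ContinuousOn (fun s => U t s x) (Set.Icc 0 t)

/-- Exponential stability: `‖U t s‖ ≤ M * exp (-α (t - s))` for all `0 ≤ s ≤ t`. -/
def IsExponentiallyStable (U : ℝ → ℝ → H →L[𝕜] H) : Prop :=
  ∃ M α : ℝ, 0 ≤ M ∧ 0 < α ∧
    ∀ s t, 0 ≤ s → s ≤ t → ‖U t s‖ ≤ M * Real.exp (-α * (t - s))

variable [NormedSpace ℝ H]

/-- `V` is the evolution operator obtained from the evolution operator `Y` by the bounded
perturbation `D` of its generator: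
`V t s w = Y t s w + ∫ r in s..t, Y t r (D r (V r s w))` for `0 ≤ s ≤ t`. -/
structure IsPerturbedEvolution (Y : ℝ → ℝ → H →L[𝕜] H) (D : ℝ → H →L[𝕜] H)
    (V : ℝ → ℝ → H →L[𝕜] H) : Prop where
  isEvolutionOperator : IsEvolutionOperator V
  intervalIntegrable : ∀ s t, 0 ≤ s → s ≤ t → ∀ w,
    IntervalIntegrable (fun r => Y t r (D r (V r s w))) volume s t
  eq_add_integral : ∀ s t, 0 ≤ s → s ≤ t → ∀ w,
    V t s w = Y t s w + ∫ r in s..t, Y t r (D r (V r s w))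

end Evolution

/-- The operator-valued function `F` is norm continuous and uniformly bounded on `[0, ∞)`. -/
def IsBoundedContinuous {E : Type*} [NormedAddCommGroup E] (F : ℝ → E) : Prop :=
  ContinuousOn F (Set.Ici 0) ∧ ∃ c : ℝ, ∀ t, 0 ≤ t → ‖F t‖ ≤ c

section Control

variable {𝕜 H X : Type*} [RCLike 𝕜]
  [NormedAddCommGroup H] [InnerProductSpace 𝕜 H] [NormedSpace ℝ H]
  [NormedAddCommGroup X] [InnerProductSpace 𝕜 X]

/-- `(A, C)` is uniformly detectable, where `A` generates the evolution operator `Y`. -/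
def IsUniformlyDetectable (Y : ℝ → ℝ → H →L[𝕜] H) (C : ℝ → H →L[𝕜] X) : Prop :=
  ∃ L : ℝ → X →L[𝕜] H, IsBoundedContinuous L ∧
    ∃ YL, IsPerturbedEvolution Y (fun t => L t ∘L C t) YL ∧ IsExponentiallyStable YL

/-- `(A, B)` is uniformly stabilizable, where `A` generates the evolution operator `Y`. -/
def IsUniformlyStabilizable (Y : ℝ → ℝ → H →L[𝕜] H) (B : ℝ → X →L[𝕜] H) : Prop :=
  ∃ K : ℝ → H →L[𝕜] X, IsBoundedContinuous K ∧
    ∃ YK, IsPerturbedEvolution Y (fun t => B t ∘L K t) YK ∧ IsExponentiallyStable YK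

/-- The state `z(t) = Y(t,s) z₀ + ∫ₛᵗ Y(t,r) B(r) u(r) dr` with initial value `z₀` at time `s`. -/
def trajectory (Y : ℝ → ℝ → H →L[𝕜] H) (B : ℝ → X →L[𝕜] H) (s : ℝ) (z₀ : H) (u : ℝ → X)
    (t : ℝ) : H :=
  Y t s z₀ + ∫ r in s..t, Y t r (B r (u r))

/-- The cost `∫ₛ^∞ ((z, W z) + (u, R u)) dr ∈ [0, ∞]` of the control `u` with initial value `z₀` at
time `s`. For nonnegative `W` and coercive `R` it is `∞` unless `u` is square integrable on
`[s, ∞)`. -/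
def infiniteCost (Y : ℝ → ℝ → H →L[𝕜] H) (B : ℝ → X →L[𝕜] H) (W : ℝ → H →L[𝕜] H)
    (R : ℝ → X →L[𝕜] X) (s : ℝ) (z₀ : H) (u : ℝ → X) : ENNReal :=
  ∫⁻ r in Set.Ici s, ENNReal.ofReal
    (RCLike.re (inner 𝕜 (trajectory Y B s z₀ u r) (W r (trajectory Y B s z₀ u r)))
      + RCLike.re (inner 𝕜 (u r) (R r (u r))))

/-- `P s` is, for each `s ≥ 0`, the optimal cost operator `P_∞(s)` of the infinite-horizon problem
started at time `s`: it is self-adjoint and nonnegative, and `(P s z₀, z₀)` is the minimum of the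
cost over all strongly measurable controls, for every initial value `z₀`. -/
def IsOptimalCostOperator (Y : ℝ → ℝ → H →L[𝕜] H) (B : ℝ → X →L[𝕜] H) (W : ℝ → H →L[𝕜] H)
    (R : ℝ → X →L[𝕜] X) (P : ℝ → H →L[𝕜] H) : Prop :=
  ∀ s, 0 ≤ s → (P s).IsPositive ∧
    ∀ z₀, IsLeast (infiniteCost Y B W R s z₀ ''
        {u | AEStronglyMeasurable u (volume.restrict (Set.Ici s))})
      (ENNReal.ofReal (RCLike.re (inner 𝕜 (P s z₀) z₀)))

/-- The feedback `K(t) = R(t)⁻¹ B(t)* P(t)`. -/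
def feedback [CompleteSpace H] [CompleteSpace X] (B : ℝ → X →L[𝕜] H) (R : ℝ → X →L[𝕜] X)
    (P : ℝ → H →L[𝕜] H) (t : ℝ) : H →L[𝕜] X :=
  (R t).inverse ∘L ContinuousLinearMap.adjoint (B t) ∘L P t

end Control

end InfiniteHorizonLQ

end

/-!
Put `C = W^(1/2)`. Taking `R^(1/2) u` as the new control and `B R^(-1/2)` as the new input operator,
one may assume `R = 1`; the cost is then the squared `L²` norm of the signal `(C z, u)`. The pairs
of an initial value at time `s` and a signal of finite cost form a closed subspace of `H × L²`,
which stabilizability makes project onto `H`. The signal of least norm is therefore a bounded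
linear function `T s` of the initial value, and `P s = (T s)* T s`.

By the principle of optimality a restriction of an optimal signal is optimal, so that the optimal
trajectories form an evolution operator `V`. The orthogonality of `T s x` to the signals with
initial value `0`, tested with controls supported on short intervals, gives `u = -B* P z` almost
everywhere, hence `V` is generated by `A - B B* P`. Detectability writes the optimal trajectory as
the response of an exponentially stable evolution operator to the optimal signal. It is thus square
integrable in time, with a bound uniform in `s`, and Datko's theorem gives the exponential
stability of `V`.
-/

namespace InfiniteHorizonLQ

/-! ### Integrals of operator-valued functions -/

section Integrals

variable {𝕜 E F : Type*} [NormedAddCommGroup E] [NormedAddCommGroup F]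

section Operators

variable [NontriviallyNormedField 𝕜] [NormedSpace 𝕜 E] [NormedSpace 𝕜 F]

lemma aestronglyMeasurable_clm_apply {α : Type*} [MeasurableSpace α] {ν : Measure α}
    {T : α → E →L[𝕜] F} {g : α → E} (hT : ∀ v, AEStronglyMeasurable (fun a => T a v) ν)
    (hg : AEStronglyMeasurable g ν) : AEStronglyMeasurable (fun a => T a (g a)) ν := by
  have simple : ∀ f : SimpleFunc α E, AEStronglyMeasurable (fun a => T a (f a)) ν := by
    intro f
    induction f using SimpleFunc.induction with
    | const c hs =>
      refine ((hT c).indicator hs).congr (Eventually.of_forall fun a => ?_)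
      by_cases h : a ∈ ‹Set α› <;> simp [h]
    | add _ hf hg => exact (hf.add hg).congr (Eventually.of_forall fun a => by simp)
  have hmk : AEStronglyMeasurable (fun a => T a (hg.mk g a)) ν :=
    aestronglyMeasurable_of_tendsto_ae atTop
      (fun n => simple (hg.stronglyMeasurable_mk.approx n)) (Eventually.of_forall fun a =>
        ((T a).continuous.tendsto _).comp (hg.stronglyMeasurable_mk.tendsto_approx a))
  exact hmk.congr (hg.ae_eq_mk.mono fun a ha => congrArg (T a) ha.symm)

lemma integrableOn_clm_apply {D : ℝ → E →L[𝕜] F} {S : Set ℝ} (hS : MeasurableSet S)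
    (hm : ∀ v, AEStronglyMeasurable (fun r => D r v) (volume.restrict S)) {d : ℝ}
    (hd : ∀ r ∈ S, ‖D r‖ ≤ d) {f : ℝ → E} (hf : IntegrableOn f S) :
    IntegrableOn (fun r => D r (f r)) S := by
  refine Integrable.mono' (hf.norm.const_mul d)
    (aestronglyMeasurable_clm_apply hm hf.aestronglyMeasurable) ?_
  filter_upwards [ae_restrict_mem hS] with r hr
  exact (D r).le_of_opNorm_le (hd r hr) _

lemma intervalIntegrable_clm_apply {D : ℝ → E →L[𝕜] F} {s t : ℝ} (hst : s ≤ t)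
    (hD : ContinuousOn D (Set.Icc s t)) {f : ℝ → E} (hf : IntervalIntegrable f volume s t) :
    IntervalIntegrable (fun r => D r (f r)) volume s t := by
  rw [intervalIntegrable_iff_integrableOn_Ioc_of_le hst] at hf ⊢
  obtain ⟨d, hd⟩ := isCompact_Icc.bddAbove_image hD.norm
  exact integrableOn_clm_apply measurableSet_Ioc
    (fun v => ((hD.mono Set.Ioc_subset_Icc_self).clm_apply continuousOn_const).aestronglyMeasurable
      measurableSet_Ioc)
    (fun r hr => hd ⟨r, Set.Ioc_subset_Icc_self hr, rfl⟩) hf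

end Operators

lemma integral_exp_mul_sub_right {l : ℝ} (hl : l ≠ 0) (s t : ℝ) :
    ∫ r in s..t, Real.exp (l * (t - r)) = (Real.exp (l * (t - s)) - 1) / l := by
  have hderiv : ∀ r ∈ Set.uIcc s t, HasDerivAt (fun r => Real.exp (l * (t - r)) / (-l))
      (Real.exp (l * (t - r))) r := fun r _ =>
    ((((hasDerivAt_id r).const_sub t).const_mul l).exp.div_const (-l)).congr_deriv
      (by simp only [id]; field_simp)
  rw [intervalIntegral.integral_eq_sub_of_hasDerivAt hderiv
    (Continuous.intervalIntegrable (by fun_prop) _ _)]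
  simp only [sub_self, mul_zero, Real.exp_zero]
  field_simp
  ring

lemma eq_zero_of_le_mul_integral {φ : ℝ → ℝ} {a b c : ℝ} (hφ : ContinuousOn φ (Set.Icc a b))
    (h0 : ∀ t ∈ Set.Icc a b, 0 ≤ φ t) (h : ∀ t ∈ Set.Icc a b, φ t ≤ c * ∫ r in a..t, φ r) :
    ∀ t ∈ Set.Icc a b, φ t = 0 := by
  intro t ht
  have hab : a ≤ b := ht.1.trans ht.2
  have hint : IntegrableOn φ (Set.uIcc a b) := by
    rw [Set.uIcc_of_le hab]
    exact hφ.integrableOn_Icc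
  have primitive_eq_zero : ∫ r in a..t, φ r = 0 := by
    refine eq_zero_of_abs_deriv_le_mul_abs_self_of_eq_zero_right (f := fun t => ∫ r in a..t, φ r)
      (f' := φ) (K := c) (b := b) ?_ (fun x hx => ?_) intervalIntegral.integral_same
      (fun x hx => ?_) t ht
    · simpa only [Set.uIcc_of_le hab] using intervalIntegral.continuousOn_primitive_interval hint
    · have hx' : x ∈ Set.Icc a b := Set.Ico_subset_Icc_self hx
      have hcont : ContinuousWithinAt φ (Set.Ioi x) x :=
        (hφ.continuousWithinAt hx').mono_of_mem_nhdsWithin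
          (Filter.mem_of_superset (Ioo_mem_nhdsGT hx.2) fun y hy =>
            ⟨hx.1.trans hy.1.le, hy.2.le⟩)
      refine intervalIntegral.integral_hasDerivWithinAt_right ?_ ?_ hcont
      · exact (intervalIntegrable_iff_integrableOn_Icc_of_le hx.1).2
          (hφ.integrableOn_Icc.mono_set (Set.Icc_subset_Icc_right hx.2.le))
      · exact ⟨Set.Ioo x b, Ioo_mem_nhdsGT hx.2, ((hφ.mono fun y hy =>
          ⟨hx.1.trans hy.1.le, hy.2.le⟩).aestronglyMeasurable measurableSet_Ioo)⟩
    · have hx' : x ∈ Set.Icc a b := Set.Ico_subset_Icc_self hx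
      rw [Real.norm_of_nonneg (h0 x hx'), Real.norm_of_nonneg
        (intervalIntegral.integral_nonneg hx.1 fun r hr => h0 r ⟨hr.1, hr.2.trans hx.2.le⟩)]
      exact h x hx'
  exact le_antisymm (by simpa only [primitive_eq_zero, mul_zero] using h t ht) (h0 t ht)

/-- The triangle `s < q < r ≤ t` of pairs `(r, q)`, on which the kernels `k r q` of Volterra
integral operators on `[s, t]` are defined. -/
def triangle (s t : ℝ) : Set (ℝ × ℝ) := {p | s < p.2 ∧ p.2 < p.1 ∧ p.1 ≤ t}

lemma measurableSet_triangle (s t : ℝ) : MeasurableSet (triangle s t) :=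
  (measurableSet_lt measurable_const measurable_snd).inter
    ((measurableSet_lt measurable_snd measurable_fst).inter
      (measurableSet_le measurable_fst measurable_const))

lemma triangle_subset_prod (s t : ℝ) : triangle s t ⊆ Set.Ioc s t ×ˢ Set.Ioc s t :=
  fun _ hp => ⟨⟨hp.1.trans hp.2.1, hp.2.2⟩, hp.1, hp.2.1.le.trans hp.2.2⟩

lemma aestronglyMeasurable_snd_triangle {s t : ℝ} {g : ℝ → E}
    (hg : AEStronglyMeasurable g (volume.restrict (Set.Ioc s t))) :
    AEStronglyMeasurable (fun p : ℝ × ℝ => g p.2) (volume.restrict (triangle s t)) := by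
  have h := AEStronglyMeasurable.comp_snd (μ := volume.restrict (Set.Ioc s t)) hg
  rw [Measure.prod_restrict, ← Measure.volume_eq_prod] at h
  exact h.mono_set (triangle_subset_prod s t)

lemma integrableOn_triangle_of_norm_le {k : ℝ → ℝ → E} {g : ℝ → F} {s t c : ℝ}
    (hk : AEStronglyMeasurable (Function.uncurry k) (volume.restrict (triangle s t)))
    (hg : IntegrableOn g (Set.Ioc s t))
    (h : ∀ q r, s < q → q < r → r ≤ t → ‖k r q‖ ≤ c * ‖g q‖) :
    IntegrableOn (Function.uncurry k) (triangle s t) := by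
  have hdom := Integrable.comp_snd (hg.norm.const_mul c) (volume.restrict (Set.Ioc s t))
  rw [Measure.prod_restrict, ← Measure.volume_eq_prod] at hdom
  refine Integrable.mono' (hdom.mono_measure
    (Measure.restrict_mono (triangle_subset_prod s t) le_rfl)) hk ?_
  filter_upwards [ae_restrict_mem (measurableSet_triangle s t)] with p hp
  exact h p.2 p.1 hp.1 hp.2.1 hp.2.2

section

variable [NormedSpace ℝ E]

lemma integral_indicator_triangle_left (k : ℝ → ℝ → E) (s t q : ℝ) :
    ∫ r, (triangle s t).indicator (Function.uncurry k) (r, q)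
      = (Set.Ioc s t).indicator (fun q => ∫ r in q..t, k r q) q := by
  by_cases hq : q ∈ Set.Ioc s t
  · rw [Set.indicator_of_mem hq, intervalIntegral.integral_of_le hq.2,
      ← integral_indicator measurableSet_Ioc]
    refine integral_congr_ae (ae_of_all _ fun r => ?_)
    simp [Set.indicator, triangle, hq.1]
  · rw [Set.indicator_of_notMem hq]
    refine integral_eq_zero_of_ae (ae_of_all _ fun r => Set.indicator_of_notMem (fun hr => hq ?_) _)
    exact (triangle_subset_prod s t hr).2

lemma integral_indicator_triangle_right (k : ℝ → ℝ → E) (s t r : ℝ) :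
    ∫ q, (triangle s t).indicator (Function.uncurry k) (r, q)
      = (Set.Ioc s t).indicator (fun r => ∫ q in s..r, k r q) r := by
  by_cases hr : r ∈ Set.Ioc s t
  · rw [Set.indicator_of_mem hr, intervalIntegral.integral_of_le hr.1.le,
      integral_Ioc_eq_integral_Ioo, ← integral_indicator measurableSet_Ioo]
    refine integral_congr_ae (ae_of_all _ fun q => ?_)
    simp [Set.indicator, triangle, hr.2]
  · rw [Set.indicator_of_notMem hr]
    refine integral_eq_zero_of_ae (ae_of_all _ fun q => Set.indicator_of_notMem (fun hq => hr ?_) _)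
    exact (triangle_subset_prod s t hq).1

variable {k : ℝ → ℝ → E} {s t : ℝ}

lemma integral_integral_triangle_swap (hst : s ≤ t)
    (hk : IntegrableOn (Function.uncurry k) (triangle s t)) :
    ∫ q in s..t, ∫ r in q..t, k r q = ∫ r in s..t, ∫ q in s..r, k r q := by
  have swap := integral_integral_swap (μ := volume) (ν := volume)
    (f := fun r q : ℝ => (triangle s t).indicator (Function.uncurry k) (r, q))
    ((integrable_indicator_iff (measurableSet_triangle s t)).2 hk)
  simp only [integral_indicator_triangle_left, integral_indicator_triangle_right,
    integral_indicator measurableSet_Ioc] at swap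
  rw [intervalIntegral.integral_of_le hst, intervalIntegral.integral_of_le hst, swap]

lemma intervalIntegrable_integral_triangle_left (hst : s ≤ t)
    (hk : IntegrableOn (Function.uncurry k) (triangle s t)) :
    IntervalIntegrable (fun q => ∫ r in q..t, k r q) volume s t := by
  have h := ((integrable_indicator_iff (measurableSet_triangle s t)).2 hk).integral_prod_right
  simp only [integral_indicator_triangle_left] at h
  exact (intervalIntegrable_iff_integrableOn_Ioc_of_le hst).2
    ((integrable_indicator_iff measurableSet_Ioc).1 h)

lemma intervalIntegrable_integral_triangle_right (hst : s ≤ t)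
    (hk : IntegrableOn (Function.uncurry k) (triangle s t)) :
    IntervalIntegrable (fun r => ∫ q in s..r, k r q) volume s t := by
  have h := ((integrable_indicator_iff (measurableSet_triangle s t)).2 hk).integral_prod_left
  simp only [integral_indicator_triangle_right] at h
  exact (intervalIntegrable_iff_integrableOn_Ioc_of_le hst).2
    ((integrable_indicator_iff measurableSet_Ioc).1 h)

end

end Integrals

/-! ### Bounded perturbations of evolution operators -/

section Evolution

variable {𝕜 H : Type*} [RCLike 𝕜] [NormedAddCommGroup H] [InnerProductSpace 𝕜 H]

/-- The extension of a function of `0 ≤ s ≤ t` to all pairs of real numbers, by its diagonal values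
for `t ≤ s` and by `U t 0` for `s ≤ 0`. It makes an evolution operator separately strongly
continuous on the plane, hence jointly measurable. -/
def extend {α : Type*} (U : ℝ → ℝ → α) (t s : ℝ) : α := U (max t (max s 0)) (max s 0)

lemma extend_of_le {α : Type*} (U : ℝ → ℝ → α) {t s : ℝ} (hs : 0 ≤ s) (h : s ≤ t) :
    extend U t s = U t s := by
  rw [extend, max_eq_left hs, max_eq_left h]

/-- Uniform boundedness on the triangles `0 ≤ s ≤ t ≤ T`. -/
def IsLocallyBounded {E : Type*} [NormedAddCommGroup E] (U : ℝ → ℝ → E) : Prop :=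
  ∀ T, ∃ N : ℝ, ∀ s t, 0 ≤ s → s ≤ t → t ≤ T → ‖U t s‖ ≤ N

lemma IsLocallyBounded.extend {E : Type*} [NormedAddCommGroup E] {U : ℝ → ℝ → E}
    (hU : IsLocallyBounded U) (T : ℝ) : ∃ N : ℝ, ∀ s t, t ≤ T → s ≤ T → ‖extend U t s‖ ≤ N := by
  obtain ⟨N, hN⟩ := hU (max T 0)
  exact ⟨N, fun s t ht hs => hN _ _ (le_max_right _ _) (le_max_right _ _)
    (max_le (ht.trans (le_max_left _ _)) (max_le_max hs le_rfl))⟩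

lemma IsExponentiallyStable.isLocallyBounded {U : ℝ → ℝ → H →L[𝕜] H}
    (hU : IsExponentiallyStable U) : IsLocallyBounded U := by
  obtain ⟨M, α, hM, hα, h⟩ := hU
  refine fun T => ⟨M, fun s t hs hst _ => (h s t hs hst).trans ?_⟩
  refine mul_le_of_le_one_right hM (Real.exp_le_one_iff.2 ?_)
  nlinarith

namespace IsEvolutionOperator

variable {U : ℝ → ℝ → H →L[𝕜] H} (hU : IsEvolutionOperator U)
include hU

lemma extend_eq_id {t s : ℝ} (h : t ≤ s) : extend U t s = ContinuousLinearMap.id 𝕜 H := by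
  rw [extend, max_eq_right (h.trans (le_max_left s 0)), hU.refl _ (le_max_right s 0)]

lemma continuous_extend_left (s : ℝ) (x : H) : Continuous fun t => extend U t s x :=
  (hU.continuousOn_left (max s 0) (le_max_right _ _) x).comp_continuous
    (f := fun t => max t (max s 0)) (by fun_prop) fun _ => Set.mem_Ici.2 (le_max_right _ _)

lemma continuous_extend_right (t : ℝ) (x : H) : Continuous fun s => extend U t s x := by
  rcases le_total 0 t with ht | ht
  · have extend_eq : ∀ s, extend U t s x = U t (min (max s 0) t) x := by
      intro s
      rcases le_total (max s 0) t with h | h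
      · rw [extend, max_eq_left h, min_eq_left h]
      · rw [extend, max_eq_right h, min_eq_right h, hU.refl _ (le_max_right _ _), hU.refl _ ht]
    simp_rw [extend_eq]
    exact (hU.continuousOn_right t ht x).comp_continuous (f := fun s => min (max s 0) t)
      (by fun_prop) fun s => ⟨le_min (le_max_right _ _) ht, min_le_right _ _⟩
  · have extend_eq : ∀ s, extend U t s x = x := fun s => by
      rw [extend, max_eq_right (ht.trans (le_max_right s 0)), hU.refl _ (le_max_right _ _),
        ContinuousLinearMap.id_apply]
    simp_rw [extend_eq]
    exact continuous_const

lemma stronglyMeasurable_extend (x : H) :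
    StronglyMeasurable fun p : ℝ × ℝ => extend U p.1 p.2 x :=
  stronglyMeasurable_uncurry_of_continuous_of_stronglyMeasurable
    (u := fun t s => extend U t s x) (fun s => hU.continuous_extend_left s x)
    (fun t => (hU.continuous_extend_right t x).stronglyMeasurable)

lemma aestronglyMeasurable_right {s t : ℝ} (hs : 0 ≤ s) (v : H) :
    AEStronglyMeasurable (fun r => U t r v) (volume.restrict (Set.Ioc s t)) := by
  refine (hU.continuous_extend_right t v).aestronglyMeasurable.congr ?_
  filter_upwards [ae_restrict_mem measurableSet_Ioc] with r hr
  rw [extend_of_le U (hs.trans hr.1.le) hr.2]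

lemma intervalIntegrable_apply (hUb : IsLocallyBounded U) {s t : ℝ} (hs : 0 ≤ s) (hst : s ≤ t)
    {f : ℝ → H} (hf : IntervalIntegrable f volume s t) :
    IntervalIntegrable (fun r => U t r (f r)) volume s t := by
  rw [intervalIntegrable_iff_integrableOn_Ioc_of_le hst] at hf ⊢
  obtain ⟨N, hN⟩ := hUb t
  exact integrableOn_clm_apply measurableSet_Ioc (fun v => hU.aestronglyMeasurable_right hs v)
    (fun r hr => hN r t (hs.trans hr.1.le) hr.2 le_rfl) hf

lemma intervalIntegrable_extend_apply (hUb : IsLocallyBounded U) {s t T : ℝ} (hsT : s ≤ T)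
    (htT : t ≤ T) {f : ℝ → H} (hf : IntervalIntegrable f volume s T) :
    IntervalIntegrable (fun r => extend U t r (f r)) volume s T := by
  obtain ⟨N, hN⟩ := hUb.extend T
  rw [intervalIntegrable_iff_integrableOn_Ioc_of_le hsT] at hf ⊢
  exact integrableOn_clm_apply measurableSet_Ioc
    (fun v => (hU.continuous_extend_right t v).aestronglyMeasurable)
    (fun r hr => hN r t htT hr.2) hf

lemma exists_norm_le_right [CompleteSpace H] {t : ℝ} (ht : 0 ≤ t) :
    ∃ c, ∀ s ∈ Set.Icc 0 t, ‖U t s‖ ≤ c := by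
  obtain ⟨c, hc⟩ := banach_steinhaus (g := fun s : Set.Icc 0 t => U t s) fun x => by
    obtain ⟨c, hc⟩ := isCompact_Icc.bddAbove_image (hU.continuousOn_right t ht x).norm
    exact ⟨c, fun s => hc ⟨s, s.2, rfl⟩⟩
  exact ⟨c, fun s hs => hc ⟨s, hs⟩⟩

end IsEvolutionOperator

lemma integrableOn_duhamel_kernel {Y V : ℝ → ℝ → H →L[𝕜] H}
    {D : ℝ → H →L[𝕜] H} (hY : IsEvolutionOperator Y) (hYb : IsLocallyBounded Y)
    (hV : IsEvolutionOperator V) (hVb : IsLocallyBounded V) (hD : IsBoundedContinuous D) {s t : ℝ}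
    (hs : 0 ≤ s) {g : ℝ → H} (hg : IntegrableOn g (Set.Ioc s t)) :
    IntegrableOn (Function.uncurry fun r q => Y t r (D r (V r q (g q)))) (triangle s t) := by
  obtain ⟨N, hN⟩ := hYb t
  obtain ⟨N', hN'⟩ := hVb t
  obtain ⟨d, hd⟩ := hD.2
  have hmem := ae_restrict_mem (μ := volume) (measurableSet_triangle s t)
  have hDm : ∀ v, AEStronglyMeasurable (fun p : ℝ × ℝ => D p.1 v)
      (volume.restrict (triangle s t)) := fun v =>
    (ContinuousOn.clm_apply (hD.1.comp continuousOn_fst fun p hp =>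
      hs.trans (hp.1.trans hp.2.1).le) continuousOn_const).aestronglyMeasurable
      (measurableSet_triangle s t)
  have hmeas := aestronglyMeasurable_clm_apply
    (fun v => ((hY.continuous_extend_right t v).comp continuous_fst).aestronglyMeasurable)
    (aestronglyMeasurable_clm_apply hDm (aestronglyMeasurable_clm_apply
      (fun v => (hV.stronglyMeasurable_extend v).aestronglyMeasurable)
      (aestronglyMeasurable_snd_triangle hg.aestronglyMeasurable)))
  refine integrableOn_triangle_of_norm_le (c := N * (d * N')) (hmeas.congr ?_) hg
    fun q r hq hqr hrt => ?_
  · filter_upwards [hmem] with p hp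
    have hp2 : 0 ≤ p.2 := hs.trans hp.1.le
    simp only [extend_of_le V hp2 hp.2.1.le, extend_of_le Y (hp2.trans hp.2.1.le) hp.2.2,
      Function.uncurry]
  · have hq0 : 0 ≤ q := hs.trans hq.le
    have hr0 : 0 ≤ r := hq0.trans hqr.le
    rw [mul_assoc, mul_assoc]
    exact (Y t r).le_of_opNorm_le_of_le (hN r t hr0 hrt le_rfl)
      ((D r).le_of_opNorm_le_of_le (hd r hr0) ((V r q).le_of_opNorm_le (hN' q r hq0 hqr.le hrt) _))

section Perturbation

variable [NormedSpace ℝ H] {Y V : ℝ → ℝ → H →L[𝕜] H} {D : ℝ → H →L[𝕜] H}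

lemma IsPerturbedEvolution.norm_base_le (hV : IsPerturbedEvolution Y D V) {s t N d c l : ℝ}
    (hs : 0 ≤ s) (hst : s ≤ t) (hVN : ∀ r ∈ Set.Icc s t, ‖V r s‖ ≤ N)
    (hD : ∀ r ∈ Set.Icc s t, ‖D r‖ ≤ d) (hl : 0 < l) (hdN : d * N ≤ l / 2)
    (hY : ∀ r ∈ Set.Icc s t, ‖Y t r‖ ≤ c * Real.exp (l * (t - r))) :
    ‖Y t s‖ ≤ N + c / 2 * Real.exp (l * (t - s)) := by
  have mem_left : s ∈ Set.Icc s t := ⟨le_rfl, hst⟩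
  have hN : 0 ≤ N := (norm_nonneg _).trans (hVN s mem_left)
  have hd : 0 ≤ d := (norm_nonneg _).trans (hD s mem_left)
  have hc : 0 ≤ c :=
    nonneg_of_mul_nonneg_left ((norm_nonneg _).trans (hY s mem_left)) (Real.exp_pos _)
  refine ContinuousLinearMap.opNorm_le_bound _ (by positivity) fun w => ?_
  have integrand_le : ∀ r ∈ Set.Ioc s t,
      ‖Y t r (D r (V r s w))‖ ≤ c * Real.exp (l * (t - r)) * (d * (N * ‖w‖)) := fun r hr => by
    have hr' := Set.Ioc_subset_Icc_self hr
    exact (Y t r).le_of_opNorm_le_of_le (hY r hr')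
      ((D r).le_of_opNorm_le_of_le (hD r hr') ((V r s).le_of_opNorm_le (hVN r hr') w))
  have integral_le : ‖∫ r in s..t, Y t r (D r (V r s w))‖
      ≤ c * ((Real.exp (l * (t - s)) - 1) / l) * (d * (N * ‖w‖)) := by
    rw [← integral_exp_mul_sub_right hl.ne', ← intervalIntegral.integral_const_mul,
      ← intervalIntegral.integral_mul_const]
    exact intervalIntegral.norm_integral_le_of_norm_le hst (ae_of_all _ integrand_le)
      (Continuous.intervalIntegrable (by fun_prop) _ _)
  have hdNl : d * N / l ≤ 1 / 2 := by rw [div_le_iff₀ hl]; linarith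
  calc ‖Y t s w‖ = ‖V t s w - ∫ r in s..t, Y t r (D r (V r s w))‖ := by
        rw [hV.eq_add_integral s t hs hst w, add_sub_cancel_right]
    _ ≤ N * ‖w‖ + c * ((Real.exp (l * (t - s)) - 1) / l) * (d * (N * ‖w‖)) :=
        (norm_sub_le _ _).trans
          (add_le_add ((V t s).le_of_opNorm_le (hVN t ⟨hst, le_rfl⟩) w) integral_le)
    _ = N * ‖w‖ + c * (d * N / l * (Real.exp (l * (t - s)) - 1)) * ‖w‖ := by ring
    _ ≤ N * ‖w‖ + c * (1 / 2 * Real.exp (l * (t - s))) * ‖w‖ := by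
        have hexp : 1 ≤ Real.exp (l * (t - s)) :=
          Real.one_le_exp (mul_nonneg hl.le (sub_nonneg.2 hst))
        gcongr
        linarith
    _ = (N + c / 2 * Real.exp (l * (t - s))) * ‖w‖ := by ring

lemma IsPerturbedEvolution.isLocallyBounded_base [CompleteSpace H] (hY : IsEvolutionOperator Y)
    (hV : IsPerturbedEvolution Y D V) (hVb : IsLocallyBounded V)
    (hD : ∃ d : ℝ, ∀ t, 0 ≤ t → ‖D t‖ ≤ d) : IsLocallyBounded Y := by
  obtain ⟨d, hd⟩ := hD
  have hd0 : 0 ≤ d := (norm_nonneg _).trans (hd 0 le_rfl)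
  intro T
  obtain ⟨N, hN⟩ := hVb T
  set l : ℝ := 2 * (d * N) + 1 with hl
  refine ⟨2 * N * Real.exp (l * T), fun s t hs hst htT => ?_⟩
  have ht : 0 ≤ t := hs.trans hst
  have hN0 : 0 ≤ N := (norm_nonneg _).trans (hN s t hs hst htT)
  have hl0 : 0 < l := by positivity
  have weight_pos : ∀ s, 0 < Real.exp (l * (t - s)) := fun s => Real.exp_pos _
  have one_le_weight : ∀ s ∈ Set.Icc 0 t, 1 ≤ Real.exp (l * (t - s)) := fun s hs =>
    Real.one_le_exp (mul_nonneg hl0.le (sub_nonneg.2 hs.2))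
  let c := ⨆ s : Set.Icc 0 t, ‖Y t s‖ / Real.exp (l * (t - s))
  have hbdd : BddAbove (Set.range fun s : Set.Icc 0 t => ‖Y t s‖ / Real.exp (l * (t - s))) := by
    obtain ⟨b, hb⟩ := hY.exists_norm_le_right ht
    refine ⟨b, ?_⟩
    rintro _ ⟨⟨s, hs⟩, rfl⟩
    exact (div_le_self (norm_nonneg _) (one_le_weight s hs)).trans (hb s hs)
  have norm_le : ∀ s ∈ Set.Icc 0 t, ‖Y t s‖ ≤ c * Real.exp (l * (t - s)) := fun s hs =>
    (div_le_iff₀ (weight_pos s)).1 (le_ciSup hbdd ⟨s, hs⟩)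
  have hc : c ≤ N + c / 2 := by
    have : Nonempty (Set.Icc 0 t) := ⟨⟨t, ht, le_rfl⟩⟩
    refine ciSup_le fun ⟨s, hs⟩ => (div_le_iff₀ (weight_pos s)).2 ?_
    have h := hV.norm_base_le hs.1 hs.2 (fun r hr => hN s r hs.1 hr.1 (hr.2.trans htT))
      (fun r hr => hd r (hs.1.trans hr.1)) hl0 (by linarith)
      (fun r hr => norm_le r ⟨hs.1.trans hr.1, hr.2⟩)
    nlinarith [one_le_weight s hs]
  calc ‖Y t s‖ ≤ c * Real.exp (l * (t - s)) := norm_le s ⟨hs, hst⟩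
    _ ≤ 2 * N * Real.exp (l * T) := by
        gcongr
        · linarith
        · linarith

end Perturbation

end Evolution

section MildSolutions

/-- The mild solution of `z' = A z + f`, `z s = x`, for the evolution operator `U` of `A`. -/
noncomputable def mild {𝕜 E : Type*} [NontriviallyNormedField 𝕜] [NormedAddCommGroup E]
    [NormedSpace 𝕜 E] [NormedSpace ℝ E] (U : ℝ → ℝ → E →L[𝕜] E) (s : ℝ) (x : E) (f : ℝ → E)
    (t : ℝ) : E :=
  U t s x + ∫ r in s..t, U t r (f r)

lemma mild_congr {𝕜 E : Type*} [NontriviallyNormedField 𝕜] [NormedAddCommGroup E]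
    [NormedSpace 𝕜 E] [NormedSpace ℝ E] {U : ℝ → ℝ → E →L[𝕜] E} {s t : ℝ} (hst : s ≤ t) {x : E}
    {f g : ℝ → E} (h : ∀ᵐ r, r ∈ Set.Ioc s t → f r = g r) : mild U s x f t = mild U s x g t := by
  refine congrArg (U t s x + ·) (intervalIntegral.integral_congr_ae ?_)
  filter_upwards [h] with r hr hr'
  rw [hr (Set.uIoc_of_le hst ▸ hr')]

lemma intervalIntegrable_of_le {E : Type*} [NormedAddCommGroup E] {f : ℝ → E} {s r t : ℝ}
    (hf : IntervalIntegrable f volume s t) (hsr : s ≤ r) (hrt : r ≤ t) :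
    IntervalIntegrable f volume s r :=
  hf.mono_set (Set.uIcc_subset_uIcc_left (Set.mem_uIcc_of_le hsr hrt))

variable {𝕜 H : Type*} [RCLike 𝕜] [NormedAddCommGroup H] [InnerProductSpace 𝕜 H]
  [NormedSpace ℝ H]

namespace IsEvolutionOperator

variable {U : ℝ → ℝ → H →L[𝕜] H} (hU : IsEvolutionOperator U)
include hU

lemma mild_self {s : ℝ} (hs : 0 ≤ s) (x : H) (f : ℝ → H) : mild U s x f s = x := by
  simp [mild, hU.refl s hs]

variable (hUb : IsLocallyBounded U)
include hUb

lemma mild_eq_integral_extend_sub {s t T : ℝ} (hs : 0 ≤ s) (ht : t ∈ Set.Icc s T) (x : H)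
    {f : ℝ → H} (hf : IntervalIntegrable f volume s T) :
    mild U s x f t
      = U t s x + ((∫ r in s..T, extend U t r (f r)) - ∫ r in t..T, f r) := by
  have hi := hU.intervalIntegrable_extend_apply hUb (ht.1.trans ht.2) ht.2 hf
  have ht' := Set.mem_uIcc_of_le ht.1 ht.2
  have before : ∫ r in s..t, extend U t r (f r) = ∫ r in s..t, U t r (f r) := by
    refine intervalIntegral.integral_congr fun r hr => ?_
    rw [Set.uIcc_of_le ht.1] at hr
    simp only [extend_of_le U (hs.trans hr.1) hr.2]
  have after : ∫ r in t..T, extend U t r (f r) = ∫ r in t..T, f r := by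
    refine intervalIntegral.integral_congr fun r hr => ?_
    rw [Set.uIcc_of_le ht.2] at hr
    simp only [hU.extend_eq_id hr.1, ContinuousLinearMap.id_apply]
  rw [mild, ← intervalIntegral.integral_add_adjacent_intervals
    (hi.mono_set (Set.uIcc_subset_uIcc_left ht')) (hi.mono_set (Set.uIcc_subset_uIcc_right ht')),
    before, after, add_sub_cancel_right]

lemma continuousOn_integral_extend_apply {s T : ℝ} (hsT : s ≤ T) {f : ℝ → H}
    (hf : IntervalIntegrable f volume s T) :
    ContinuousOn (fun t => ∫ r in s..T, extend U t r (f r)) (Set.Icc s T) := by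
  obtain ⟨N, hN⟩ := hUb.extend T
  intro t _
  refine intervalIntegral.tendsto_integral_filter_of_dominated_convergence
    (fun r => N * ‖f r‖) ?_ ?_ (hf.norm.const_mul N) ?_
  · filter_upwards [self_mem_nhdsWithin] with t' ht'
    exact (hU.intervalIntegrable_extend_apply hUb hsT ht'.2 hf).def'.aestronglyMeasurable
  · filter_upwards [self_mem_nhdsWithin] with t' ht'
    refine ae_of_all _ fun r hr => (extend U t' r).le_of_opNorm_le (hN r t' ht'.2 ?_) _
    exact (Set.uIoc_of_le hsT ▸ hr).2
  · exact ae_of_all _ fun r _ =>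
      ((hU.continuous_extend_left r (f r)).tendsto t).mono_left nhdsWithin_le_nhds

lemma continuousOn_mild {s T : ℝ} (hs : 0 ≤ s) (x : H) {f : ℝ → H}
    (hf : IntervalIntegrable f volume s T) : ContinuousOn (mild U s x f) (Set.Icc s T) := by
  rcases lt_or_ge T s with hT | hT
  · rw [Set.Icc_eq_empty (not_le.2 hT)]
    exact continuousOn_empty _
  have hprimitive : ContinuousOn (fun t => ∫ r in t..T, f r) (Set.Icc s T) := by
    rw [← Set.uIcc_of_le hT]
    refine intervalIntegral.continuousOn_primitive_interval_left ?_
    rwa [Set.uIcc_of_le hT, ← intervalIntegrable_iff_integrableOn_Icc_of_le hT]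
  exact (((hU.continuousOn_left s hs x).mono Set.Icc_subset_Ici_self).add
    ((hU.continuousOn_integral_extend_apply hUb hT hf).sub hprimitive)).congr
    fun t ht => hU.mild_eq_integral_extend_sub hUb hs ht x hf

lemma mild_restart [CompleteSpace H] {s q t : ℝ} (hs : 0 ≤ s) (hsq : s ≤ q) (hqt : q ≤ t) (x : H)
    {f : ℝ → H} (hf : IntervalIntegrable f volume s t) :
    mild U s x f t = mild U q (mild U s x f q) f t := by
  have hq := Set.mem_uIcc_of_le hsq hqt
  have hi := hU.intervalIntegrable_apply hUb hs (hsq.trans hqt) hf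
  have transport : ∫ r in s..q, U t r (f r) = U t q (∫ r in s..q, U q r (f r)) := by
    rw [← ContinuousLinearMap.intervalIntegral_comp_comm _
      (hU.intervalIntegrable_apply hUb hs hsq (intervalIntegrable_of_le hf hsq hqt))]
    refine intervalIntegral.integral_congr fun r hr => ?_
    rw [Set.uIcc_of_le hsq] at hr
    simp only [← hU.comp r q t (hs.trans hr.1) hr.2 hqt, ContinuousLinearMap.comp_apply]
  rw [mild, mild, mild, map_add, ← intervalIntegral.integral_add_adjacent_intervals
    (hi.mono_set (Set.uIcc_subset_uIcc_left hq)) (hi.mono_set (Set.uIcc_subset_uIcc_right hq)),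
    transport, ← hU.comp s q t hs hsq hqt, ContinuousLinearMap.comp_apply, add_assoc]

end IsEvolutionOperator

variable {Y V : ℝ → ℝ → H →L[𝕜] H} {D : ℝ → H →L[𝕜] H}

lemma eq_zero_of_eq_integral (hYb : IsLocallyBounded Y) (hD : ∃ d : ℝ, ∀ t, 0 ≤ t → ‖D t‖ ≤ d)
    {s T : ℝ} (hs : 0 ≤ s) {e : ℝ → H} (hc : ContinuousOn e (Set.Icc s T))
    (he : ∀ t ∈ Set.Icc s T, e t = ∫ r in s..t, Y t r (D r (e r))) :
    ∀ t ∈ Set.Icc s T, e t = 0 := by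
  obtain ⟨d, hd⟩ := hD
  obtain ⟨N, hN⟩ := hYb T
  intro t ht
  rw [← norm_eq_zero]
  refine eq_zero_of_le_mul_integral (φ := fun t => ‖e t‖) (c := N * d) hc.norm
    (fun t _ => norm_nonneg _) (fun t ht => ?_) t ht
  rw [← intervalIntegral.integral_const_mul, he t ht]
  refine intervalIntegral.norm_integral_le_of_norm_le ht.1 (ae_of_all _ fun r hr => ?_)
    ((hc.mono (Set.Icc_subset_Icc_right ht.2)).norm.intervalIntegrable_of_Icc ht.1 |>.const_mul _)
  have hr0 : 0 ≤ r := hs.trans hr.1.le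
  rw [mul_assoc]
  exact (Y t r).le_of_opNorm_le_of_le (hN r t hr0 hr.2 ht.2) ((D r).le_of_opNorm_le (hd r hr0) _)

namespace IsPerturbedEvolution

theorem eq (hYb : IsLocallyBounded Y) {V' : ℝ → ℝ → H →L[𝕜] H} (hV : IsPerturbedEvolution Y D V)
    (hV' : IsPerturbedEvolution Y D V') (hD : ∃ d : ℝ, ∀ t, 0 ≤ t → ‖D t‖ ≤ d) {s t : ℝ}
    (hs : 0 ≤ s) (hst : s ≤ t) : V t s = V' t s := by
  ext x
  refine sub_eq_zero.1 (eq_zero_of_eq_integral (T := t) (e := fun t => V t s x - V' t s x)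
    hYb hD hs ?_ (fun r hr => ?_) t ⟨hst, le_rfl⟩)
  · exact ((hV.isEvolutionOperator.continuousOn_left s hs x).sub
      (hV'.isEvolutionOperator.continuousOn_left s hs x)).mono Set.Icc_subset_Ici_self
  · rw [hV.eq_add_integral s r hs hr.1 x, hV'.eq_add_integral s r hs hr.1 x,
      add_sub_add_left_eq_sub, ← intervalIntegral.integral_sub
        (hV.intervalIntegrable s r hs hr.1 x) (hV'.intervalIntegrable s r hs hr.1 x)]
    simp only [map_sub]

variable [CompleteSpace H] (hY : IsEvolutionOperator Y) (hYb : IsLocallyBounded Y)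
  (hV : IsPerturbedEvolution Y D V) (hVb : IsLocallyBounded V) (hD : IsBoundedContinuous D)
include hY hYb hV hVb hD

lemma integral_forcing_eq {s t : ℝ} (hs : 0 ≤ s) (hst : s ≤ t) {g : ℝ → H}
    (hg : IntervalIntegrable g volume s t) :
    ∫ q in s..t, V t q (g q)
      = (∫ q in s..t, Y t q (g q)) + ∫ r in s..t, Y t r (D r (∫ q in s..r, V r q (g q))) := by
  have hVe := hV.isEvolutionOperator
  have hk := integrableOn_duhamel_kernel hY hYb hVe hVb hD hs
    ((intervalIntegrable_iff_integrableOn_Ioc_of_le hst).1 hg)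
  calc ∫ q in s..t, V t q (g q)
      = ∫ q in s..t, (Y t q (g q) + ∫ r in q..t, Y t r (D r (V r q (g q)))) := by
        refine intervalIntegral.integral_congr fun q hq => ?_
        rw [Set.uIcc_of_le hst] at hq
        exact hV.eq_add_integral q t (hs.trans hq.1) hq.2 (g q)
    _ = (∫ q in s..t, Y t q (g q)) + ∫ q in s..t, ∫ r in q..t, Y t r (D r (V r q (g q))) :=
        intervalIntegral.integral_add (hY.intervalIntegrable_apply hYb hs hst hg)
          (intervalIntegrable_integral_triangle_left hst hk)
    _ = (∫ q in s..t, Y t q (g q)) + ∫ r in s..t, ∫ q in s..r, Y t r (D r (V r q (g q))) := by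
        rw [integral_integral_triangle_swap hst hk]
    _ = _ := by
        refine congrArg _ (intervalIntegral.integral_congr fun r hr => ?_)
        rw [Set.uIcc_of_le hst] at hr
        exact ((Y t r) ∘L D r).intervalIntegral_comp_comm (hVe.intervalIntegrable_apply hVb hs hr.1
          (intervalIntegrable_of_le hg hr.1 hr.2))

theorem mild_eq {s t : ℝ} (hs : 0 ≤ s) (hst : s ≤ t) (x : H) {g : ℝ → H}
    (hg : IntervalIntegrable g volume s t) :
    mild V s x g t = mild Y s x (fun r => g r + D r (mild V s x g r)) t := by
  have hVg : IntervalIntegrable (fun r => D r (mild V s x g r)) volume s t :=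
    intervalIntegrable_clm_apply hst (hD.1.mono fun r hr => hs.trans hr.1)
      ((hV.isEvolutionOperator.continuousOn_mild hVb hs x hg).intervalIntegrable_of_Icc hst)
  have hYDV := hY.intervalIntegrable_apply hYb hs hst hVg
  have hYg := hY.intervalIntegrable_apply hYb hs hst hg
  have feedback_split : ∫ r in s..t, Y t r (D r (∫ q in s..r, V r q (g q)))
      = (∫ r in s..t, Y t r (D r (mild V s x g r))) - ∫ r in s..t, Y t r (D r (V r s x)) := by
    rw [← intervalIntegral.integral_sub hYDV (hV.intervalIntegrable s t hs hst x)]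
    simp only [mild, map_add, add_sub_cancel_left]
  calc mild V s x g t
      = Y t s x + (∫ r in s..t, Y t r (D r (V r s x))) + ∫ q in s..t, V t q (g q) := by
        rw [mild, hV.eq_add_integral s t hs hst x]
    _ = Y t s x + ((∫ r in s..t, Y t r (g r)) + ∫ r in s..t, Y t r (D r (mild V s x g r))) := by
        rw [hV.integral_forcing_eq hY hYb hVb hD hs hst hg, feedback_split]
        abel
    _ = _ := by
        rw [← intervalIntegral.integral_add hYg hYDV]
        simp only [mild, map_add]

theorem mild_eq_sub {s t : ℝ} (hs : 0 ≤ s) (hst : s ≤ t) (x : H) {f : ℝ → H}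
    (hf : IntervalIntegrable f volume s t) :
    mild Y s x f t = mild V s x (fun r => f r - D r (mild Y s x f r)) t := by
  set z := mild Y s x f with hz
  set g : ℝ → H := fun r => f r - D r (z r) with hg
  have integrable_feedback : ∀ {e : ℝ → H}, ContinuousOn e (Set.Icc s t) →
      IntervalIntegrable (fun r => D r (e r)) volume s t := fun he =>
    intervalIntegrable_clm_apply hst (hD.1.mono fun r hr => hs.trans hr.1)
      (he.intervalIntegrable_of_Icc hst)
  have hzc : ContinuousOn z (Set.Icc s t) := hY.continuousOn_mild hYb hs x hf
  have hgi : IntervalIntegrable g volume s t := hf.sub (integrable_feedback hzc)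
  have hwc : ContinuousOn (mild V s x g) (Set.Icc s t) :=
    hV.isEvolutionOperator.continuousOn_mild hVb hs x hgi
  refine sub_eq_zero.1 (eq_zero_of_eq_integral hYb hD.2 hs (hzc.sub hwc) (fun r hr => ?_) t
    ⟨hst, le_rfl⟩)
  have hY_integrable : ∀ {e : ℝ → H}, IntervalIntegrable e volume s t →
      IntervalIntegrable (fun q => Y r q (e q)) volume s r := fun he =>
    hY.intervalIntegrable_apply hYb hs hr.1 (intervalIntegrable_of_le he hr.1 hr.2)
  rw [Pi.sub_apply, hV.mild_eq hY hYb hVb hD hs hr.1 x (intervalIntegrable_of_le hgi hr.1 hr.2), hz,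
    mild, mild, add_sub_add_left_eq_sub, ← intervalIntegral.integral_sub (hY_integrable hf)
      (hY_integrable (hgi.add (integrable_feedback hwc)))]
  refine intervalIntegral.integral_congr fun q _ => ?_
  simp only [hg, ← map_sub, Pi.sub_apply]
  congr 1
  simp only [map_sub]
  abel

end IsPerturbedEvolution

end MildSolutions

/-! ### Minimal sections and square roots -/

section MinimalSection

variable {𝕜 H E : Type*} [RCLike 𝕜] [NormedAddCommGroup H] [InnerProductSpace 𝕜 H]
  [NormedAddCommGroup E] [InnerProductSpace 𝕜 E]

lemma exists_orthogonal_of_mem [CompleteSpace E] {Γ : Submodule 𝕜 (H × E)}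
    (hΓ : IsClosed (Γ : Set (H × E))) {x : H} {g : E} (hg : (x, g) ∈ Γ) :
    ∃ f, (x, f) ∈ Γ ∧ (∀ k, (0, k) ∈ Γ → inner 𝕜 f k = 0) ∧ ‖f‖ ≤ ‖g‖ := by
  let Γ₀ : Submodule 𝕜 E := Γ.comap (LinearMap.inr 𝕜 H E)
  have hΓ₀ : IsClosed (Γ₀ : Set E) := hΓ.preimage (f := fun k : E => ((0 : H), k)) (by fun_prop)
  have : CompleteSpace Γ₀ := hΓ₀.completeSpace_coe
  have hproj : Γ₀.starProjection g ∈ Γ₀ := Γ₀.starProjection_apply_mem g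
  refine ⟨g - Γ₀.starProjection g, by simpa using Γ.sub_mem hg hproj,
    fun k hk => Submodule.starProjection_inner_eq_zero g k hk, ?_⟩
  rw [← Submodule.starProjection_orthogonal_val]
  exact Submodule.norm_starProjection_apply_le _ g

lemma eq_of_orthogonal_of_mem {Γ : Submodule 𝕜 (H × E)} {x : H} {f g : E} (hf : (x, f) ∈ Γ)
    (hf₀ : ∀ k, (0, k) ∈ Γ → inner 𝕜 f k = 0) (hg : (x, g) ∈ Γ)
    (hg₀ : ∀ k, (0, k) ∈ Γ → inner 𝕜 g k = 0) : f = g := by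
  have h : (0, f - g) ∈ Γ := by simpa using Γ.sub_mem hf hg
  rw [← sub_eq_zero, ← inner_self_eq_zero (𝕜 := 𝕜), inner_sub_left, hf₀ _ h, hg₀ _ h, sub_zero]

theorem exists_minimal_section [CompleteSpace E] (Γ : Submodule 𝕜 (H × E))
    (hΓ : IsClosed (Γ : Set (H × E))) {C : ℝ} (hC : ∀ x, ∃ g, (x, g) ∈ Γ ∧ ‖g‖ ≤ C * ‖x‖) :
    ∃ T : H →L[𝕜] E, (∀ x, (x, T x) ∈ Γ) ∧ (∀ x g, (0, g) ∈ Γ → inner 𝕜 (T x) g = 0) ∧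
      ∀ x, ‖T x‖ ≤ C * ‖x‖ := by
  have hmin (x : H) :
      ∃ f, (x, f) ∈ Γ ∧ (∀ k, (0, k) ∈ Γ → inner 𝕜 f k = 0) ∧ ‖f‖ ≤ C * ‖x‖ := by
    obtain ⟨g, hg, hgC⟩ := hC x
    obtain ⟨f, hf, hf₀, hfg⟩ := exists_orthogonal_of_mem hΓ hg
    exact ⟨f, hf, hf₀, hfg.trans hgC⟩
  choose T hT hT₀ hTC using hmin
  let L : H →ₗ[𝕜] E :=
    { toFun := T
      map_add' := fun x y => by
        refine eq_of_orthogonal_of_mem (hT _) (hT₀ _) (by simpa using Γ.add_mem (hT x) (hT y))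
          fun k hk => ?_
        rw [inner_add_left, hT₀ x _ hk, hT₀ y _ hk, add_zero]
      map_smul' := fun a x => by
        refine eq_of_orthogonal_of_mem (hT _) (hT₀ _) (by simpa using Γ.smul_mem a (hT x))
          fun k hk => ?_
        rw [inner_smul_left, hT₀ x _ hk, mul_zero] }
  exact ⟨L.mkContinuous C hTC, hT, hT₀, hTC⟩

end MinimalSection

section PositiveOperators

variable {𝕜 H : Type*} [RCLike 𝕜] [NormedAddCommGroup H] [InnerProductSpace 𝕜 H]

lemma eq_of_re_inner_eq {P Q : H →L[𝕜] H} (hP : P.IsPositive) (hQ : Q.IsPositive)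
    (h : ∀ x, RCLike.re (inner 𝕜 (P x) x) = RCLike.re (inner 𝕜 (Q x) x)) : P = Q := by
  have hsymm : ((P - Q : H →L[𝕜] H) : H →ₗ[𝕜] H).IsSymmetric := by
    simpa only [ContinuousLinearMap.toLinearMap_sub] using hP.isSymmetric.sub hQ.isSymmetric
  have hzero : ((P - Q : H →L[𝕜] H) : H →ₗ[𝕜] H) = 0 := by
    refine hsymm.inner_map_self_eq_zero.1 fun x => ?_
    rw [← hsymm.coe_re_inner_apply_self x]
    simp [inner_sub_left, h x]
  exact sub_eq_zero.1 (ContinuousLinearMap.coe_injective hzero)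

lemma abs_re_inner_apply_le (A : H →L[𝕜] H) (x y : H) :
    |RCLike.re (inner 𝕜 (A x) y)| ≤ ‖A‖ * ‖x‖ * ‖y‖ :=
  (RCLike.abs_re_le_norm _).trans ((norm_inner_le_norm _ _).trans (by gcongr; exact A.le_opNorm x))

variable [CompleteSpace H]

lemma exists_norm_apply_sub_smul_le {D : H →L[𝕜] H} (hD : IsSelfAdjoint D) (hD0 : D ≠ 0) {ε : ℝ}
    (hε : 0 < ε) : ∃ x ≠ 0, ∃ l : ℝ, |l| = ‖D‖ ∧ ‖D x - (l : 𝕜) • x‖ ≤ ε * ‖x‖ := by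
  set d := ‖D‖
  have hd0 : 0 < d := norm_pos_iff.2 hD0
  set δ := ε ^ 2 / (2 * d) with hδ
  obtain ⟨x, hx⟩ : ∃ x, max (d - δ) 0 < |D.rayleighQuotient x| := by
    refine exists_lt_of_lt_ciSup (lt_of_lt_of_eq (max_lt (sub_lt_self d (by positivity)) hd0) ?_)
    exact ContinuousLinearMap.norm_eq_iSup_rayleighQuotient D hD.isSymmetric
  have hx0 : x ≠ 0 := by
    rintro rfl
    simp at hx
  have : 0 < ‖x‖ := norm_pos_iff.2 hx0
  set p := RCLike.re (inner 𝕜 (D x) x)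
  have hpx : (d - δ) * ‖x‖ ^ 2 ≤ |p| := by
    have h := (le_max_left _ _).trans hx.le
    rwa [ContinuousLinearMap.rayleighQuotient, abs_div, abs_of_nonneg (sq_nonneg ‖x‖),
      le_div_iff₀ (by positivity)] at h
  obtain ⟨l, hl, hlp⟩ : ∃ l : ℝ, |l| = d ∧ l * p = d * |p| := by
    rcases le_total 0 p with h | h
    · exact ⟨d, abs_of_pos hd0, by rw [abs_of_nonneg h]⟩
    · exact ⟨-d, by rw [abs_neg, abs_of_pos hd0], by rw [abs_of_nonpos h]; ring⟩
  refine ⟨x, hx0, l, hl, abs_le_of_sq_le_sq' ?_ (by positivity) |>.2⟩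
  have hexpand : ‖D x - (l : 𝕜) • x‖ ^ 2 = ‖D x‖ ^ 2 - 2 * (d * |p|) + (d * ‖x‖) ^ 2 := by
    rw [norm_sub_sq (𝕜 := 𝕜), inner_smul_right, RCLike.re_ofReal_mul, norm_smul,
      RCLike.norm_ofReal, hl, hlp]
  have hDx : ‖D x‖ ^ 2 ≤ (d * ‖x‖) ^ 2 := by gcongr; exact D.le_opNorm x
  calc ‖D x - (l : 𝕜) • x‖ ^ 2
      ≤ (d * ‖x‖) ^ 2 - 2 * (d * ((d - δ) * ‖x‖ ^ 2)) + (d * ‖x‖) ^ 2 := by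
        rw [hexpand]; gcongr
    _ = (ε * ‖x‖) ^ 2 := by rw [hδ]; field_simp; ring

lemma re_inner_mul_self_sub_apply {S T : H →L[𝕜] H} (hS : IsSelfAdjoint S) (hT : IsSelfAdjoint T)
    {x r : H} {l : ℝ} (hx : (S - T) x = (l : 𝕜) • x + r) :
    RCLike.re (inner 𝕜 ((S * S - T * T) x) x)
      = l * (RCLike.re (inner 𝕜 (S x) x) + RCLike.re (inner 𝕜 (T x) x))
        + RCLike.re (inner 𝕜 (S x) r) + RCLike.re (inner 𝕜 (T x) r) := by
  have hfactor : (S * S - T * T) x = S ((S - T) x) + (S - T) (T x) := by simp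
  have hleft : inner 𝕜 (S ((S - T) x)) x = inner 𝕜 ((S - T) x) (S x) := hS.isSymmetric _ _
  have hright : inner 𝕜 ((S - T) (T x)) x = inner 𝕜 (T x) ((S - T) x) :=
    (hS.sub hT).isSymmetric _ _
  have hxS : RCLike.re (inner 𝕜 x (S x)) = RCLike.re (inner 𝕜 (S x) x) := inner_re_symm _ _
  rw [hfactor, inner_add_left, hleft, hright, hx, inner_add_left, inner_add_right, inner_smul_left,
    inner_smul_right, RCLike.conj_ofReal]
  simp only [map_add, RCLike.re_ofReal_mul, hxS, inner_re_symm r]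
  ring

lemma norm_sub_sq_le_add_mul {S T : H →L[𝕜] H} (hS : S.IsPositive) (hT : T.IsPositive) {x : H}
    (hx : x ≠ 0) {l ε : ℝ} (hl : |l| = ‖S - T‖)
    (hxl : ‖(S - T) x - (l : 𝕜) • x‖ ≤ ε * ‖x‖) :
    ‖S - T‖ ^ 2 ≤ ‖S * S - T * T‖ + (‖S‖ + ‖T‖ + ‖S - T‖) * ε := by
  set D := S - T with hD
  set r := D x - (l : 𝕜) • x with hr
  set a := RCLike.re (inner 𝕜 (S x) x) + RCLike.re (inner 𝕜 (T x) x)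
  have hDx : D x = (l : 𝕜) • x + r := by rw [hr]; abel
  have hxpos : 0 < ‖x‖ := norm_pos_iff.2 hx
  have hSx : 0 ≤ RCLike.re (inner 𝕜 (S x) x) := hS.re_inner_nonneg_left x
  have hTx : 0 ≤ RCLike.re (inner 𝕜 (T x) x) := hT.re_inner_nonneg_left x
  have hsq : RCLike.re (inner 𝕜 ((S * S - T * T) x) x)
      = l * a + RCLike.re (inner 𝕜 (S x) r) + RCLike.re (inner 𝕜 (T x) r) :=
    re_inner_mul_self_sub_apply hS.isSelfAdjoint hT.isSelfAdjoint hDx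
  have hDa : (‖D‖ - ε) * ‖x‖ ^ 2 ≤ a := by
    have hDxx : RCLike.re (inner 𝕜 (D x) x) = l * ‖x‖ ^ 2 + RCLike.re (inner 𝕜 r x) := by
      rw [hDx, inner_add_left, inner_smul_left, RCLike.conj_ofReal, map_add,
        RCLike.re_ofReal_mul, inner_self_eq_norm_sq]
    have hrx : |RCLike.re (inner 𝕜 r x)| ≤ ε * ‖x‖ * ‖x‖ :=
      (RCLike.abs_re_le_norm _).trans ((norm_inner_le_norm _ _).trans (by gcongr))
    have hDST : RCLike.re (inner 𝕜 (D x) x)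
        = RCLike.re (inner 𝕜 (S x) x) - RCLike.re (inner 𝕜 (T x) x) := by
      simp [hD, inner_sub_left]
    rcases abs_cases l with ⟨h, -⟩ | ⟨h, -⟩ <;> nlinarith [abs_le.1 hrx]
  have hl_a : ‖D‖ * a ≤ ‖S * S - T * T‖ * ‖x‖ ^ 2 + (‖S‖ + ‖T‖) * ε * ‖x‖ ^ 2 := by
    have hsq' := abs_re_inner_apply_le (S * S - T * T) x x
    have hSr := abs_re_inner_apply_le S x r
    have hTr := abs_re_inner_apply_le T x r
    have hSr' : ‖S‖ * ‖x‖ * ‖r‖ ≤ ‖S‖ * ‖x‖ * (ε * ‖x‖) := by gcongr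
    have hTr' : ‖T‖ * ‖x‖ * ‖r‖ ≤ ‖T‖ * ‖x‖ * (ε * ‖x‖) := by gcongr
    have hla : ‖D‖ * a = |l * a| := by rw [abs_mul, hl, abs_of_nonneg (add_nonneg hSx hTx)]
    rw [hla, abs_le]
    constructor <;> nlinarith [abs_le.1 hsq', abs_le.1 hSr, abs_le.1 hTr]
  refine le_of_mul_le_mul_right ?_ (pow_pos hxpos 2)
  nlinarith [mul_le_mul_of_nonneg_left hDa (norm_nonneg D)]

theorem norm_sub_sq_le_norm_mul_self_sub {S T : H →L[𝕜] H} (hS : S.IsPositive)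
    (hT : T.IsPositive) : ‖S - T‖ ^ 2 ≤ ‖S * S - T * T‖ := by
  rcases eq_or_ne (S - T) 0 with h0 | h0
  · simp [h0]
  have hev : ∀ᶠ ε in 𝓝[>] (0 : ℝ),
      ‖S - T‖ ^ 2 ≤ ‖S * S - T * T‖ + (‖S‖ + ‖T‖ + ‖S - T‖) * ε := by
    filter_upwards [self_mem_nhdsWithin] with ε hε
    obtain ⟨x, hx, l, hl, hxl⟩ :=
      exists_norm_apply_sub_smul_le (hS.isSelfAdjoint.sub hT.isSelfAdjoint) h0 hε
    exact norm_sub_sq_le_add_mul hS hT hx hl hxl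
  refine ge_of_tendsto (tendsto_nhdsWithin_of_tendsto_nhds ?_) hev
  exact Continuous.tendsto' (by fun_prop) _ _ (by simp)

lemma continuousOn_posSqrt {α : Type*} [TopologicalSpace α] {W : α → H →L[𝕜] H} {S : Set α}
    (hW : ContinuousOn W S) (hpos : ∀ t ∈ S, (W t).IsPositive) :
    ContinuousOn (fun t => posSqrt (W t)) S := by
  intro t ht
  have hsqrt : Tendsto (fun x => √‖W x - W t‖) (𝓝[S] t) (𝓝 0) := by
    simpa using (tendsto_iff_norm_sub_tendsto_zero.1 (hW t ht)).sqrt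
  rw [ContinuousWithinAt, tendsto_iff_norm_sub_tendsto_zero]
  refine squeeze_zero' (Eventually.of_forall fun _ => norm_nonneg _) ?_ hsqrt
  filter_upwards [self_mem_nhdsWithin] with x hx
  refine Real.le_sqrt_of_sq_le ?_
  simpa only [posSqrt_mul_self (hpos x hx), posSqrt_mul_self (hpos t ht)] using
    norm_sub_sq_le_norm_mul_self_sub (posSqrt_isPositive (hpos x hx))
      (posSqrt_isPositive (hpos t ht))

lemma adjoint_posSqrt_comp_self {W : H →L[𝕜] H} (hW : W.IsPositive) :
    (posSqrt W).adjoint ∘L posSqrt W = W := by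
  rw [(posSqrt_isPositive hW).isSelfAdjoint.adjoint_eq]
  exact posSqrt_mul_self hW

lemma norm_posSqrt_apply_sq {W : H →L[𝕜] H} (hW : W.IsPositive) (x : H) :
    ‖posSqrt W x‖ ^ 2 = RCLike.re (inner 𝕜 x (W x)) := by
  conv_rhs =>
    rw [← adjoint_posSqrt_comp_self hW, ContinuousLinearMap.comp_apply,
      ContinuousLinearMap.adjoint_inner_right, inner_self_eq_norm_sq]

lemma norm_posSqrt_sq_le {W : H →L[𝕜] H} (hW : W.IsPositive) : ‖posSqrt W‖ ^ 2 ≤ ‖W‖ := by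
  have hS : IsSelfAdjoint (posSqrt W) := (posSqrt_isPositive hW).isSelfAdjoint
  have h := CStarRing.norm_star_mul_self (x := posSqrt W)
  rw [hS.star_eq, posSqrt_mul_self hW] at h
  rw [sq, h]

lemma IsBoundedContinuous.posSqrt {W : ℝ → H →L[𝕜] H} (hW : IsBoundedContinuous W)
    (hpos : ∀ t, 0 ≤ t → (W t).IsPositive) : IsBoundedContinuous fun t => posSqrt (W t) := by
  obtain ⟨c, hc⟩ := hW.2
  exact ⟨continuousOn_posSqrt hW.1 hpos, √c, fun t ht =>
    Real.le_sqrt_of_sq_le ((norm_posSqrt_sq_le (hpos t ht)).trans (hc t ht))⟩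

end PositiveOperators

/-! ### Exponential stability -/

section SquareIntegrals

variable {s t : ℝ}

lemma intervalIntegrable_of_norm_sq {E : Type*} [NormedAddCommGroup E] {f : ℝ → E} (hst : s ≤ t)
    (hm : AEStronglyMeasurable f (volume.restrict (Set.Ioc s t)))
    (hf : IntervalIntegrable (fun r => ‖f r‖ ^ 2) volume s t) :
    IntervalIntegrable f volume s t := by
  rw [intervalIntegrable_iff_integrableOn_Ioc_of_le hst] at hf ⊢
  exact ((memLp_two_iff_integrable_sq_norm hm).2 hf).integrable one_le_two

lemma sq_integral_mul_le {w φ : ℝ → ℝ} (hst : s ≤ t) (hw : ContinuousOn w (Set.uIcc s t))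
    (hw0 : ∀ r, 0 ≤ w r) (hφ : IntervalIntegrable φ volume s t)
    (hφ2 : IntervalIntegrable (fun r => φ r ^ 2) volume s t) :
    (∫ r in s..t, w r * φ r) ^ 2 ≤ (∫ r in s..t, w r) * ∫ r in s..t, w r * φ r ^ 2 := by
  have hwφ : IntervalIntegrable (fun r => w r * φ r) volume s t := hφ.continuousOn_mul hw
  have hwφ2 : IntervalIntegrable (fun r => w r * φ r ^ 2) volume s t := hφ2.continuousOn_mul hw
  have hquad (c : ℝ) : 0 ≤ (∫ r in s..t, w r) * (c * c) + (-2 * ∫ r in s..t, w r * φ r) * c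
      + ∫ r in s..t, w r * φ r ^ 2 := by
    have hnonneg : 0 ≤ ∫ r in s..t, w r * (φ r - c) ^ 2 :=
      intervalIntegral.integral_nonneg hst fun r _ => mul_nonneg (hw0 r) (sq_nonneg _)
    have hexpand (r : ℝ) : w r * (φ r - c) ^ 2
        = w r * φ r ^ 2 - 2 * c * (w r * φ r) + c * c * w r := by ring
    simp_rw [hexpand] at hnonneg
    rw [intervalIntegral.integral_add (hwφ2.sub (hwφ.const_mul _))
        (hw.intervalIntegrable.const_mul _),
      intervalIntegral.integral_sub hwφ2 (hwφ.const_mul _), intervalIntegral.integral_const_mul,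
      intervalIntegral.integral_const_mul] at hnonneg
    linarith
  have h := discrim_le_zero hquad
  rw [discrim] at h
  linarith

end SquareIntegrals

section ExponentialKernels

variable {s t α : ℝ}

lemma integral_exp_neg_mul_sub_right_le (hα : 0 < α) (s t : ℝ) :
    ∫ r in s..t, Real.exp (-α * (t - r)) ≤ 1 / α := by
  rw [integral_exp_mul_sub_right (neg_ne_zero.2 hα.ne'), div_neg, ← neg_div, neg_sub]
  exact div_le_div_of_nonneg_right (by linarith [Real.exp_pos (-α * (t - s))]) hα.le

lemma integral_exp_neg_mul_sub_left_le (hα : 0 < α) (s t : ℝ) :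
    ∫ r in s..t, Real.exp (-α * (r - s)) ≤ 1 / α := by
  have h := intervalIntegral.integral_comp_sub_left (a := s) (b := t)
    (fun r => Real.exp (-α * (t - r))) (s + t)
  simp only [add_sub_cancel_right, add_sub_cancel_left] at h
  refine le_of_eq_of_le ?_ (integral_exp_neg_mul_sub_right_le hα s t)
  rw [← h]
  exact intervalIntegral.integral_congr fun r _ => by ring_nf

variable {F : ℝ → ℝ}

lemma integrableOn_exp_mul_triangle (hα : 0 ≤ α) (hst : s ≤ t)
    (hF : IntervalIntegrable F volume s t) :
    IntegrableOn (Function.uncurry fun r q => Real.exp (-α * (r - q)) * F q) (triangle s t) := by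
  rw [intervalIntegrable_iff_integrableOn_Ioc_of_le hst] at hF
  refine integrableOn_triangle_of_norm_le (c := 1) ?_ hF fun q r _ hqr _ => ?_
  · exact (Continuous.aestronglyMeasurable (by fun_prop)).mul
      (aestronglyMeasurable_snd_triangle hF.aestronglyMeasurable)
  · rw [norm_mul, Real.norm_of_nonneg (Real.exp_pos _).le]
    gcongr
    exact Real.exp_le_one_iff.2 (by nlinarith)

lemma integral_integral_exp_mul_le (hα : 0 < α) (hst : s ≤ t) (hF0 : ∀ r, 0 ≤ F r)
    (hF : IntervalIntegrable F volume s t) :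
    ∫ r in s..t, ∫ q in s..r, Real.exp (-α * (r - q)) * F q ≤ 1 / α * ∫ q in s..t, F q := by
  have hk := integrableOn_exp_mul_triangle hα.le hst hF
  rw [← integral_integral_triangle_swap hst hk, ← intervalIntegral.integral_const_mul]
  refine intervalIntegral.integral_mono_on hst (intervalIntegrable_integral_triangle_left hst hk)
    (hF.const_mul _) fun q _ => ?_
  rw [intervalIntegral.integral_mul_const]
  exact mul_le_mul_of_nonneg_right (integral_exp_neg_mul_sub_left_le hα q t) (hF0 q)

end ExponentialKernels

section Stability

variable {𝕜 H : Type*} [RCLike 𝕜] [NormedAddCommGroup H] [InnerProductSpace 𝕜 H]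
  {V : ℝ → ℝ → H →L[𝕜] H}

namespace IsEvolutionOperator

variable (hV : IsEvolutionOperator V)
include hV

lemma sub_mul_norm_sq_le {c : ℝ} (hc : 0 ≤ c)
    (hbd : ∀ s t, 0 ≤ s → s ≤ t → ∀ x, ‖V t s x‖ ^ 2 ≤ c * ‖x‖ ^ 2)
    (hint : ∀ s t, 0 ≤ s → s ≤ t → ∀ x, ∫ r in s..t, ‖V r s x‖ ^ 2 ≤ c * ‖x‖ ^ 2) {s t : ℝ}
    (hs : 0 ≤ s) (hst : s ≤ t) (x : H) : (t - s) * ‖V t s x‖ ^ 2 ≤ c * (c * ‖x‖ ^ 2) := by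
  have hi : IntervalIntegrable (fun r => c * ‖V r s x‖ ^ 2) volume s t := by
    refine ContinuousOn.intervalIntegrable ?_
    rw [Set.uIcc_of_le hst]
    exact (((hV.continuousOn_left s hs x).mono Set.Icc_subset_Ici_self).norm.pow 2).const_smul c
  calc (t - s) * ‖V t s x‖ ^ 2 = ∫ _ in s..t, ‖V t s x‖ ^ 2 := by simp
    _ ≤ ∫ r in s..t, c * ‖V r s x‖ ^ 2 := by
      refine intervalIntegral.integral_mono_on hst (by simp) hi fun r hr => ?_
      rw [← hV.comp s r t hs hr.1 hr.2]
      exact hbd r t (hs.trans hr.1) hr.2 _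
    _ ≤ c * (c * ‖x‖ ^ 2) := by
      rw [intervalIntegral.integral_const_mul]
      exact mul_le_mul_of_nonneg_left (hint s t hs hst x) hc

lemma norm_le_mul_pow {M τ : ℝ} (hτ : 0 ≤ τ) (hM : 0 ≤ M)
    (hbd : ∀ s t, 0 ≤ s → s ≤ t → ‖V t s‖ ≤ M)
    (hhalf : ∀ s, 0 ≤ s → ‖V (s + τ) s‖ ≤ 1 / 2) (n : ℕ) :
    ∀ s t, 0 ≤ s → s + n * τ ≤ t → ‖V t s‖ ≤ M * (1 / 2) ^ n := by
  induction n with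
  | zero => exact fun s t hs hst => by simpa using hbd s t hs (by simpa using hst)
  | succ n ih =>
    intro s t hs hst
    push_cast at hst
    have hnτ : 0 ≤ n * τ := by positivity
    rw [← hV.comp s (s + τ) t hs (by linarith) (by linarith), pow_succ, ← mul_assoc]
    exact (ContinuousLinearMap.opNorm_comp_le _ _).trans
      (mul_le_mul (ih (s + τ) t (by linarith) (by linarith)) (hhalf s hs) (norm_nonneg _)
        (by positivity))

lemma isExponentiallyStable_of_norm_le_half {M τ : ℝ} (hτ : 0 < τ) (hM : 0 ≤ M)
    (hbd : ∀ s t, 0 ≤ s → s ≤ t → ‖V t s‖ ≤ M)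
    (hhalf : ∀ s, 0 ≤ s → ‖V (s + τ) s‖ ≤ 1 / 2) : IsExponentiallyStable V := by
  have : 0 < Real.log 2 := Real.log_pos one_lt_two
  refine ⟨2 * M, Real.log 2 / τ, by positivity, by positivity, fun s t hs hst => ?_⟩
  set n := ⌊(t - s) / τ⌋₊
  have hle : n * τ ≤ t - s := by
    rw [← le_div_iff₀ hτ]
    exact Nat.floor_le (div_nonneg (sub_nonneg.2 hst) hτ.le)
  have hlt : (t - s) / τ < n + 1 := Nat.lt_floor_add_one _
  have hpow : (1 / 2 : ℝ) ^ n = 2 * Real.exp (-(Real.log 2 * (n + 1))) := by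
    rw [Real.exp_neg, Real.exp_mul, Real.exp_log two_pos, ← Nat.cast_succ, Real.rpow_natCast,
      pow_succ, div_pow, one_pow]
    field_simp
  calc ‖V t s‖ ≤ M * (1 / 2) ^ n := hV.norm_le_mul_pow hτ.le hM hbd hhalf n s t hs (by linarith)
    _ = 2 * M * Real.exp (-(Real.log 2 * (n + 1))) := by rw [hpow]; ring
    _ ≤ 2 * M * Real.exp (-(Real.log 2 / τ) * (t - s)) := by
      gcongr
      rw [neg_mul, div_mul_comm, mul_comm]
      gcongr

theorem isExponentiallyStable_of_integral_le {c : ℝ}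
    (hbd : ∀ s t, 0 ≤ s → s ≤ t → ∀ x, ‖V t s x‖ ^ 2 ≤ c * ‖x‖ ^ 2)
    (hint : ∀ s t, 0 ≤ s → s ≤ t → ∀ x, ∫ r in s..t, ‖V r s x‖ ^ 2 ≤ c * ‖x‖ ^ 2) :
    IsExponentiallyStable V := by
  wlog hc : 0 ≤ c generalizing c
  · have hc0 (x : H) : c * ‖x‖ ^ 2 ≤ 0 * ‖x‖ ^ 2 :=
      mul_le_mul_of_nonneg_right (le_of_not_ge hc) (sq_nonneg _)
    exact this (fun s t hs hst x => (hbd s t hs hst x).trans (hc0 x))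
      (fun s t hs hst x => (hint s t hs hst x).trans (hc0 x)) le_rfl
  have hτ : 0 < 4 * c ^ 2 + 1 := by positivity
  refine hV.isExponentiallyStable_of_norm_le_half hτ (Real.sqrt_nonneg c)
    (fun s t hs hst => ?_) fun s hs => ?_
  · refine ContinuousLinearMap.opNorm_le_bound _ (Real.sqrt_nonneg c) fun x => ?_
    refine abs_le_of_sq_le_sq' ?_ (by positivity) |>.2
    rw [mul_pow, Real.sq_sqrt hc]
    exact hbd s t hs hst x
  · refine ContinuousLinearMap.opNorm_le_bound _ (by norm_num) fun x => ?_
    refine abs_le_of_sq_le_sq' ?_ (by positivity) |>.2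
    have h := hV.sub_mul_norm_sq_le hc hbd hint hs (le_add_of_nonneg_right hτ.le) x
    rw [add_sub_cancel_left] at h
    refine le_of_mul_le_mul_left (h.trans ?_) hτ
    nlinarith [sq_nonneg ‖x‖]

end IsEvolutionOperator

variable [NormedSpace ℝ H]

lemma norm_mild_sq_le {M α : ℝ} (hα : 0 < α)
    (hVb : ∀ s t, 0 ≤ s → s ≤ t → ‖V t s‖ ≤ M * Real.exp (-α * (t - s)))
    {s t : ℝ} (hs : 0 ≤ s) (hst : s ≤ t) (x : H) {f : ℝ → H}
    (hf : IntervalIntegrable f volume s t)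
    (hf2 : IntervalIntegrable (fun r => ‖f r‖ ^ 2) volume s t) :
    ‖mild V s x f t‖ ^ 2 ≤ 2 * M ^ 2 * (Real.exp (-α * (t - s)) * ‖x‖ ^ 2
      + 1 / α * ∫ r in s..t, Real.exp (-α * (t - r)) * ‖f r‖ ^ 2) := by
  have hexp : ContinuousOn (fun r => Real.exp (-α * (t - r))) (Set.uIcc s t) :=
    Continuous.continuousOn (by fun_prop)
  set e := Real.exp (-α * (t - s))
  set I := ∫ r in s..t, Real.exp (-α * (t - r)) * ‖f r‖ with hI
  set J := ∫ r in s..t, Real.exp (-α * (t - r)) * ‖f r‖ ^ 2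
  have hIJ : I ^ 2 ≤ 1 / α * J := by
    refine (sq_integral_mul_le hst hexp (fun r => (Real.exp_pos _).le) hf.norm hf2).trans ?_
    refine mul_le_mul_of_nonneg_right (integral_exp_neg_mul_sub_right_le hα s t) ?_
    exact intervalIntegral.integral_nonneg hst fun r _ => by positivity
  have hforced : ‖∫ r in s..t, V t r (f r)‖ ≤ M * I := by
    rw [hI, ← intervalIntegral.integral_const_mul]
    refine intervalIntegral.norm_integral_le_of_norm_le hst (ae_of_all _ fun r hr => ?_)
      ((hf.norm.continuousOn_mul hexp).const_mul M)
    rw [← mul_assoc]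
    exact (V t r).le_of_opNorm_le (hVb r t (hs.trans hr.1.le) hr.2) _
  have hfree : ‖V t s x‖ ≤ M * (e * ‖x‖) := by
    rw [← mul_assoc]
    exact (V t s).le_of_opNorm_le (hVb s t hs hst) _
  have he2 : e ^ 2 ≤ e := by
    rw [sq]
    exact mul_le_of_le_one_left (Real.exp_pos _).le (Real.exp_le_one_iff.2 (by nlinarith))
  calc ‖mild V s x f t‖ ^ 2 ≤ (M * (e * ‖x‖) + M * I) ^ 2 := by
        rw [mild]
        gcongr
        exact norm_add_le_of_le hfree hforced
    _ ≤ 2 * ((M * (e * ‖x‖)) ^ 2 + (M * I) ^ 2) := add_sq_le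
    _ = 2 * M ^ 2 * (e ^ 2 * ‖x‖ ^ 2 + I ^ 2) := by ring
    _ ≤ 2 * M ^ 2 * (e * ‖x‖ ^ 2 + 1 / α * J) := by gcongr

lemma norm_mild_sq_le_integral {M α : ℝ} (hα : 0 < α)
    (hVb : ∀ s t, 0 ≤ s → s ≤ t → ‖V t s‖ ≤ M * Real.exp (-α * (t - s)))
    {s t : ℝ} (hs : 0 ≤ s) (hst : s ≤ t) (x : H) {f : ℝ → H}
    (hf : IntervalIntegrable f volume s t)
    (hf2 : IntervalIntegrable (fun r => ‖f r‖ ^ 2) volume s t) :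
    ‖mild V s x f t‖ ^ 2 ≤ 2 * M ^ 2 * (‖x‖ ^ 2 + 1 / α * ∫ r in s..t, ‖f r‖ ^ 2) := by
  have hexp (r : ℝ) (hr : r ∈ Set.Icc s t) : Real.exp (-α * (t - r)) ≤ 1 :=
    Real.exp_le_one_iff.2 (by nlinarith [hr.2])
  refine (norm_mild_sq_le hα hVb hs hst x hf hf2).trans ?_
  gcongr
  · exact mul_le_of_le_one_left (sq_nonneg _) (hexp s ⟨le_rfl, hst⟩)
  · exact intervalIntegral.integral_mono_on hst
      (hf2.continuousOn_mul (Continuous.continuousOn (by fun_prop))) hf2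
      fun r hr => mul_le_of_le_one_left (sq_nonneg _) (hexp r hr)

lemma integral_norm_mild_sq_le {M α : ℝ} (hV : IsEvolutionOperator V) (hα : 0 < α)
    (hVb : ∀ s t, 0 ≤ s → s ≤ t → ‖V t s‖ ≤ M * Real.exp (-α * (t - s)))
    (hVl : IsLocallyBounded V) {s t : ℝ} (hs : 0 ≤ s) (hst : s ≤ t) (x : H) {f : ℝ → H}
    (hf : IntervalIntegrable f volume s t)
    (hf2 : IntervalIntegrable (fun r => ‖f r‖ ^ 2) volume s t) :
    ∫ r in s..t, ‖mild V s x f r‖ ^ 2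
      ≤ 2 * M ^ 2 * (1 / α * ‖x‖ ^ 2 + 1 / α * (1 / α * ∫ r in s..t, ‖f r‖ ^ 2)) := by
  have hmild : IntervalIntegrable (fun r => ‖mild V s x f r‖ ^ 2) volume s t := by
    refine ContinuousOn.intervalIntegrable ?_
    rw [Set.uIcc_of_le hst]
    exact (hV.continuousOn_mild hVl hs x hf).norm.pow 2
  have hfree : IntervalIntegrable (fun r => Real.exp (-α * (r - s)) * ‖x‖ ^ 2) volume s t :=
    Continuous.intervalIntegrable (by fun_prop) _ _
  have hforced := (intervalIntegrable_integral_triangle_right hst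
    (integrableOn_exp_mul_triangle hα.le hst hf2)).const_mul (1 / α)
  refine (intervalIntegral.integral_mono_on hst hmild ((hfree.add hforced).const_mul (2 * M ^ 2))
    fun r hr => norm_mild_sq_le hα hVb hs hr.1 x (intervalIntegrable_of_le hf hr.1 hr.2)
      (intervalIntegrable_of_le hf2 hr.1 hr.2)).trans ?_
  rw [intervalIntegral.integral_const_mul, intervalIntegral.integral_add hfree hforced,
    intervalIntegral.integral_mul_const, intervalIntegral.integral_const_mul]
  gcongr
  · exact integral_exp_neg_mul_sub_left_le hα s t
  · exact integral_integral_exp_mul_le hα hst (fun r => sq_nonneg _) hf2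

theorem IsExponentiallyStable.exists_mild_le (hVs : IsExponentiallyStable V)
    (hV : IsEvolutionOperator V) :
    ∃ c : ℝ, 0 ≤ c ∧ ∀ s t, 0 ≤ s → s ≤ t → ∀ (x : H) (f : ℝ → H),
      AEStronglyMeasurable f (volume.restrict (Set.Ioc s t)) →
      IntervalIntegrable (fun r => ‖f r‖ ^ 2) volume s t →
      ‖mild V s x f t‖ ^ 2 ≤ c * (‖x‖ ^ 2 + ∫ r in s..t, ‖f r‖ ^ 2) ∧
      ∫ r in s..t, ‖mild V s x f r‖ ^ 2 ≤ c * (‖x‖ ^ 2 + ∫ r in s..t, ‖f r‖ ^ 2) := by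
  have hVl := hVs.isLocallyBounded
  obtain ⟨M, α, -, hα, hVb⟩ := hVs
  have hα0 : 0 < 1 / α := by positivity
  refine ⟨2 * M ^ 2 * (1 + 1 / α) ^ 2, by positivity, fun s t hs hst x f hm hf2 => ?_⟩
  have hf := intervalIntegrable_of_norm_sq hst hm hf2
  have hF0 : 0 ≤ ∫ r in s..t, ‖f r‖ ^ 2 :=
    intervalIntegral.integral_nonneg hst fun r _ => sq_nonneg _
  constructor
  · refine (norm_mild_sq_le_integral hα hVb hs hst x hf hf2).trans ?_
    rw [mul_assoc (2 * M ^ 2)]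
    gcongr
    nlinarith [mul_nonneg hα0.le (sq_nonneg ‖x‖), mul_nonneg hα0.le hF0,
      mul_nonneg (mul_nonneg hα0.le hα0.le) hF0,
      mul_nonneg (mul_nonneg hα0.le hα0.le) (sq_nonneg ‖x‖)]
  · refine (integral_norm_mild_sq_le hV hα hVb hVl hs hst x hf hf2).trans ?_
    rw [mul_assoc (2 * M ^ 2)]
    gcongr
    nlinarith [mul_nonneg hα0.le (sq_nonneg ‖x‖), mul_nonneg hα0.le hF0, sq_nonneg ‖x‖,
      mul_nonneg (mul_nonneg hα0.le hα0.le) (sq_nonneg ‖x‖)]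

end Stability

/-! ### Signals of a control system -/

section SquareIntegrable

section Measure

variable {α F : Type*} [MeasurableSpace α] {ν : Measure α} [NormedAddCommGroup F]

lemma integrable_norm_sq (φ : Lp F 2 ν) : Integrable (fun r => ‖φ r‖ ^ 2) ν :=
  (memLp_two_iff_integrable_sq_norm (Lp.aestronglyMeasurable φ)).1 (Lp.memLp φ)

lemma ofReal_norm_sq_eq_lintegral (φ : Lp F 2 ν) :
    ENNReal.ofReal (‖φ‖ ^ 2) = ∫⁻ r, ENNReal.ofReal (‖φ r‖ ^ 2) ∂ν := by
  have h := eLpNorm_nnreal_pow_eq_lintegral (f := φ) (μ := ν) (p := 2) two_ne_zero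
  simp only [ENNReal.ofReal_pow (norm_nonneg _), ofReal_norm, Lp.enorm_def]
  simpa only [NNReal.coe_ofNat, ENNReal.rpow_ofNat, ENNReal.coe_ofNat] using h

lemma norm_sq_eq_integral (φ : Lp F 2 ν) : ‖φ‖ ^ 2 = ∫ r, ‖φ r‖ ^ 2 ∂ν := by
  have h := ofReal_norm_sq_eq_lintegral φ
  rw [← ofReal_integral_eq_lintegral_ofReal (integrable_norm_sq φ)
    (ae_of_all _ fun _ => sq_nonneg _)] at h
  exact (ENNReal.ofReal_eq_ofReal_iff (sq_nonneg _) (integral_nonneg fun _ => sq_nonneg _)).1 h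

end Measure

variable {F : Type*} [NormedAddCommGroup F]

lemma integral_norm_sq_le (φ : Lp F 2 (volume : Measure ℝ)) {s t : ℝ} (hst : s ≤ t) :
    ∫ r in s..t, ‖φ r‖ ^ 2 ≤ ‖φ‖ ^ 2 := by
  rw [norm_sq_eq_integral, intervalIntegral.integral_of_le hst]
  exact setIntegral_le_integral (integrable_norm_sq φ) (ae_of_all _ fun _ => sq_nonneg _)

lemma intervalIntegrable_coeFn (φ : Lp F 2 (volume : Measure ℝ)) (s t : ℝ) :
    IntervalIntegrable φ volume s t :=
  (((Lp.memLp φ).locallyIntegrable one_le_two).integrableOn_isCompact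
    isCompact_uIcc).intervalIntegrable

lemma integral_norm_le (φ : Lp F 2 (volume : Measure ℝ)) {s t : ℝ} (hst : s ≤ t) :
    ∫ r in s..t, ‖φ r‖ ≤ √(t - s) * ‖φ‖ := by
  have h := sq_integral_mul_le hst (w := fun _ => 1) continuousOn_const (fun _ => zero_le_one)
    (intervalIntegrable_coeFn φ s t).norm (integrable_norm_sq φ).intervalIntegrable
  simp only [one_mul, intervalIntegral.integral_const, smul_eq_mul, mul_one] at h
  rw [← Real.sqrt_sq (norm_nonneg φ), ← Real.sqrt_mul (sub_nonneg.2 hst)]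
  exact Real.le_sqrt_of_sq_le (h.trans
    (mul_le_mul_of_nonneg_left (integral_norm_sq_le φ hst) (sub_nonneg.2 hst)))

lemma exists_clm_eq_integral {𝕜 H : Type*} [RCLike 𝕜] [NormedSpace 𝕜 F] [NormedAddCommGroup H]
    [NormedSpace 𝕜 H] [NormedSpace ℝ H] [CompleteSpace H] {D : ℝ → F →L[𝕜] H} {s t d : ℝ}
    (hst : s ≤ t) (hd : ∀ r ∈ Set.Ioc s t, ‖D r‖ ≤ d)
    (hD : ∀ f : ℝ → F, IntervalIntegrable f volume s t →
      IntervalIntegrable (fun r => D r (f r)) volume s t) :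
    ∃ L : Lp F 2 (volume : Measure ℝ) →L[𝕜] H, (∀ φ, L φ = ∫ r in s..t, D r (φ r)) ∧
      ∀ φ, ‖L φ‖ ≤ d * √(t - s) * ‖φ‖ := by
  rcases hst.eq_or_lt with rfl | hlt
  · exact ⟨0, by simp⟩
  have hd0 : 0 ≤ d := (norm_nonneg _).trans (hd t ⟨hlt, le_rfl⟩)
  have hi (φ : Lp F 2 (volume : Measure ℝ)) := hD φ (intervalIntegrable_coeFn φ s t)
  have hbound (φ : Lp F 2 (volume : Measure ℝ)) :
      ‖∫ r in s..t, D r (φ r)‖ ≤ d * √(t - s) * ‖φ‖ := by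
    rw [mul_assoc]
    refine le_trans ?_ (mul_le_mul_of_nonneg_left (integral_norm_le φ hst) hd0)
    rw [← intervalIntegral.integral_const_mul]
    exact intervalIntegral.norm_integral_le_of_norm_le hst
      (ae_of_all _ fun r hr => (D r).le_of_opNorm_le (hd r hr) _)
      ((intervalIntegrable_coeFn φ s t).norm.const_mul _)
  let L : Lp F 2 (volume : Measure ℝ) →ₗ[𝕜] H :=
    { toFun := fun φ => ∫ r in s..t, D r (φ r)
      map_add' := fun φ ψ => by
        rw [← intervalIntegral.integral_add (hi φ) (hi ψ)]
        refine intervalIntegral.integral_congr_ae ?_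
        filter_upwards [Lp.coeFn_add φ ψ] with r hr _
        rw [hr, Pi.add_apply, map_add]
      map_smul' := fun a φ => by
        have hsmul := (a • ContinuousLinearMap.id 𝕜 H).intervalIntegral_comp_comm (hi φ)
        simp only [smul_apply, ContinuousLinearMap.id_apply] at hsmul
        rw [RingHom.id_apply, ← hsmul]
        refine intervalIntegral.integral_congr_ae ?_
        filter_upwards [Lp.coeFn_smul a φ] with r hr _
        rw [hr, Pi.smul_apply, map_smul] }
  exact ⟨L.mkContinuous _ hbound, fun φ => rfl, hbound⟩

lemma intervalIntegrable_snd {G X : Type*} [NormedAddCommGroup G] [NormedAddCommGroup X]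
    {f : ℝ → WithLp 2 (G × X)} {s t : ℝ} (hf : IntervalIntegrable f volume s t) :
    IntervalIntegrable (fun r => (f r).snd) volume s t :=
  hf.mono_fun
    ((continuous_snd.comp (WithLp.prod_continuous_ofLp 2 G X)).comp_aestronglyMeasurable
      hf.aestronglyMeasurable_restrict_uIoc)
    (ae_of_all _ fun r => WithLp.norm_snd_le _ (f r))

end SquareIntegrable

section OutputSignals

variable {𝕜 H X G : Type*} [RCLike 𝕜]
  [NormedAddCommGroup H] [InnerProductSpace 𝕜 H] [NormedSpace ℝ H]
  [NormedAddCommGroup X] [InnerProductSpace 𝕜 X] [NormedAddCommGroup G] [InnerProductSpace 𝕜 G]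
  {Y : ℝ → ℝ → H →L[𝕜] H} {B : ℝ → X →L[𝕜] H} {C : ℝ → H →L[𝕜] G}

/-- The control system `z' = A z + B u`, where `A` generates the evolution operator `Y`. -/
structure IsControlSystem (Y : ℝ → ℝ → H →L[𝕜] H) (B : ℝ → X →L[𝕜] H) : Prop where
  evolution : IsEvolutionOperator Y
  isLocallyBounded : IsLocallyBounded Y
  input : IsBoundedContinuous B

/-- `φ = (y, u)` is the signal of the control `u` and the initial value `x` at time `s`: it vanishes
before `s`, and `y = C z` along the trajectory `z` from then on. Taking `y` and `u` together, the
squared `L²` norm of `φ` is the cost of `u` for `W = C* C` and `R = 1`. -/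
def IsOutputSignal (Y : ℝ → ℝ → H →L[𝕜] H) (B : ℝ → X →L[𝕜] H) (C : ℝ → H →L[𝕜] G) (s : ℝ)
    (x : H) (φ : ℝ → WithLp 2 (G × X)) : Prop :=
  (∀ᵐ t, t < s → φ t = 0) ∧
    ∀ᵐ t, s ≤ t → (φ t).fst = C t (trajectory Y B s x (fun r => (φ r).snd) t)

lemma trajectory_eq_mild (s : ℝ) (x : H) (u : ℝ → X) :
    trajectory Y B s x u = mild Y s x (fun r => B r (u r)) := rfl

lemma trajectory_congr {s t : ℝ} (hst : s ≤ t) {x : H} {u v : ℝ → X}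
    (h : ∀ᵐ r, r ∈ Set.Ioc s t → u r = v r) :
    trajectory Y B s x u t = trajectory Y B s x v t :=
  mild_congr hst (h.mono fun r hr hr' => congrArg (B r) (hr hr'))

lemma IsOutputSignal.congr {s : ℝ} {x : H} {φ ψ : ℝ → WithLp 2 (G × X)}
    (hφ : IsOutputSignal Y B C s x φ) (h : φ =ᵐ[volume] ψ) : IsOutputSignal Y B C s x ψ := by
  constructor
  · filter_upwards [h, hφ.1] with t ht h0 hts
    rw [← ht, h0 hts]
  · filter_upwards [h, hφ.2] with t ht hC hst
    rw [← ht, hC hst, trajectory_congr hst (h.mono fun r hr _ => by rw [hr])]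

namespace IsControlSystem

variable (hS : IsControlSystem Y B) {s t : ℝ} (hs : 0 ≤ s)
include hS hs

omit [NormedSpace ℝ H] in
lemma intervalIntegrable_input {u : ℝ → X} (hst : s ≤ t) (hu : IntervalIntegrable u volume s t) :
    IntervalIntegrable (fun r => B r (u r)) volume s t :=
  intervalIntegrable_clm_apply hst (hS.input.1.mono fun _ hr => hs.trans hr.1) hu

lemma continuousOn_trajectory (x : H) {u : ℝ → X} (hu : ∀ t, IntervalIntegrable u volume s t) :
    ContinuousOn (trajectory Y B s x u) (Set.Ici s) := by
  intro t (ht : s ≤ t)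
  have hcont := hS.evolution.continuousOn_mild hS.isLocallyBounded hs x
    (hS.intervalIntegrable_input hs (ht.trans (lt_add_one t).le) (hu (t + 1)))
  refine (hcont t ⟨ht, (lt_add_one t).le⟩).mono_of_mem_nhdsWithin ?_
  rw [← Set.Ici_inter_Iic]
  exact inter_mem_nhdsWithin _ (Iic_mem_nhds (lt_add_one t))

variable [CompleteSpace H]

lemma trajectory_restart {r : ℝ} (hsr : s ≤ r) (hrt : r ≤ t) (x : H) {u : ℝ → X}
    (hu : IntervalIntegrable u volume s t) :
    trajectory Y B s x u t = trajectory Y B r (trajectory Y B s x u r) u t :=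
  hS.evolution.mild_restart hS.isLocallyBounded hs hsr hrt x
    (hS.intervalIntegrable_input hs (hsr.trans hrt) hu)

lemma exists_inputMap {N b : ℝ} (hst : s ≤ t) (hN : ∀ r ∈ Set.Ioc s t, ‖Y t r‖ ≤ N)
    (hb : ∀ r, 0 ≤ r → ‖B r‖ ≤ b) :
    ∃ L : Lp (WithLp 2 (G × X)) 2 (volume : Measure ℝ) →L[𝕜] H,
      (∀ φ, L φ = ∫ r in s..t, Y t r (B r (φ r).snd)) ∧
      ∀ φ, ‖L φ‖ ≤ N * b * √(t - s) * ‖φ‖ := by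
  have snd_norm : ‖WithLp.sndL 2 𝕜 G X‖ ≤ 1 :=
    ContinuousLinearMap.opNorm_le_bound _ zero_le_one fun f => by
      simpa using WithLp.norm_snd_le _ f
  refine exists_clm_eq_integral (D := fun r => Y t r ∘L B r ∘L WithLp.sndL 2 𝕜 G X) hst
    (fun r hr => ?_) fun f hf => ?_
  · have hr0 := hs.trans hr.1.le
    calc ‖Y t r ∘L B r ∘L WithLp.sndL 2 𝕜 G X‖
        ≤ ‖Y t r‖ * (‖B r‖ * ‖WithLp.sndL 2 𝕜 G X‖) :=
          (ContinuousLinearMap.opNorm_comp_le _ _).trans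
            (by gcongr; exact ContinuousLinearMap.opNorm_comp_le _ _)
      _ ≤ N * (b * 1) := by
          have := (norm_nonneg _).trans (hN r hr)
          gcongr
          exacts [hN r hr, (norm_nonneg _).trans (hb r hr0), hb r hr0]
      _ = N * b := by rw [mul_one]
  · exact hS.evolution.intervalIntegrable_apply hS.isLocallyBounded hs hst
      (hS.intervalIntegrable_input hs hst (intervalIntegrable_snd hf))

lemma exists_trajectoryMap (hst : s ≤ t) :
    ∃ L : H × Lp (WithLp 2 (G × X)) 2 (volume : Measure ℝ) →L[𝕜] H,
      ∀ p, L p = trajectory Y B s p.1 (fun r => (p.2 r).snd) t := by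
  obtain ⟨N, hN⟩ := hS.isLocallyBounded t
  obtain ⟨b, hb⟩ := hS.input.2
  obtain ⟨L, hL, -⟩ := hS.exists_inputMap (G := G) hs hst
    (fun r hr => hN r t (hs.trans hr.1.le) hr.2 le_rfl) hb
  exact ⟨(Y t s).coprod L, fun p => by
    rw [ContinuousLinearMap.coprod_apply, hL, trajectory]⟩

end IsControlSystem

variable [CompleteSpace H]

/-- The square integrable signals starting at time `s`, paired with their initial values. -/
noncomputable def outputSignals (hS : IsControlSystem Y B) (C : ℝ → H →L[𝕜] G) {s : ℝ}
    (hs : 0 ≤ s) : Submodule 𝕜 (H × Lp (WithLp 2 (G × X)) 2 (volume : Measure ℝ)) where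
  carrier := {p | IsOutputSignal Y B C s p.1 p.2}
  add_mem' {p q} hp hq := by
    constructor
    · filter_upwards [hp.1, hq.1, Lp.coeFn_add p.2 q.2] with t hp hq h ht
      rw [Prod.snd_add, h, Pi.add_apply, hp ht, hq ht, add_zero]
    · filter_upwards [hp.2, hq.2, Lp.coeFn_add p.2 q.2] with t hp hq h ht
      obtain ⟨L, hL⟩ := hS.exists_trajectoryMap (G := G) hs ht
      rw [← hL] at hp hq ⊢
      rw [Prod.snd_add, h, Pi.add_apply, WithLp.add_fst, hp ht, hq ht, map_add, map_add]
  zero_mem' := by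
    constructor
    · filter_upwards [Lp.coeFn_zero (WithLp 2 (G × X)) 2 (volume : Measure ℝ)] with t h _ using h
    · filter_upwards [Lp.coeFn_zero (WithLp 2 (G × X)) 2 (volume : Measure ℝ)] with t h ht
      obtain ⟨L, hL⟩ := hS.exists_trajectoryMap (G := G) hs ht
      rw [← hL, map_zero, map_zero, Prod.snd_zero, h, Pi.zero_apply, WithLp.zero_fst]
  smul_mem' a p hp := by
    constructor
    · filter_upwards [hp.1, Lp.coeFn_smul a p.2] with t hp h ht
      rw [Prod.smul_snd, h, Pi.smul_apply, hp ht, smul_zero]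
    · filter_upwards [hp.2, Lp.coeFn_smul a p.2] with t hp h ht
      obtain ⟨L, hL⟩ := hS.exists_trajectoryMap (G := G) hs ht
      rw [← hL] at hp ⊢
      rw [Prod.smul_snd, h, Pi.smul_apply, WithLp.smul_fst, hp ht, map_smul, map_smul]

lemma isClosed_outputSignals (hS : IsControlSystem Y B) {s : ℝ} (hs : 0 ≤ s) :
    IsClosed (outputSignals hS C hs :
      Set (H × Lp (WithLp 2 (G × X)) 2 (volume : Measure ℝ))) := by
  refine IsSeqClosed.isClosed fun p q hp hpq => ?_
  obtain ⟨ns, hns, hae⟩ := (tendstoInMeasure_of_tendsto_Lp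
    ((continuous_snd.tendsto q).comp hpq)).exists_seq_tendsto_ae
  constructor
  · filter_upwards [hae, ae_all_iff.2 fun n => (hp n).1] with t ht h0 hts
    refine tendsto_nhds_unique ht (tendsto_const_nhds.congr fun i => ?_)
    exact (h0 (ns i) hts).symm
  · filter_upwards [hae, ae_all_iff.2 fun n => (hp n).2] with t ht hC hst
    obtain ⟨L, hL⟩ := hS.exists_trajectoryMap (G := G) hs hst
    simp only [← hL] at hC ⊢
    have hlim : Tendsto (fun i => C t (L (p (ns i)))) atTop (𝓝 (C t (L q))) :=
      (((C t).continuous.comp L.continuous).tendsto q).comp (hpq.comp hns.tendsto_atTop)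
    refine tendsto_nhds_unique ?_ (hlim.congr fun i => (hC (ns i) hst).symm)
    exact ((WithLp.fstL 2 𝕜 G X).continuous.tendsto _).comp ht

end OutputSignals

section ExponentialDecay

variable {E : Type*} [NormedAddCommGroup E] {f : ℝ → E} {s m α : ℝ}

lemma integrableOn_norm_sq_of_norm_le_exp (hα : 0 < α)
    (hm : AEStronglyMeasurable f (volume.restrict (Set.Ici s)))
    (hf : ∀ t, s ≤ t → ‖f t‖ ≤ m * Real.exp (-α * (t - s))) :
    IntegrableOn (fun t => ‖f t‖ ^ 2) (Set.Ici s) ∧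
      ∫ t in Set.Ici s, ‖f t‖ ^ 2 ≤ m ^ 2 / (2 * α) := by
  have hα2 : -(2 * α) < 0 := by linarith
  have sq_exp (t : ℝ) : (m * Real.exp (-α * (t - s))) ^ 2
      = m ^ 2 * Real.exp (2 * α * s) * Real.exp (-(2 * α) * t) := by
    rw [mul_pow, ← Real.exp_nat_mul, mul_assoc, ← Real.exp_add]
    congr 2
    push_cast
    ring
  have hle (t : ℝ) (ht : s ≤ t) :
      ‖f t‖ ^ 2 ≤ m ^ 2 * Real.exp (2 * α * s) * Real.exp (-(2 * α) * t) :=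
    sq_exp t ▸ pow_le_pow_left₀ (norm_nonneg _) (hf t ht) 2
  have hexp : IntegrableOn (fun t => m ^ 2 * Real.exp (2 * α * s) * Real.exp (-(2 * α) * t))
      (Set.Ici s) :=
    ((integrableOn_exp_mul_Ioi hα2 s).congr_set_ae Ioi_ae_eq_Ici.symm).const_mul _
  have hint : IntegrableOn (fun t => ‖f t‖ ^ 2) (Set.Ici s) := by
    refine hexp.mono' (hm.norm.pow 2) ?_
    filter_upwards [ae_restrict_mem measurableSet_Ici] with t ht
    rw [Real.norm_of_nonneg (sq_nonneg _)]
    exact hle t ht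
  refine ⟨hint, (setIntegral_mono_on hint hexp measurableSet_Ici hle).trans_eq ?_⟩
  rw [integral_const_mul, integral_Ici_eq_integral_Ioi, integral_exp_mul_Ioi hα2, neg_div_neg_eq,
    mul_div_assoc', mul_assoc, ← Real.exp_add, neg_mul, add_neg_cancel, Real.exp_zero, mul_one]

lemma memLp_indicator_of_norm_le_exp (hα : 0 < α)
    (hm : AEStronglyMeasurable f (volume.restrict (Set.Ici s)))
    (hf : ∀ t, s ≤ t → ‖f t‖ ≤ m * Real.exp (-α * (t - s))) :
    ∃ h : MemLp (Set.indicator (Set.Ici s) f) 2 volume, ‖h.toLp‖ ≤ m / √(2 * α) := by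
  obtain ⟨hint, hle⟩ := integrableOn_norm_sq_of_norm_le_exp hα hm hf
  have hLp : MemLp (Set.indicator (Set.Ici s) f) 2 volume :=
    (memLp_indicator_iff_restrict measurableSet_Ici).2
      ((memLp_two_iff_integrable_sq_norm hm).2 hint)
  have hm0 : 0 ≤ m := by simpa using (norm_nonneg _).trans (hf s le_rfl)
  refine ⟨hLp, (pow_le_pow_iff_left₀ (norm_nonneg _) (by positivity) two_ne_zero).1 ?_⟩
  rw [div_pow, Real.sq_sqrt (by positivity), norm_sq_eq_integral]
  refine le_of_eq_of_le ?_ hle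
  rw [← integral_indicator measurableSet_Ici]
  refine integral_congr_ae ?_
  filter_upwards [hLp.coeFn_toLp] with t ht
  rw [ht]
  by_cases hts : t ∈ Set.Ici s <;> simp [hts]

end ExponentialDecay

section OptimalSignals

variable {𝕜 H X G : Type*} [RCLike 𝕜]
  [NormedAddCommGroup H] [InnerProductSpace 𝕜 H] [NormedSpace ℝ H]
  [NormedAddCommGroup X] [InnerProductSpace 𝕜 X] [NormedAddCommGroup G] [InnerProductSpace 𝕜 G]
  {Y : ℝ → ℝ → H →L[𝕜] H} {B : ℝ → X →L[𝕜] H} {C : ℝ → H →L[𝕜] G}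

lemma IsPerturbedEvolution.isOutputSignal_indicator {K : ℝ → H →L[𝕜] X} {Z : ℝ → ℝ → H →L[𝕜] H}
    (hZ : IsPerturbedEvolution Y (fun t => B t ∘L K t) Z) {s : ℝ} (hs : 0 ≤ s) (x : H) :
    IsOutputSignal Y B C s x (Set.indicator (Set.Ici s) fun t =>
      WithLp.toLp 2 (C t (Z t s x), K t (Z t s x))) := by
  refine ⟨ae_of_all _ fun t ht => Set.indicator_of_notMem (not_le.2 ht) _,
    ae_of_all _ fun t ht => ?_⟩
  rw [Set.indicator_of_mem (Set.mem_Ici.2 ht), WithLp.toLp_fst,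
    hZ.eq_add_integral s t hs ht x]
  refine congrArg (C t) (mild_congr ht (ae_of_all _ fun r hr => ?_))
  simp only [Set.indicator_of_mem (Set.mem_Ici.2 hr.1.le), WithLp.toLp_snd,
    ContinuousLinearMap.comp_apply]

lemma norm_toLp_prodMk_le (a : G) (v : X) : ‖WithLp.toLp 2 (a, v)‖ ≤ ‖a‖ + ‖v‖ := by
  refine (pow_le_pow_iff_left₀ (norm_nonneg _) (by positivity) two_ne_zero).1 ?_
  rw [WithLp.prod_norm_sq_eq_of_L2, WithLp.toLp_fst, WithLp.toLp_snd]
  nlinarith [mul_nonneg (norm_nonneg a) (norm_nonneg v)]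

lemma IsUniformlyStabilizable.exists_isOutputSignal (hstab : IsUniformlyStabilizable Y B)
    (hC : IsBoundedContinuous C) :
    ∃ c : ℝ, 0 ≤ c ∧ ∀ s, 0 ≤ s → ∀ x, ∃ φ : Lp (WithLp 2 (G × X)) 2 (volume : Measure ℝ),
      IsOutputSignal Y B C s x φ ∧ ‖φ‖ ≤ c * ‖x‖ := by
  obtain ⟨K, ⟨hK, k, hk⟩, Z, hZ, M, α, hM, hα, hZM⟩ := hstab
  obtain ⟨hC, c, hc⟩ := hC
  have hc0 := (norm_nonneg _).trans (hc 0 le_rfl)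
  have hk0 := (norm_nonneg _).trans (hk 0 le_rfl)
  refine ⟨(c + k) * M / √(2 * α), by positivity, fun s hs x => ?_⟩
  have hcont : ContinuousOn (fun t => WithLp.toLp 2 (C t (Z t s x), K t (Z t s x))) (Set.Ici s) :=
    have hZx := hZ.isEvolutionOperator.continuousOn_left s hs x
    have hsub := Set.Ici_subset_Ici.2 hs
    (WithLp.prod_continuous_toLp 2 G X).comp_continuousOn
      (((hC.mono hsub).clm_apply hZx).prodMk ((hK.mono hsub).clm_apply hZx))
  obtain ⟨hLp, hle⟩ := memLp_indicator_of_norm_le_exp hα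
    (hcont.aestronglyMeasurable measurableSet_Ici) (m := (c + k) * M * ‖x‖) fun t ht => by
      have h0t := hs.trans ht
      calc ‖WithLp.toLp 2 (C t (Z t s x), K t (Z t s x))‖
          ≤ c * ‖Z t s x‖ + k * ‖Z t s x‖ := (norm_toLp_prodMk_le _ _).trans
            (add_le_add ((C t).le_of_opNorm_le (hc t h0t) _) ((K t).le_of_opNorm_le (hk t h0t) _))
        _ = (c + k) * ‖Z t s x‖ := by ring
        _ ≤ (c + k) * (M * Real.exp (-α * (t - s)) * ‖x‖) := by
          gcongr
          exact (Z t s).le_of_opNorm_le (hZM s t hs ht) x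
        _ = (c + k) * M * ‖x‖ * Real.exp (-α * (t - s)) := by ring
  exact ⟨hLp.toLp, (hZ.isOutputSignal_indicator hs x).congr hLp.coeFn_toLp.symm,
    hle.trans_eq (by ring)⟩

/-- `T s x` is the signal of minimal norm, that is, of minimal cost, among those with initial value
`x` at time `s`; minimality is expressed as orthogonality to the signals with initial value `0`. The
norms of the `T s` are required to be bounded in `s`. -/
structure IsOptimalSignal (Y : ℝ → ℝ → H →L[𝕜] H) (B : ℝ → X →L[𝕜] H) (C : ℝ → H →L[𝕜] G)
    (T : ℝ → H →L[𝕜] Lp (WithLp 2 (G × X)) 2 (volume : Measure ℝ)) : Prop where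
  isOutputSignal : ∀ s, 0 ≤ s → ∀ x, IsOutputSignal Y B C s x (T s x)
  inner_eq_zero : ∀ s, 0 ≤ s → ∀ x (g : Lp (WithLp 2 (G × X)) 2 (volume : Measure ℝ)),
    IsOutputSignal Y B C s 0 g → inner 𝕜 (T s x) g = 0
  exists_norm_le : ∃ c : ℝ, 0 ≤ c ∧ ∀ s, 0 ≤ s → ∀ x, ‖T s x‖ ≤ c * ‖x‖

theorem IsControlSystem.exists_isOptimalSignal [CompleteSpace H] [CompleteSpace X]
    [CompleteSpace G] (hS : IsControlSystem Y B) (hC : IsBoundedContinuous C)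
    (hstab : IsUniformlyStabilizable Y B) : ∃ T, IsOptimalSignal Y B C T := by
  obtain ⟨c, hc, hsig⟩ := hstab.exists_isOutputSignal hC
  have hsection (s : ℝ) : ∃ T : H →L[𝕜] Lp (WithLp 2 (G × X)) 2 (volume : Measure ℝ), 0 ≤ s →
      (∀ x, IsOutputSignal Y B C s x (T x)) ∧
      (∀ x (g : Lp (WithLp 2 (G × X)) 2 (volume : Measure ℝ)),
        IsOutputSignal Y B C s 0 g → inner 𝕜 (T x) g = 0) ∧
      ∀ x, ‖T x‖ ≤ c * ‖x‖ := by
    by_cases hs : 0 ≤ s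
    · obtain ⟨T, hT⟩ := exists_minimal_section _ (isClosed_outputSignals (C := C) hS hs) (hsig s hs)
      exact ⟨T, fun _ => hT⟩
    · exact ⟨0, fun h => absurd h hs⟩
  choose T hT using hsection
  exact ⟨T, fun s hs => (hT s hs).1, fun s hs => (hT s hs).2.1, c, hc, fun s hs => (hT s hs).2.2⟩

end OptimalSignals

/-! ### Dynamic programming -/

section OptimalFlow

variable {𝕜 H X G : Type*} [RCLike 𝕜]
  [NormedAddCommGroup H] [InnerProductSpace 𝕜 H] [NormedSpace ℝ H]
  [NormedAddCommGroup X] [InnerProductSpace 𝕜 X] [NormedAddCommGroup G] [InnerProductSpace 𝕜 G]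
  {Y V : ℝ → ℝ → H →L[𝕜] H} {B : ℝ → X →L[𝕜] H} {C : ℝ → H →L[𝕜] G}
  {T : ℝ → H →L[𝕜] Lp (WithLp 2 (G × X)) 2 (volume : Measure ℝ)}

/-- `V t s` maps an initial value at time `s` to the value at time `t` of the trajectory of its
optimal control. -/
def IsOptimalFlow (Y : ℝ → ℝ → H →L[𝕜] H) (B : ℝ → X →L[𝕜] H)
    (T : ℝ → H →L[𝕜] Lp (WithLp 2 (G × X)) 2 (volume : Measure ℝ))
    (V : ℝ → ℝ → H →L[𝕜] H) : Prop :=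
  ∀ s t, 0 ≤ s → s ≤ t → ∀ x, V t s x = trajectory Y B s x (fun r => (T s x r).snd) t

variable [CompleteSpace H]

lemma IsControlSystem.exists_isOptimalFlow (hS : IsControlSystem Y B)
    (T : ℝ → H →L[𝕜] Lp (WithLp 2 (G × X)) 2 (volume : Measure ℝ)) :
    ∃ V : ℝ → ℝ → H →L[𝕜] H, IsOptimalFlow Y B T V := by
  have h (t s : ℝ) : ∃ L : H →L[𝕜] H, 0 ≤ s → s ≤ t →
      ∀ x, L x = trajectory Y B s x (fun r => (T s x r).snd) t := by
    by_cases hst : 0 ≤ s ∧ s ≤ t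
    · obtain ⟨L, hL⟩ := hS.exists_trajectoryMap (G := G) hst.1 hst.2
      exact ⟨L ∘L (ContinuousLinearMap.id 𝕜 H).prod (T s), fun _ _ x => hL (x, T s x)⟩
    · exact ⟨0, fun h1 h2 => absurd ⟨h1, h2⟩ hst⟩
  choose V hV using h
  exact ⟨V, fun s t => hV t s⟩

section Concatenation

variable {s r : ℝ} (hs : 0 ≤ s) (hsr : s ≤ r)
  {ψ : Lp (WithLp 2 (G × X)) 2 (volume : Measure ℝ)}
include hs hsr

lemma IsControlSystem.isOutputSignal_indicator_add (hS : IsControlSystem Y B) {x : H} {u : ℝ → X}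
    (hu : IntervalIntegrable u volume s r)
    (hψ : IsOutputSignal Y B C r (trajectory Y B s x u r) ψ) :
    IsOutputSignal Y B C s x fun t => (Set.Ico s r).indicator
      (fun t => WithLp.toLp 2 (C t (trajectory Y B s x u t), u t)) t + ψ t := by
  set w : ℝ → X := fun t => (Set.Ico s r).indicator u t + (ψ t).snd
  have hw : (fun t => ((Set.Ico s r).indicator
      (fun t => WithLp.toLp 2 (C t (trajectory Y B s x u t), u t)) t + ψ t).snd) = w := by
    funext t
    by_cases ht : t ∈ Set.Ico s r <;> simp [w, ht]
  have w_int (t : ℝ) : IntervalIntegrable w volume s t := by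
    refine IntervalIntegrable.add ?_ (intervalIntegrable_snd (intervalIntegrable_coeFn ψ s t))
    refine ((integrable_indicator_iff measurableSet_Ico).2 ?_).intervalIntegrable
    exact ((intervalIntegrable_iff_integrableOn_Ioc_of_le hsr).1 hu).congr_set_ae
      Ico_ae_eq_Ioc
  have w_left {t : ℝ} (hst : s ≤ t) (htr : t ≤ r) :
      trajectory Y B s x w t = trajectory Y B s x u t := by
    refine trajectory_congr hst ?_
    filter_upwards [hψ.1, compl_mem_ae_iff.2 (measure_singleton r)] with q hq hqr hqt
    have hqr : q < r := lt_of_le_of_ne (hqt.2.trans htr) hqr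
    simp [w, hq hqr, Set.indicator_of_mem (Set.mem_Ico.2 ⟨hqt.1.le, hqr⟩)]
  have w_right {t : ℝ} (hrt : r ≤ t) : trajectory Y B s x w t
      = trajectory Y B r (trajectory Y B s x u r) (fun q => (ψ q).snd) t := by
    rw [hS.trajectory_restart hs hsr hrt x (w_int t), w_left hsr le_rfl]
    refine trajectory_congr hrt (ae_of_all _ fun q hq => ?_)
    simp [w, Set.indicator_of_notMem fun h : q ∈ Set.Ico s r => hq.1.not_gt h.2]
  constructor
  · filter_upwards [hψ.1] with t ht hts
    rw [ht (hts.trans_le hsr), Set.indicator_of_notMem fun h => hts.not_ge h.1, add_zero]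
  · filter_upwards [hψ.1, hψ.2] with t h0 hC hst
    rw [hw]
    rcases lt_or_ge t r with htr | hrt
    · rw [h0 htr, add_zero, Set.indicator_of_mem (Set.mem_Ico.2 ⟨hst, htr⟩), WithLp.toLp_fst,
        w_left hst htr.le]
    · rw [Set.indicator_of_notMem fun h => hrt.not_gt h.2, zero_add, hC hrt, w_right hrt]

lemma IsControlSystem.isOutputSignal_zero_of_le (hS : IsControlSystem Y B)
    (hψ : IsOutputSignal Y B C r 0 ψ) : IsOutputSignal Y B C s 0 ψ := by
  have rest : trajectory Y B s 0 (fun _ => 0) = 0 := by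
    funext t
    simp [trajectory]
  have h := hS.isOutputSignal_indicator_add hs hsr (C := C) (x := 0) (u := fun _ => 0)
    intervalIntegrable_const (ψ := ψ) (by rwa [rest])
  refine h.congr (ae_of_all _ fun t => ?_)
  simp [rest, Set.indicator_apply]

end Concatenation

lemma inner_toLp_indicator_Ici {F : Type*} [NormedAddCommGroup F] [InnerProductSpace 𝕜 F]
    {φ ψ : Lp F 2 (volume : Measure ℝ)} {r : ℝ}
    (hφ : MemLp (Set.indicator (Set.Ici r) φ) 2 volume) (hψ : ∀ᵐ t, t < r → ψ t = 0) :
    inner 𝕜 hφ.toLp ψ = inner 𝕜 φ ψ := by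
  rw [L2.inner_def, L2.inner_def]
  refine integral_congr_ae ?_
  filter_upwards [hφ.coeFn_toLp, hψ] with t ht h0
  rw [ht]
  by_cases hrt : t ∈ Set.Ici r
  · rw [Set.indicator_of_mem hrt]
  · rw [h0 (not_le.1 hrt), inner_zero_right, inner_zero_right]

namespace IsOptimalSignal

variable (hT : IsOptimalSignal Y B C T) (hS : IsControlSystem Y B) (hV : IsOptimalFlow Y B T V)
include hT hS hV

theorem apply_flow_ae_eq {s r : ℝ} (hs : 0 ≤ s) (hsr : s ≤ r) (x : H) :
    T r (V r s x) =ᵐ[volume] Set.indicator (Set.Ici r) (T s x) := by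
  have hr := hs.trans hsr
  have htail : MemLp (Set.indicator (Set.Ici r) (T s x)) 2 volume :=
    (Lp.memLp (T s x)).indicator measurableSet_Ici
  have h : IsOutputSignal Y B C r (V r s x) (Set.indicator (Set.Ici r) (T s x)) := by
    refine ⟨ae_of_all _ fun t ht => Set.indicator_of_notMem (s := Set.Ici r) (not_le.2 ht) _, ?_⟩
    filter_upwards [(hT.isOutputSignal s hs x).2] with t ht hrt
    rw [Set.indicator_of_mem (Set.mem_Ici.2 hrt), ht (hsr.trans hrt),
      hS.trajectory_restart hs hsr hrt x (intervalIntegrable_snd (intervalIntegrable_coeFn _ s t)),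
      ← hV s r hs hsr x]
    refine congrArg (C t) (trajectory_congr hrt (ae_of_all _ fun q hq => ?_))
    rw [Set.indicator_of_mem (Set.mem_Ici.2 hq.1.le)]
  have htail_mem : IsOutputSignal Y B C r (V r s x) htail.toLp := h.congr htail.coeFn_toLp.symm
  have heq : T r (V r s x) = htail.toLp :=
    eq_of_orthogonal_of_mem (Γ := outputSignals hS C hr) (hT.isOutputSignal r hr _)
      (hT.inner_eq_zero r hr _) htail_mem fun g hg => by
        rw [inner_toLp_indicator_Ici htail hg.1]
        exact hT.inner_eq_zero s hs x g (hS.isOutputSignal_zero_of_le hs hsr hg)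
  rw [heq]
  exact htail.coeFn_toLp

lemma flow_comp {s r t : ℝ} (hs : 0 ≤ s) (hsr : s ≤ r) (hrt : r ≤ t) (x : H) :
    V t r (V r s x) = V t s x := by
  rw [hV r t (hs.trans hsr) hrt, hV s t hs (hsr.trans hrt),
    hS.trajectory_restart hs hsr hrt x (intervalIntegrable_snd (intervalIntegrable_coeFn _ s t)),
    ← hV s r hs hsr x]
  refine trajectory_congr hrt ?_
  filter_upwards [hT.apply_flow_ae_eq hS hV hs hsr x] with q hq hqr
  rw [hq, Set.indicator_of_mem (Set.mem_Ici.2 hqr.1.le)]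

lemma exists_norm_flow_sub_le (t : ℝ) :
    ∃ k : ℝ, 0 ≤ k ∧ ∀ s r, 0 ≤ s → s ≤ r → r ≤ t → ∀ x,
      ‖V r s x - Y r s x‖ ≤ k * √(r - s) * ‖x‖ := by
  obtain ⟨N, hN⟩ := hS.isLocallyBounded t
  obtain ⟨b, hb⟩ := hS.input.2
  obtain ⟨c, hc, hTc⟩ := hT.exists_norm_le
  refine ⟨|N * b| * c, by positivity, fun s r hs hsr hrt x => ?_⟩
  obtain ⟨L, hL, hLn⟩ := hS.exists_inputMap (G := G) hs hsr
    (fun q hq => hN q r (hs.trans hq.1.le) hq.2 hrt) hb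
  rw [hV s r hs hsr x, trajectory, ← hL, add_sub_cancel_left]
  calc ‖L (T s x)‖ ≤ N * b * √(r - s) * ‖T s x‖ := hLn _
    _ ≤ |N * b| * √(r - s) * (c * ‖x‖) := by
      gcongr
      exacts [le_abs_self _, hTc s hs x]
    _ = |N * b| * c * √(r - s) * ‖x‖ := by ring

lemma flow_isLocallyBounded : IsLocallyBounded V := fun T => by
  obtain ⟨k, hk, hVk⟩ := hT.exists_norm_flow_sub_le hS hV T
  obtain ⟨N, hN⟩ := hS.isLocallyBounded T
  refine ⟨|N| + k * √T, fun s t hs hst htT => ContinuousLinearMap.opNorm_le_bound _ (by positivity)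
    fun x => ?_⟩
  calc ‖V t s x‖ ≤ ‖Y t s x‖ + ‖V t s x - Y t s x‖ := by
        simpa using norm_add_le (Y t s x) (V t s x - Y t s x)
    _ ≤ |N| * ‖x‖ + k * √T * ‖x‖ := by
      gcongr
      · exact (Y t s).le_of_opNorm_le ((hN s t hs hst htT).trans (le_abs_self N)) x
      · refine (hVk s t hs hst htT x).trans ?_
        gcongr
        linarith
    _ = (|N| + k * √T) * ‖x‖ := by ring

lemma exists_norm_flow_sub_flow_le (t : ℝ) :
    ∃ m k : ℝ, ∀ s r, 0 ≤ s → s ≤ r → r ≤ t → ∀ x,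
      ‖V t s x - V t r x‖ ≤ |m| * (‖Y r s x - x‖ + k * √(r - s) * ‖x‖) := by
  obtain ⟨k, -, hVk⟩ := hT.exists_norm_flow_sub_le hS hV t
  obtain ⟨m, hm⟩ := hT.flow_isLocallyBounded hS hV t
  refine ⟨m, k, fun s r hs hsr hrt x => ?_⟩
  rw [← hT.flow_comp hS hV hs hsr hrt x, ← map_sub]
  refine ((V t r).le_of_opNorm_le ((hm r t (hs.trans hsr) hrt le_rfl).trans (le_abs_self m))
    _).trans ?_
  gcongr
  calc ‖V r s x - x‖ = ‖(Y r s x - x) + (V r s x - Y r s x)‖ := by abel_nf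
    _ ≤ ‖Y r s x - x‖ + k * √(r - s) * ‖x‖ := norm_add_le_of_le le_rfl (hVk s r hs hsr hrt x)

lemma continuousOn_flow_right (t : ℝ) (x : H) :
    ContinuousOn (fun s => V t s x) (Set.Icc 0 t) := by
  intro r hr
  have hY := hS.evolution
  obtain ⟨m, k, hmk⟩ := hT.exists_norm_flow_sub_flow_le hS hV t
  set bound : ℝ → ℝ := fun s =>
    |m| * (‖extend Y r s x - x‖ + ‖extend Y s r x - x‖ + k * √|r - s| * ‖x‖)
  have hbound : Tendsto bound (𝓝 r) (𝓝 0) := by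
    have hcont : Continuous bound := by
      have hright := hY.continuous_extend_right r x
      have hleft := hY.continuous_extend_left r x
      fun_prop
    simpa [bound, hY.extend_eq_id le_rfl] using hcont.tendsto r
  rw [ContinuousWithinAt, tendsto_iff_norm_sub_tendsto_zero]
  refine squeeze_zero' (Eventually.of_forall fun _ => norm_nonneg _) ?_
    (hbound.mono_left nhdsWithin_le_nhds)
  filter_upwards [self_mem_nhdsWithin] with s hs
  rcases le_total s r with h | h
  · refine (hmk s r hs.1 h hr.2 x).trans (mul_le_mul_of_nonneg_left ?_ (abs_nonneg m))
    rw [extend_of_le Y hs.1 h, abs_of_nonneg (sub_nonneg.2 h)]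
    linarith [norm_nonneg (extend Y s r x - x)]
  · rw [norm_sub_rev]
    refine (hmk r s hr.1 h hs.2 x).trans (mul_le_mul_of_nonneg_left ?_ (abs_nonneg m))
    rw [extend_of_le Y hr.1 h, abs_sub_comm, abs_of_nonneg (sub_nonneg.2 h)]
    linarith [norm_nonneg (extend Y r s x - x)]

theorem isEvolutionOperator : IsEvolutionOperator V where
  refl t ht := ContinuousLinearMap.ext fun x => by
    rw [hV t t ht le_rfl x, trajectory_eq_mild, hS.evolution.mild_self ht,
      ContinuousLinearMap.id_apply]
  comp s r t hs hsr hrt := ContinuousLinearMap.ext fun x => hT.flow_comp hS hV hs hsr hrt x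
  continuousOn_left s hs x :=
    (hS.continuousOn_trajectory hs x fun t =>
      intervalIntegrable_snd (intervalIntegrable_coeFn (T s x) s t)).congr
        fun t ht => hV s t hs ht x
  continuousOn_right t _ x := hT.continuousOn_flow_right hS hV t x

end IsOptimalSignal

end OptimalFlow

/-! ### The optimal control as a feedback -/

section RightDerivatives

variable {F : Type*} [NormedAddCommGroup F]

lemma hasDerivWithinAt_sub_smul [NormedSpace ℝ F] {g : ℝ → F} {s : Set ℝ} {r : ℝ}
    (hg : ContinuousWithinAt g s r) : HasDerivWithinAt (fun t => (t - r) • g t) (g r) s r := by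
  have hsub : Tendsto (fun t => g t - g r) (𝓝[s] r) (𝓝 0) := by
    simpa using hg.tendsto.sub_const (g r)
  refine .of_isLittleO ?_
  simpa [smul_sub] using (Asymptotics.isBigO_refl (fun t : ℝ => t - r) (𝓝[s] r)).smul_isLittleO
    ((Asymptotics.isLittleO_one_iff ℝ).2 hsub)

lemma hasDerivWithinAt_integral_Ici [NormedSpace ℝ F] [CompleteSpace F] {f : ℝ → F} {s : ℝ}
    (hf : ContinuousOn f (Set.Ici s)) :
    HasDerivWithinAt (fun t => ∫ r in s..t, f r) (f s) (Set.Ici s) s :=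
  intervalIntegral.integral_hasDerivWithinAt_right (t := Set.Ioi s) IntervalIntegrable.refl
    ((hf.mono Set.Ioi_subset_Ici_self).stronglyMeasurableAtFilter_nhdsWithin measurableSet_Ioi s)
    ((hf s Set.self_mem_Ici).mono Set.Ioi_subset_Ici_self)

/-- The operators `h` need not be continuous: continuity along the single orbit `v` suffices. -/
lemma hasDerivWithinAt_clm_apply {𝕜 E : Type*} [NontriviallyNormedField 𝕜]
    [NormedAddCommGroup E] [NormedSpace 𝕜 E] [NormedSpace ℝ E] [NormedSpace 𝕜 F] [NormedSpace ℝ F]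
    {h : ℝ → E →L[𝕜] F} {c : ℝ} {s : Set ℝ} {r : ℝ} (hc : ∀ t ∈ s, ‖h t‖ ≤ c)
    {v : ℝ → E} (hv : ContinuousWithinAt v s r)
    (hhv : ContinuousWithinAt (fun t => h t (v t)) s r) {ζ : ℝ → E} (hζr : ζ r = 0)
    (hζ : HasDerivWithinAt ζ (v r) s r) :
    HasDerivWithinAt (fun t => h t (ζ t)) (h r (v r)) s r := by
  have hrem : HasDerivWithinAt (fun t => ζ t - (t - r) • v t) 0 s r := by
    simpa using hζ.fun_sub (hasDerivWithinAt_sub_smul hv)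
  have hhrem : HasDerivWithinAt (fun t => h t (ζ t - (t - r) • v t)) 0 s r := by
    refine .of_isLittleO (Asymptotics.IsBigO.trans_isLittleO (.of_bound c ?_) hrem.isLittleO)
    filter_upwards [self_mem_nhdsWithin] with t ht
    simpa [hζr] using (h t).le_of_opNorm_le (hc t ht) (ζ t - (t - r) • v t)
  have hsum := hhrem.add (hasDerivWithinAt_sub_smul hhv)
  rw [zero_add] at hsum
  refine hsum.congr (fun t _ => ?_) ?_
  · simp [map_sub, map_real_smul (h t) (h t).continuous]
  · simp [hζr]

lemma ae_hasDerivAt_integral_inner {𝕜 : Type*} [RCLike 𝕜] [InnerProductSpace 𝕜 F] [CompleteSpace F]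
    {u : ℝ → F} (hu : LocallyIntegrable u volume) :
    ∀ᵐ r, ∀ v, HasDerivAt (fun t => ∫ q in r..t, inner 𝕜 (u q) v) (inner 𝕜 (u r) v) r := by
  let _ := NormedSpace.restrictScalars ℝ 𝕜 F
  filter_upwards [LocallyIntegrable.ae_hasDerivAt_integral hu] with r hr v
  let ℓ : F →L[ℝ] 𝕜 := RCLike.conjCLE.toContinuousLinearMap ∘L (innerSL 𝕜 v).restrictScalars ℝ
  have hℓ (x : F) : ℓ x = inner 𝕜 x v := inner_conj_symm x v
  have hint (t : ℝ) : IntervalIntegrable u volume r t :=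
    (hu.integrableOn_isCompact isCompact_uIcc).intervalIntegrable
  have hcomm (t : ℝ) : ∫ q in r..t, inner 𝕜 (u q) v = ℓ (∫ q in r..t, u q) := by
    rw [← ℓ.intervalIntegral_comp_comm (hint t)]
    simp only [hℓ]
  rw [funext hcomm, ← hℓ]
  exact ℓ.hasFDerivAt.comp_hasDerivAt r (hr r)

end RightDerivatives

lemma IsEvolutionOperator.hasDerivWithinAt_integral_apply {𝕜 H : Type*} [RCLike 𝕜]
    [NormedAddCommGroup H] [InnerProductSpace 𝕜 H] [NormedSpace ℝ H] [CompleteSpace H]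
    {U : ℝ → ℝ → H →L[𝕜] H} (hU : IsEvolutionOperator U) (hUb : IsLocallyBounded U) {s : ℝ}
    (hs : 0 ≤ s) {f : ℝ → H} (hf : ContinuousOn f (Set.Ici s)) :
    HasDerivWithinAt (fun t => ∫ r in s..t, U t r (f r)) (f s) (Set.Ici s) s := by
  obtain ⟨N, hN⟩ := hUb (s + 1)
  have horbit : ContinuousOn (fun t => U t s (f s)) (Set.Ici s) := hU.continuousOn_left s hs (f s)
  set ψ : ℝ → H := fun r => f r - U r s (f s) with hψ
  have hψ_cont : ContinuousOn ψ (Set.Ici s) := hf.sub horbit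
  have hψs : ψ s = 0 := by simp [hψ, hU.refl s hs]
  have integral_eq {t : ℝ} (hst : s ≤ t) : ∫ r in s..t, U t r (f r)
      = (∫ r in s..t, U t r (ψ r)) + (t - s) • U t s (f s) := by
    have hψ_int : IntervalIntegrable (fun r => U t r (ψ r)) volume s t :=
      hU.intervalIntegrable_apply hUb hs hst
        ((hψ_cont.mono Set.Icc_subset_Ici_self).intervalIntegrable_of_Icc hst)
    rw [← intervalIntegral.integral_const, ← intervalIntegral.integral_add hψ_int
      intervalIntegrable_const]
    refine intervalIntegral.integral_congr fun r hr => ?_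
    rw [Set.uIcc_of_le hst] at hr
    simp only [hψ, map_sub, ← hU.comp s r t hs hr.1 hr.2, ContinuousLinearMap.comp_apply,
      sub_add_cancel]
  have hsmall : HasDerivWithinAt (fun t => ∫ r in s..t, U t r (ψ r)) 0 (Set.Ici s) s := by
    have hnorm := (hasDerivWithinAt_integral_Ici hψ_cont.norm).isLittleO
    refine .of_isLittleO (Asymptotics.IsBigO.trans_isLittleO (.of_bound N ?_) hnorm)
    filter_upwards [self_mem_nhdsWithin,
      mem_nhdsWithin_of_mem_nhds (Iic_mem_nhds (lt_add_one s))] with t (hst : s ≤ t) hts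
    have hψ_int := ((hψ_cont.norm.mono Set.Icc_subset_Ici_self).intervalIntegrable_of_Icc
      (μ := volume) hst)
    simp only [intervalIntegral.integral_same, sub_zero, smul_zero, hψs, norm_zero,
      Real.norm_of_nonneg (intervalIntegral.integral_nonneg hst fun r _ => norm_nonneg (ψ r))]
    rw [← intervalIntegral.integral_const_mul]
    exact intervalIntegral.norm_integral_le_of_norm_le hst (ae_of_all _ fun r hr =>
      (U t r).le_of_opNorm_le (hN r t (hs.trans hr.1.le) hr.2 hts) (ψ r)) (hψ_int.const_mul N)
  have hsum := hsmall.add (hasDerivWithinAt_sub_smul (horbit s Set.self_mem_Ici))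
  rw [zero_add, hU.refl s hs, ContinuousLinearMap.id_apply] at hsum
  exact hsum.congr (fun t ht => integral_eq ht) (integral_eq le_rfl)

section ControlFormula

variable {𝕜 H X G : Type*} [RCLike 𝕜]
  [NormedAddCommGroup H] [InnerProductSpace 𝕜 H] [NormedSpace ℝ H]
  [NormedAddCommGroup X] [InnerProductSpace 𝕜 X] [NormedAddCommGroup G] [InnerProductSpace 𝕜 G]
  {Y V : ℝ → ℝ → H →L[𝕜] H} {B : ℝ → X →L[𝕜] H} {C : ℝ → H →L[𝕜] G}
  {T : ℝ → H →L[𝕜] Lp (WithLp 2 (G × X)) 2 (volume : Measure ℝ)}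

lemma exists_memLp_indicator_Ico {F : Type*} [NormedAddCommGroup F] [InnerProductSpace 𝕜 F]
    {f : ℝ → F} {r t : ℝ} (hrt : r ≤ t) (hf : ContinuousOn f (Set.Icc r t)) :
    ∃ h : MemLp ((Set.Ico r t).indicator f) 2 volume,
      ∀ φ : Lp F 2 (volume : Measure ℝ), inner 𝕜 φ h.toLp = ∫ q in r..t, inner 𝕜 (φ q) (f q) := by
  obtain ⟨c, hc⟩ := isCompact_Icc.bddAbove_image hf.norm
  have hfm := (hf.mono Set.Ico_subset_Icc_self).aestronglyMeasurable measurableSet_Ico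
    (μ := volume)
  have hLp : MemLp ((Set.Ico r t).indicator f) 2 volume := by
    refine (memLp_indicator_iff_restrict measurableSet_Ico).2 (.of_bound hfm c ?_)
    filter_upwards [ae_restrict_mem measurableSet_Ico] with q hq
    exact hc ⟨q, Set.Ico_subset_Icc_self hq, rfl⟩
  refine ⟨hLp, fun φ => ?_⟩
  rw [L2.inner_def, intervalIntegral.integral_of_le hrt, ← integral_Ico_eq_integral_Ioc,
    ← integral_indicator measurableSet_Ico]
  refine integral_congr_ae ?_
  filter_upwards [hLp.coeFn_toLp] with q hq
  rw [hq]
  by_cases hqrt : q ∈ Set.Ico r t <;> simp [hqrt]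

lemma IsControlSystem.continuousOn_output (hS : IsControlSystem Y B) (hC : IsBoundedContinuous C)
    {s : ℝ} (hs : 0 ≤ s) (x : H) {u : ℝ → X} (hu : ∀ t, IntervalIntegrable u volume s t) :
    ContinuousOn (fun t => C t (trajectory Y B s x u t)) (Set.Ici s) :=
  (hC.1.mono (Set.Ici_subset_Ici.2 hs)).clm_apply (hS.continuousOn_trajectory hs x hu)

namespace IsOptimalSignal

variable [CompleteSpace H]
  (hT : IsOptimalSignal Y B C T) (hS : IsControlSystem Y B) (hV : IsOptimalFlow Y B T V)
include hT hS hV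

lemma inner_apply_flow {s r : ℝ} (hs : 0 ≤ s) (hsr : s ≤ r) (x : H)
    {ψ : Lp (WithLp 2 (G × X)) 2 (volume : Measure ℝ)} (hψ : ∀ᵐ t, t < r → ψ t = 0) :
    inner 𝕜 (T r (V r s x)) ψ = inner 𝕜 (T s x) ψ := by
  have htail : MemLp (Set.indicator (Set.Ici r) (T s x)) 2 volume :=
    (Lp.memLp (T s x)).indicator measurableSet_Ici
  rw [← inner_toLp_indicator_Ici htail hψ]
  congr 1
  exact Lp.ext ((hT.apply_flow_ae_eq hS hV hs hsr x).trans htail.coeFn_toLp.symm)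

lemma continuousOn_inner_apply_flow (φ : Lp (WithLp 2 (G × X)) 2 (volume : Measure ℝ)) {r : ℝ}
    (hr : 0 ≤ r) (y : H) :
    ContinuousOn (fun t => inner 𝕜 φ (T t (V t r y))) (Set.Ici r) := by
  have hint : Integrable (fun q => inner 𝕜 (φ q) (T r y q)) volume := L2.integrable_inner φ (T r y)
  have inner_eq {t : ℝ} (hrt : r ≤ t) : inner 𝕜 φ (T t (V t r y))
      = inner 𝕜 φ (T r y) - ∫ q in r..t, inner 𝕜 (φ q) (T r y q) := by
    rw [eq_sub_iff_add_eq, L2.inner_def, L2.inner_def, intervalIntegral.integral_of_le hrt,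
      ← integral_Ico_eq_integral_Ioc, ← integral_indicator measurableSet_Ico,
      ← integral_add (L2.integrable_inner _ _) (hint.indicator measurableSet_Ico)]
    refine integral_congr_ae ?_
    filter_upwards [hT.apply_flow_ae_eq hS hV hr hrt y, (hT.isOutputSignal r hr y).1] with q hq h0
    rw [hq]
    rcases lt_or_ge q r with hqr | hrq
    · simp [h0 hqr, Set.indicator_apply]
    · rcases lt_or_ge q t with hqt | htq
      · simp [hrq, hqt, hqt.not_ge]
      · simp [htq, htq.not_gt]
  refine ContinuousOn.congr ?_ fun t ht => inner_eq ht
  exact (continuous_const.sub (intervalIntegral.continuous_primitive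
    (fun a b => hint.intervalIntegrable) r)).continuousOn

omit hV in
/-- Comparison with the needle variations of the control, which are equal to `v` on `[r, t]` and
optimal afterwards. -/
lemma integral_inner_add_inner_eq_zero (hC : IsBoundedContinuous C) {s r t : ℝ} (hs : 0 ≤ s)
    (hsr : s ≤ r) (hrt : r ≤ t) (x : H) (v : X) :
    (∫ q in r..t, inner 𝕜 (T s x q)
      (WithLp.toLp 2 (C q (trajectory Y B r 0 (fun _ => v) q), v)))
      + inner 𝕜 (T s x) (T t (trajectory Y B r 0 (fun _ => v) t)) = 0 := by
  have hr := hs.trans hsr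
  have hcont : ContinuousOn
      (fun q => WithLp.toLp 2 (C q (trajectory Y B r 0 (fun _ => v) q), v)) (Set.Icc r t) :=
    (WithLp.prod_continuous_toLp 2 G X).comp_continuousOn
      (((hS.continuousOn_output hC hr 0 fun _ => intervalIntegrable_const).mono
        Set.Icc_subset_Ici_self).prodMk continuousOn_const)
  obtain ⟨hLp, hinner⟩ := exists_memLp_indicator_Ico (𝕜 := 𝕜) hrt hcont
  set ψ := T t (trajectory Y B r 0 (fun _ => v) t)
  have hsignal : IsOutputSignal Y B C r 0 (hLp.toLp + ψ : Lp (WithLp 2 (G × X)) 2 volume) := by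
    refine (hS.isOutputSignal_indicator_add hr hrt (u := fun _ => v) intervalIntegrable_const
      (hT.isOutputSignal t (hr.trans hrt) _)).congr ?_
    filter_upwards [Lp.coeFn_add hLp.toLp ψ, hLp.coeFn_toLp] with q hadd hq
    rw [hadd, Pi.add_apply, hq]
  rw [← hinner, ← inner_add_right]
  exact hT.inner_eq_zero s hs x _ (hS.isOutputSignal_zero_of_le hs hsr hsignal)

lemma hasDerivWithinAt_inner_apply_trajectory
    (φ : Lp (WithLp 2 (G × X)) 2 (volume : Measure ℝ)) {r : ℝ} (hr : 0 ≤ r) (v : X) :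
    HasDerivWithinAt (fun t => inner 𝕜 φ (T t (trajectory Y B r 0 (fun _ => v) t)))
      (inner 𝕜 φ (T r (B r v))) (Set.Ici r) r := by
  obtain ⟨c, hc, hTc⟩ := hT.exists_norm_le
  have hVE := hT.isEvolutionOperator hS hV
  have hVr : V r r (B r v) = B r v := by rw [hVE.refl r hr, ContinuousLinearMap.id_apply]
  have hderiv := hS.evolution.hasDerivWithinAt_integral_apply hS.isLocallyBounded hr
    ((hS.input.1.mono (Set.Ici_subset_Ici.2 hr)).clm_apply (continuousOn_const (c := v)))
  have h := hasDerivWithinAt_clm_apply (h := fun t => innerSL 𝕜 φ ∘L T t) (c := ‖φ‖ * c)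
    (v := fun t => V t r (B r v)) (ζ := trajectory Y B r 0 fun _ => v) (s := Set.Ici r) (r := r)
    (fun t (ht : r ≤ t) => ?_) (hVE.continuousOn_left r hr _ r Set.self_mem_Ici)
    (hT.continuousOn_inner_apply_flow hS hV φ hr _ r Set.self_mem_Ici) ?_ ?_
  · rwa [hVr] at h
  · refine (ContinuousLinearMap.opNorm_comp_le _ _).trans ?_
    rw [innerSL_apply_norm]
    gcongr
    exact (T t).opNorm_le_bound hc (hTc t (hr.trans ht))
  · simp [trajectory]
  · have hζ : trajectory Y B r 0 (fun _ => v) = fun t => ∫ q in r..t, Y t q (B q v) := by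
      funext t
      simp [trajectory]
    rwa [hζ, hVr]

lemma integral_inner_output_add (hC : IsBoundedContinuous C) {s r t : ℝ} (hs : 0 ≤ s)
    (hsr : s ≤ r) (hrt : r ≤ t) (x : H) {f : ℝ → G} (hf : ContinuousOn f (Set.Ici r)) (v : X) :
    (∫ q in r..t, inner 𝕜 (C q (V q s x)) (f q)) + ∫ q in r..t, inner 𝕜 (T s x q).snd v
      = ∫ q in r..t, inner 𝕜 (T s x q) (WithLp.toLp 2 (f q, v)) := by
  have hCV : ContinuousOn (fun q => C q (V q s x)) (Set.Icc r t) :=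
    (hC.1.mono fun q hq => hs.trans (hsr.trans hq.1)).clm_apply
      (((hT.isEvolutionOperator hS hV).continuousOn_left s hs x).mono fun q hq => hsr.trans hq.1)
  have hsnd : IntervalIntegrable (fun q => inner 𝕜 (T s x q).snd v) volume r t :=
    intervalIntegrable_iff.2 ((intervalIntegrable_iff.1
      (intervalIntegrable_snd (intervalIntegrable_coeFn (T s x) r t))).inner_const v)
  rw [← intervalIntegral.integral_add
    ((hCV.inner (hf.mono Set.Icc_subset_Ici_self)).intervalIntegrable_of_Icc hrt) hsnd]
  refine intervalIntegral.integral_congr_ae ?_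
  filter_upwards [(hT.isOutputSignal s hs x).2] with q hq hqrt
  have hsq : s ≤ q := hsr.trans (Set.uIoc_of_le hrt ▸ hqrt).1.le
  rw [WithLp.prod_inner_apply, hV s q hs hsq x, ← hq hsq]
  rfl

lemma hasDerivWithinAt_integral_inner_output (hC : IsBoundedContinuous C) {s r : ℝ} (hs : 0 ≤ s)
    (hsr : s ≤ r) (x : H) (v : X) :
    HasDerivWithinAt (fun t => ∫ q in r..t, inner 𝕜 (C q (V q s x))
      (C q (trajectory Y B r 0 (fun _ => v) q))) 0 (Set.Ici r) r := by
  have hr := hs.trans hsr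
  have h := hasDerivWithinAt_integral_Ici
    (((hC.1.mono (Set.Ici_subset_Ici.2 hr)).clm_apply
      (((hT.isEvolutionOperator hS hV).continuousOn_left s hs x).mono
        (Set.Ici_subset_Ici.2 hsr))).inner (𝕜 := 𝕜)
      (hS.continuousOn_output hC hr 0 fun _ => intervalIntegrable_const (c := v)))
  simpa [trajectory] using h

theorem snd_ae_eq_neg_adjoint [CompleteSpace X] [CompleteSpace G] (hC : IsBoundedContinuous C)
    {s : ℝ} (hs : 0 ≤ s) (x : H) :
    ∀ᵐ r, s ≤ r → (T s x r).snd = -(B r).adjoint ((T r).adjoint (T r (V r s x))) := by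
  have hu : LocallyIntegrable (fun q => (T s x q).snd) volume :=
    ((WithLp.sndL 2 𝕜 G X).comp_memLp' (Lp.memLp (T s x))).locallyIntegrable one_le_two
  filter_upwards [ae_hasDerivAt_integral_inner (𝕜 := 𝕜) hu] with r hur hsr
  refine ext_inner_right 𝕜 fun v => ?_
  rw [inner_neg_left, ContinuousLinearMap.adjoint_inner_left,
    ContinuousLinearMap.adjoint_inner_left]
  have hr := hs.trans hsr
  have hderiv := ((hT.hasDerivWithinAt_integral_inner_output hS hV hC hs hsr x v).fun_add
    (hur v).hasDerivWithinAt).fun_add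
      (hT.hasDerivWithinAt_inner_apply_trajectory hS hV (T s x) hr v)
  have sum_eq_zero (t : ℝ) (hrt : t ∈ Set.Ici r) :
      (∫ q in r..t, inner 𝕜 (C q (V q s x)) (C q (trajectory Y B r 0 (fun _ => v) q)))
        + (∫ q in r..t, inner 𝕜 (T s x q).snd v)
        + inner 𝕜 (T s x) (T t (trajectory Y B r 0 (fun _ => v) t)) = 0 := by
    rw [hT.integral_inner_output_add hS hV hC hs hsr hrt x
      (hS.continuousOn_output hC hr 0 fun _ => intervalIntegrable_const) v,
      hT.integral_inner_add_inner_eq_zero hS hC hs hsr hrt]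
  have hzero := (uniqueDiffWithinAt_Ici r).eq_deriv _ hderiv
    ((hasDerivWithinAt_const r _ 0).congr sum_eq_zero (sum_eq_zero r Set.self_mem_Ici))
  rw [zero_add] at hzero
  rw [hT.inner_apply_flow hS hV hs hsr x (hT.isOutputSignal r hr _).1]
  exact eq_neg_of_add_eq_zero_left hzero

end IsOptimalSignal

end ControlFormula

/-! ### The closed loop -/

namespace IsBoundedContinuous

variable {𝕜 E F G : Type*} [RCLike 𝕜] [NormedAddCommGroup E] [NormedSpace 𝕜 E]
  [NormedAddCommGroup F] [NormedSpace 𝕜 F] [NormedAddCommGroup G] [NormedSpace 𝕜 G]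

lemma const (A : E →L[𝕜] F) : IsBoundedContinuous fun _ => A :=
  ⟨continuousOn_const, ‖A‖, fun _ _ => le_rfl⟩

lemma sub {A B : ℝ → E →L[𝕜] F} (hA : IsBoundedContinuous A) (hB : IsBoundedContinuous B) :
    IsBoundedContinuous fun t => A t - B t := by
  obtain ⟨a, ha⟩ := hA.2
  obtain ⟨b, hb⟩ := hB.2
  exact ⟨hA.1.sub hB.1, a + b, fun t ht => norm_sub_le_of_le (ha t ht) (hb t ht)⟩

lemma comp {A : ℝ → F →L[𝕜] G} {B : ℝ → E →L[𝕜] F} (hA : IsBoundedContinuous A)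
    (hB : IsBoundedContinuous B) : IsBoundedContinuous fun t => A t ∘L B t := by
  obtain ⟨a, ha⟩ := hA.2
  obtain ⟨b, hb⟩ := hB.2
  refine ⟨hA.1.clm_comp hB.1, a * b, fun t ht => (ContinuousLinearMap.opNorm_comp_le _ _).trans ?_⟩
  exact mul_le_mul (ha t ht) (hb t ht) (norm_nonneg _) ((norm_nonneg _).trans (ha t ht))

lemma exists_integral_norm_sq_apply_le {A : ℝ → E →L[𝕜] F} (hA : IsBoundedContinuous A) :
    ∃ a : ℝ, 0 ≤ a ∧ ∀ s t, 0 ≤ s → s ≤ t → ∀ φ : Lp E 2 (volume : Measure ℝ),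
      AEStronglyMeasurable (fun r => A r (φ r)) (volume.restrict (Set.Ioc s t)) ∧
      IntervalIntegrable (fun r => ‖A r (φ r)‖ ^ 2) volume s t ∧
      ∫ r in s..t, ‖A r (φ r)‖ ^ 2 ≤ a * ‖φ‖ ^ 2 := by
  obtain ⟨a, ha⟩ := hA.2
  refine ⟨a ^ 2, sq_nonneg a, fun s t hs hst φ => ?_⟩
  have hm : AEStronglyMeasurable (fun r => A r (φ r)) (volume.restrict (Set.Ioc s t)) :=
    (intervalIntegrable_clm_apply hst (hA.1.mono fun _ hr => hs.trans hr.1)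
      (intervalIntegrable_coeFn φ s t)).aestronglyMeasurable
  have hle (r : ℝ) (hr : r ∈ Set.Ioc s t) : ‖A r (φ r)‖ ^ 2 ≤ a ^ 2 * ‖φ r‖ ^ 2 := by
    rw [← mul_pow]
    gcongr
    exact (A r).le_of_opNorm_le (ha r (hs.trans hr.1.le)) _
  have hφ : IntegrableOn (fun r => a ^ 2 * ‖φ r‖ ^ 2) (Set.Ioc s t) :=
    ((integrable_norm_sq φ).const_mul _).integrableOn
  have hint : IntegrableOn (fun r => ‖A r (φ r)‖ ^ 2) (Set.Ioc s t) := by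
    refine hφ.mono' (hm.norm.pow 2) ?_
    filter_upwards [ae_restrict_mem measurableSet_Ioc] with r hr
    rw [Real.norm_of_nonneg (sq_nonneg _)]
    exact hle r hr
  refine ⟨hm, (intervalIntegrable_iff_integrableOn_Ioc_of_le hst).2 hint, ?_⟩
  calc ∫ r in s..t, ‖A r (φ r)‖ ^ 2 ≤ ∫ r in s..t, a ^ 2 * ‖φ r‖ ^ 2 := by
        rw [intervalIntegral.integral_of_le hst, intervalIntegral.integral_of_le hst]
        exact setIntegral_mono_on hint hφ measurableSet_Ioc hle
    _ = a ^ 2 * ∫ r in s..t, ‖φ r‖ ^ 2 := intervalIntegral.integral_const_mul _ _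
    _ ≤ a ^ 2 * ‖φ‖ ^ 2 := by gcongr; exact integral_norm_sq_le φ hst

end IsBoundedContinuous

section ClosedLoop

variable {𝕜 H X G : Type*} [RCLike 𝕜]
  [NormedAddCommGroup H] [InnerProductSpace 𝕜 H] [NormedSpace ℝ H] [CompleteSpace H]
  [NormedAddCommGroup X] [InnerProductSpace 𝕜 X] [NormedAddCommGroup G] [InnerProductSpace 𝕜 G]
  {Y V : ℝ → ℝ → H →L[𝕜] H} {B : ℝ → X →L[𝕜] H} {C : ℝ → H →L[𝕜] G} {D : ℝ → H →L[𝕜] H}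
  {T : ℝ → H →L[𝕜] Lp (WithLp 2 (G × X)) 2 (volume : Measure ℝ)}

lemma IsOutputSignal.trajectory_eq_mild_sub (hS : IsControlSystem Y B) (hC : IsBoundedContinuous C)
    {L : ℝ → G →L[𝕜] H} (hL : IsBoundedContinuous L) {U : ℝ → ℝ → H →L[𝕜] H}
    (hU : IsPerturbedEvolution Y (fun t => L t ∘L C t) U) (hUb : IsLocallyBounded U) {s t : ℝ}
    (hs : 0 ≤ s) (hst : s ≤ t) {x : H} {φ : ℝ → WithLp 2 (G × X)}
    (hφ : IsOutputSignal Y B C s x φ) (hi : IntervalIntegrable φ volume s t) :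
    trajectory Y B s x (fun r => (φ r).snd) t
      = mild U s x (fun r => B r (φ r).snd - L r (φ r).fst) t := by
  rw [trajectory_eq_mild, hU.mild_eq_sub hS.evolution hS.isLocallyBounded hUb (hL.comp hC) hs hst x
    (hS.intervalIntegrable_input hs hst (intervalIntegrable_snd hi))]
  refine mild_congr hst ?_
  filter_upwards [hφ.2] with q hq hqt
  rw [hq hqt.1.le, trajectory_eq_mild]
  rfl

namespace IsOptimalSignal

variable (hT : IsOptimalSignal Y B C T) (hS : IsControlSystem Y B) (hV : IsOptimalFlow Y B T V)
include hT hS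

include hV in
theorem isPerturbedEvolution [CompleteSpace X] [CompleteSpace G] (hC : IsBoundedContinuous C)
    (hD : ∀ t, 0 ≤ t → D t = -(B t ∘L (B t).adjoint ∘L (T t).adjoint ∘L T t)) :
    IsPerturbedEvolution Y D V := by
  have hae (s : ℝ) (hs : 0 ≤ s) (x : H) :
      ∀ᵐ r, s < r → D r (V r s x) = B r (T s x r).snd := by
    filter_upwards [hT.snd_ae_eq_neg_adjoint hS hV hC hs x] with r hr hsr
    rw [hr hsr.le, hD r (hs.trans hsr.le), map_neg]
    rfl
  refine ⟨hT.isEvolutionOperator hS hV, fun s t hs hst x => ?_, fun s t hs hst x => ?_⟩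
  · have h := hS.evolution.intervalIntegrable_apply hS.isLocallyBounded hs hst
      (hS.intervalIntegrable_input hs hst
        (intervalIntegrable_snd (intervalIntegrable_coeFn (T s x) s t)))
    rw [intervalIntegrable_iff_integrableOn_Ioc_of_le hst] at h ⊢
    refine h.congr ?_
    filter_upwards [ae_restrict_of_ae (hae s hs x), ae_restrict_mem measurableSet_Ioc] with r hr hrt
    rw [hr hrt.1]
  · rw [hV s t hs hst x, trajectory]
    congr 1
    refine intervalIntegral.integral_congr_ae ?_
    filter_upwards [hae s hs x] with r hr hrt
    rw [hr (Set.uIoc_of_le hst ▸ hrt).1]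

include hV in
theorem isExponentiallyStable (hC : IsBoundedContinuous C) (hdet : IsUniformlyDetectable Y C) :
    IsExponentiallyStable V := by
  obtain ⟨L, hL, U, hU, hUs⟩ := hdet
  obtain ⟨m, hm, hmild⟩ := hUs.exists_mild_le hU.isEvolutionOperator
  obtain ⟨c, -, hTc⟩ := hT.exists_norm_le
  obtain ⟨a, ha, hforce⟩ := ((hS.input.comp (.const (WithLp.sndL 2 𝕜 G X))).sub
    (hL.comp (.const (WithLp.fstL 2 𝕜 G X)))).exists_integral_norm_sq_apply_le
  have flow_le (s t : ℝ) (hs : 0 ≤ s) (hst : s ≤ t) (x : H) :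
      ‖V t s x‖ ^ 2 ≤ m * (1 + a * c ^ 2) * ‖x‖ ^ 2 ∧
      ∫ r in s..t, ‖V r s x‖ ^ 2 ≤ m * (1 + a * c ^ 2) * ‖x‖ ^ 2 := by
    have flow_eq (r : ℝ) (hr : s ≤ r) :
        V r s x = mild U s x (fun q => B q (T s x q).snd - L q (T s x q).fst) r := by
      rw [hV s r hs hr x]
      exact (hT.isOutputSignal s hs x).trajectory_eq_mild_sub hS hC hL hU hUs.isLocallyBounded hs hr
        (intervalIntegrable_coeFn (T s x) s r)
    obtain ⟨hfm, hfi, hfle⟩ := hforce s t hs hst (T s x)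
    obtain ⟨hbound, hintegral⟩ := hmild s t hs hst x _ hfm hfi
    have data_le : m * (‖x‖ ^ 2 + ∫ r in s..t, ‖B r (T s x r).snd - L r (T s x r).fst‖ ^ 2)
        ≤ m * (1 + a * c ^ 2) * ‖x‖ ^ 2 := by
      have hTx : ‖T s x‖ ^ 2 ≤ (c * ‖x‖) ^ 2 := by gcongr; exact hTc s hs x
      calc _ ≤ m * (‖x‖ ^ 2 + a * (c * ‖x‖) ^ 2) := by
            gcongr
            exact hfle.trans (by gcongr)
        _ = m * (1 + a * c ^ 2) * ‖x‖ ^ 2 := by ring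
    refine ⟨flow_eq t hst ▸ hbound.trans data_le, (le_of_eq ?_).trans (hintegral.trans data_le)⟩
    refine intervalIntegral.integral_congr fun r hr => ?_
    rw [flow_eq r (Set.uIcc_of_le hst ▸ hr).1]
    rfl
  exact (hT.isEvolutionOperator hS hV).isExponentiallyStable_of_integral_le
    (fun s t hs hst x => (flow_le s t hs hst x).1) fun s t hs hst x => (flow_le s t hs hst x).2

lemma exists_norm_feedback_le [CompleteSpace X] [CompleteSpace G] :
    ∃ d : ℝ, ∀ t, 0 ≤ t → ‖B t ∘L (B t).adjoint ∘L (T t).adjoint ∘L T t‖ ≤ d := by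
  obtain ⟨b, hb⟩ := hS.input.2
  obtain ⟨c, hc, hTc⟩ := hT.exists_norm_le
  refine ⟨b * (b * (c * c)), fun t ht => ?_⟩
  have hTt : ‖T t‖ ≤ c := (T t).opNorm_le_bound hc (hTc t ht)
  have hb0 : 0 ≤ b := (norm_nonneg _).trans (hb t ht)
  calc _ ≤ ‖B t‖ * (‖(B t).adjoint‖ * (‖(T t).adjoint‖ * ‖T t‖)) := by
        refine (ContinuousLinearMap.opNorm_comp_le _ _).trans ?_
        gcongr
        refine (ContinuousLinearMap.opNorm_comp_le _ _).trans ?_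
        gcongr
        exact ContinuousLinearMap.opNorm_comp_le _ _
    _ ≤ b * (b * (c * c)) := by
        simp only [LinearIsometryEquiv.norm_map]
        gcongr <;> exact hb t ht

theorem exists_isPerturbedEvolution_and_isExponentiallyStable [CompleteSpace X] [CompleteSpace G]
    (hC : IsBoundedContinuous C) (hdet : IsUniformlyDetectable Y C)
    (hD : ∀ t, 0 ≤ t → D t = -(B t ∘L (B t).adjoint ∘L (T t).adjoint ∘L T t)) :
    (∃ V, IsPerturbedEvolution Y D V) ∧
      ∀ V, IsPerturbedEvolution Y D V → IsExponentiallyStable V := by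
  obtain ⟨V, hV⟩ := hS.exists_isOptimalFlow T
  have hVD := hT.isPerturbedEvolution hS hV hC hD
  refine ⟨⟨V, hVD⟩, fun V' hV' => ?_⟩
  obtain ⟨d, hd⟩ := hT.exists_norm_feedback_le hS
  obtain ⟨M, α, hM, hα, hVle⟩ := hT.isExponentiallyStable hS hV hC hdet
  refine ⟨M, α, hM, hα, fun s t hs hst => ?_⟩
  rw [hV'.eq hS.isLocallyBounded hVD ⟨d, fun t ht => ?_⟩ hs hst]
  · exact hVle s t hs hst
  · rw [hD t ht, norm_neg]
    exact hd t ht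

end IsOptimalSignal

end ClosedLoop

/-! ### Reduction to unit control weight -/

section InverseSqrt

variable {𝕜 X : Type*} [RCLike 𝕜] [NormedAddCommGroup X] [InnerProductSpace 𝕜 X] [CompleteSpace X]
  {R : X →L[𝕜] X}

lemma isUnit_of_coercive {δ : ℝ} (hδ : 0 < δ)
    (h : ∀ v, δ * ‖v‖ ^ 2 ≤ RCLike.re (inner 𝕜 v (R v))) : IsUnit R := by
  refine ContinuousLinearMap.isUnit_of_forall_le_norm_inner_map R (c := ⟨δ, hδ.le⟩) hδ fun v => ?_
  rw [mul_comm, norm_inner_symm]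
  exact (h v).trans (RCLike.re_le_norm _)

lemma isPositive_of_coercive (hR : IsSelfAdjoint R) {δ : ℝ} (hδ : 0 ≤ δ)
    (h : ∀ v, δ * ‖v‖ ^ 2 ≤ RCLike.re (inner 𝕜 v (R v))) : R.IsPositive := by
  rw [ContinuousLinearMap.isPositive_def']
  refine ⟨hR, fun v => ?_⟩
  rw [ContinuousLinearMap.reApplyInnerSelf_apply, inner_re_symm]
  exact (by positivity : 0 ≤ δ * ‖v‖ ^ 2).trans (h v)

/-- The operator `R^(-1/2)`, for a positive invertible operator `R`. -/
noncomputable def inverseSqrt (R : X →L[𝕜] X) : X →L[𝕜] X := R.inverse * posSqrt R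

lemma inverseSqrt_mul_posSqrt (hpos : R.IsPositive) (hu : IsUnit R) :
    inverseSqrt R * posSqrt R = 1 := by
  rw [inverseSqrt, mul_assoc, posSqrt_mul_self hpos, ← ContinuousLinearMap.ringInverse_eq_inverse,
    Ring.inverse_mul_cancel _ hu]

lemma posSqrt_mul_inverseSqrt (hpos : R.IsPositive) (hu : IsUnit R) :
    posSqrt R * inverseSqrt R = 1 := by
  have right_inverse : posSqrt R * (posSqrt R * R.inverse) = 1 := by
    rw [← mul_assoc, posSqrt_mul_self hpos, ← ContinuousLinearMap.ringInverse_eq_inverse,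
      Ring.mul_inverse_cancel _ hu]
  rwa [left_inv_eq_right_inv (inverseSqrt_mul_posSqrt hpos hu) right_inverse]

lemma inverseSqrt_mul_self (hpos : R.IsPositive) (hu : IsUnit R) :
    inverseSqrt R * inverseSqrt R = R.inverse := by
  nth_rewrite 1 [inverseSqrt]
  rw [mul_assoc, posSqrt_mul_inverseSqrt hpos hu, mul_one]

lemma isSelfAdjoint_inverseSqrt (hpos : R.IsPositive) (hu : IsUnit R) :
    IsSelfAdjoint (inverseSqrt R) := by
  have hS : star (posSqrt R) = posSqrt R := (posSqrt_isPositive hpos).isSelfAdjoint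
  refine left_inv_eq_right_inv (a := posSqrt R) ?_ (posSqrt_mul_inverseSqrt hpos hu)
  nth_rewrite 1 [← hS]
  rw [← star_mul, posSqrt_mul_inverseSqrt hpos hu, star_one]

lemma norm_inverseSqrt_le (hpos : R.IsPositive) {δ : ℝ} (hδ : 0 < δ)
    (h : ∀ v, δ * ‖v‖ ^ 2 ≤ RCLike.re (inner 𝕜 v (R v))) : ‖inverseSqrt R‖ ≤ (√δ)⁻¹ := by
  refine ContinuousLinearMap.opNorm_le_bound _ (by positivity) fun v => ?_
  have hv := h (inverseSqrt R v)
  rw [← norm_posSqrt_apply_sq hpos, ← mul_apply_eq_comp,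
    posSqrt_mul_inverseSqrt hpos (isUnit_of_coercive hδ h), one_apply_eq_self] at hv
  rw [← div_eq_inv_mul, le_div_iff₀ (Real.sqrt_pos.2 hδ)]
  refine le_of_sq_le_sq ?_ (norm_nonneg v)
  rwa [mul_pow, Real.sq_sqrt hδ.le, mul_comm]

lemma IsBoundedContinuous.inverseSqrt {R : ℝ → X →L[𝕜] X} (hR : IsBoundedContinuous R)
    (hpos : ∀ t, 0 ≤ t → (R t).IsPositive) {δ : ℝ} (hδ : 0 < δ)
    (h : ∀ t, 0 ≤ t → ∀ v, δ * ‖v‖ ^ 2 ≤ RCLike.re (inner 𝕜 v (R t v))) :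
    IsBoundedContinuous fun t => InfiniteHorizonLQ.inverseSqrt (R t) := by
  refine ⟨ContinuousOn.mul (fun t ht => ?_) (hR.posSqrt hpos).1, (√δ)⁻¹, fun t ht =>
    norm_inverseSqrt_le (hpos t ht) hδ (h t ht)⟩
  obtain ⟨a, ha⟩ := isUnit_of_coercive hδ (h t ht)
  have hcont : ContinuousAt ContinuousLinearMap.inverse (R t) := by
    rw [← ContinuousLinearMap.ringInverse_eq_inverse, ← ha]
    exact NormedRing.inverse_continuousAt a
  exact hcont.comp_continuousWithinAt (hR.1 t ht)

lemma comp_feedback {H : Type*} [NormedAddCommGroup H] [InnerProductSpace 𝕜 H] [CompleteSpace H]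
    {B : ℝ → X →L[𝕜] H} {R : ℝ → X →L[𝕜] X} (P : ℝ → H →L[𝕜] H) {t : ℝ}
    (hpos : (R t).IsPositive) (hu : IsUnit (R t)) :
    B t ∘L feedback B R P t
      = (B t ∘L inverseSqrt (R t)) ∘L (B t ∘L inverseSqrt (R t)).adjoint ∘L P t := by
  rw [feedback, ContinuousLinearMap.adjoint_comp, (isSelfAdjoint_inverseSqrt hpos hu).adjoint_eq,
    ← inverseSqrt_mul_self hpos hu]
  rfl

end InverseSqrt

section Cost

lemma memLp_two_of_lintegral_norm_sq_ne_top {α F : Type*} [MeasurableSpace α] {ν : Measure α}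
    [NormedAddCommGroup F] {f : α → F} (hm : AEStronglyMeasurable f ν)
    (hf : ∫⁻ r, ENNReal.ofReal (‖f r‖ ^ 2) ∂ν ≠ ⊤) : MemLp f 2 ν := by
  rw [memLp_two_iff_integrable_sq_norm hm]
  refine ⟨hm.norm.pow 2, ?_⟩
  rw [hasFiniteIntegral_iff_ofReal (ae_of_all _ fun _ => sq_nonneg _)]
  exact hf.lt_top

variable {𝕜 H X G : Type*} [RCLike 𝕜]
  [NormedAddCommGroup H] [InnerProductSpace 𝕜 H]
  [NormedAddCommGroup X] [InnerProductSpace 𝕜 X] [NormedAddCommGroup G] [InnerProductSpace 𝕜 G]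
  {Y : ℝ → ℝ → H →L[𝕜] H} {B : ℝ → X →L[𝕜] H} {W : ℝ → H →L[𝕜] H} {C : ℝ → H →L[𝕜] G}
  {R S S' : ℝ → X →L[𝕜] X}

/-- The weights factor as `W = C* C` and `R = S* S`, and `S` is invertible with inverse `S'`. The
control `v = S u` of the system with input operator `B S'` then has the weight `1`. -/
structure IsCostFactorization (W : ℝ → H →L[𝕜] H) (R : ℝ → X →L[𝕜] X) (C : ℝ → H →L[𝕜] G)
    (S S' : ℝ → X →L[𝕜] X) : Prop where
  norm_output_sq : ∀ t, 0 ≤ t → ∀ z, ‖C t z‖ ^ 2 = RCLike.re (inner 𝕜 z (W t z))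
  norm_control_sq : ∀ t, 0 ≤ t → ∀ v, ‖S t v‖ ^ 2 = RCLike.re (inner 𝕜 v (R t v))
  left_inv : ∀ t, 0 ≤ t → ∀ v, S' t (S t v) = v
  right_inv : ∀ t, 0 ≤ t → ∀ v, S t (S' t v) = v

lemma isCostFactorization_adjoint_comp_self [CompleteSpace H] [CompleteSpace X] [CompleteSpace G]
    (hW : ∀ t, 0 ≤ t → W t = (C t).adjoint ∘L C t) (hpos : ∀ t, 0 ≤ t → (R t).IsPositive)
    (hu : ∀ t, 0 ≤ t → IsUnit (R t)) :
    IsCostFactorization W R C (fun t => posSqrt (R t)) fun t => inverseSqrt (R t) where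
  norm_output_sq t ht z := by
    rw [hW t ht, ContinuousLinearMap.comp_apply, ContinuousLinearMap.adjoint_inner_right,
      inner_self_eq_norm_sq]
  norm_control_sq t ht := norm_posSqrt_apply_sq (hpos t ht)
  left_inv t ht := DFunLike.congr_fun (inverseSqrt_mul_posSqrt (hpos t ht) (hu t ht))
  right_inv t ht := DFunLike.congr_fun (posSqrt_mul_inverseSqrt (hpos t ht) (hu t ht))

variable [NormedSpace ℝ H]

lemma IsPerturbedEvolution.congr {V : ℝ → ℝ → H →L[𝕜] H} {D D' : ℝ → H →L[𝕜] H}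
    (hV : IsPerturbedEvolution Y D V) (h : ∀ t, 0 ≤ t → D t = D' t) :
    IsPerturbedEvolution Y D' V := by
  refine ⟨hV.isEvolutionOperator, fun s t hs hst w => ?_, fun s t hs hst w => ?_⟩
  · refine (hV.intervalIntegrable s t hs hst w).congr fun r hr => ?_
    rw [Set.uIoc_of_le hst] at hr
    simp only [h r (hs.trans hr.1.le)]
  · rw [hV.eq_add_integral s t hs hst w]
    congr 1
    refine intervalIntegral.integral_congr fun r hr => ?_
    rw [Set.uIcc_of_le hst] at hr
    simp only [h r (hs.trans hr.1)]

lemma IsUniformlyStabilizable.comp_of_leftInverse (hstab : IsUniformlyStabilizable Y B)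
    (hS : IsBoundedContinuous S) (hinv : ∀ t, 0 ≤ t → ∀ v, S' t (S t v) = v) :
    IsUniformlyStabilizable Y fun t => B t ∘L S' t := by
  obtain ⟨K, hK, Z, hZ, hZs⟩ := hstab
  refine ⟨_, hS.comp hK, Z, hZ.congr fun t ht => ?_, hZs⟩
  ext x
  exact congrArg (B t) (hinv t ht (K t x)).symm

lemma IsUniformlyStabilizable.isControlSystem [CompleteSpace H]
    (hstab : IsUniformlyStabilizable Y B) (hY : IsEvolutionOperator Y)
    (hB : IsBoundedContinuous B) : IsControlSystem Y B := by
  obtain ⟨K, hK, Z, hZ, hZs⟩ := hstab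
  exact ⟨hY, hZ.isLocallyBounded_base hY hZs.isLocallyBounded (hB.comp hK).2, hB⟩

lemma IsOptimalCostOperator.eq [CompleteSpace H] {P Q : ℝ → H →L[𝕜] H}
    (hP : IsOptimalCostOperator Y B W R P) (hQ : IsOptimalCostOperator Y B W R Q) {s : ℝ}
    (hs : 0 ≤ s) : P s = Q s := by
  refine eq_of_re_inner_eq (hP s hs).1 (hQ s hs).1 fun x => ?_
  exact (ENNReal.ofReal_eq_ofReal_iff ((hP s hs).1.re_inner_nonneg_left x)
    ((hQ s hs).1.re_inner_nonneg_left x)).1 (((hP s hs).2 x).unique ((hQ s hs).2 x))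

/-- The signal `(C z, S u)` of a control `u`, extended by `0` to the times before `s`. -/
noncomputable def costSignal (Y : ℝ → ℝ → H →L[𝕜] H) (B : ℝ → X →L[𝕜] H) (C : ℝ → H →L[𝕜] G)
    (S : ℝ → X →L[𝕜] X) (s : ℝ) (x : H) (u : ℝ → X) : ℝ → WithLp 2 (G × X) :=
  Set.indicator (Set.Ici s) fun r => WithLp.toLp 2 (C r (trajectory Y B s x u r), S r (u r))

lemma costSignal_of_le {s t : ℝ} (hst : s ≤ t) (x : H) (u : ℝ → X) :
    costSignal Y B C S s x u t = WithLp.toLp 2 (C t (trajectory Y B s x u t), S t (u t)) :=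
  Set.indicator_of_mem (Set.mem_Ici.2 hst) _

lemma trajectory_comp_input {s t : ℝ} (hst : s ≤ t) (x : H) {u v : ℝ → X}
    (h : ∀ r, s ≤ r → S' r (v r) = u r) :
    trajectory Y (fun r => B r ∘L S' r) s x v t = trajectory Y B s x u t :=
  mild_congr hst (ae_of_all _ fun r hr => congrArg (B r) (h r hr.1.le))

namespace IsCostFactorization

variable (hf : IsCostFactorization W R C S S') {s : ℝ} (hs : 0 ≤ s) (x : H)
include hf hs

lemma infiniteCost_eq_lintegral (u : ℝ → X) :
    infiniteCost Y B W R s x u = ∫⁻ r, ENNReal.ofReal (‖costSignal Y B C S s x u r‖ ^ 2) := by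
  rw [infiniteCost, ← lintegral_indicator measurableSet_Ici]
  refine lintegral_congr fun r => ?_
  by_cases hr : r ∈ Set.Ici s
  · have hr0 := hs.trans hr
    rw [Set.indicator_of_mem hr, costSignal_of_le hr, WithLp.prod_norm_sq_eq_of_L2,
      WithLp.toLp_fst, WithLp.toLp_snd, ← hf.norm_output_sq r hr0, ← hf.norm_control_sq r hr0]
  · simp [costSignal, Set.indicator_of_notMem hr]

lemma trajectory_snd_costSignal {t : ℝ} (hst : s ≤ t) (u : ℝ → X) :
    trajectory Y (fun r => B r ∘L S' r) s x (fun r => (costSignal Y B C S s x u r).snd) t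
      = trajectory Y B s x u t :=
  trajectory_comp_input hst x fun r hr => by
    rw [costSignal_of_le hr, WithLp.toLp_snd, hf.left_inv r (hs.trans hr)]

lemma isOutputSignal_costSignal (u : ℝ → X) :
    IsOutputSignal Y (fun r => B r ∘L S' r) C s x (costSignal Y B C S s x u) := by
  refine ⟨ae_of_all _ fun t ht => Set.indicator_of_notMem (s := Set.Ici s) (not_le.2 ht) _,
    ae_of_all _ fun t ht => ?_⟩
  rw [hf.trajectory_snd_costSignal hs x ht, costSignal_of_le ht, WithLp.toLp_fst]

lemma costSignal_snd_ae_eq {φ : ℝ → WithLp 2 (G × X)}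
    (hφ : IsOutputSignal Y (fun r => B r ∘L S' r) C s x φ) :
    costSignal Y B C S s x (fun r => S' r (φ r).snd) =ᵐ[volume] φ := by
  filter_upwards [hφ.1, hφ.2] with r hzero houtput
  rcases lt_or_ge r s with hr | hr
  · rw [hzero hr]
    exact Set.indicator_of_notMem (s := Set.Ici s) (not_le.2 hr) _
  · rw [costSignal_of_le hr, hf.right_inv r (hs.trans hr),
      ← trajectory_comp_input hr x fun _ _ => rfl, ← houtput hr]
    rfl

lemma infiniteCost_snd {φ : Lp (WithLp 2 (G × X)) 2 (volume : Measure ℝ)}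
    (hφ : IsOutputSignal Y (fun r => B r ∘L S' r) C s x φ) :
    infiniteCost Y B W R s x (fun r => S' r (φ r).snd) = ENNReal.ofReal (‖φ‖ ^ 2) := by
  rw [hf.infiniteCost_eq_lintegral hs x, ofReal_norm_sq_eq_lintegral]
  refine lintegral_congr_ae ?_
  filter_upwards [hf.costSignal_snd_ae_eq hs x hφ] with r hr
  rw [hr]

lemma memLp_costSignal (hB : IsControlSystem Y fun t => B t ∘L S' t) (hC : IsBoundedContinuous C)
    (hS : IsBoundedContinuous S) {u : ℝ → X}
    (hu : AEStronglyMeasurable u (volume.restrict (Set.Ici s)))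
    (hcost : infiniteCost Y B W R s x u ≠ ⊤) : MemLp (costSignal Y B C S s x u) 2 volume := by
  have hsub : Set.Ici s ⊆ Set.Ici 0 := Set.Ici_subset_Ici.2 hs
  rw [hf.infiniteCost_eq_lintegral hs x] at hcost
  have hSu : AEStronglyMeasurable (fun r => S r (u r)) (volume.restrict (Set.Ici s)) :=
    aestronglyMeasurable_clm_apply (fun v =>
      ((hS.1.mono hsub).clm_apply continuousOn_const).aestronglyMeasurable measurableSet_Ici) hu
  have snd_eq : (fun r => (costSignal Y B C S s x u r).snd)
      = Set.indicator (Set.Ici s) fun r => S r (u r) := by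
    ext r
    by_cases hr : r ∈ Set.Ici s <;> simp [costSignal, hr]
  have snd_memLp : MemLp (fun r => (costSignal Y B C S s x u r).snd) 2 volume := by
    refine memLp_two_of_lintegral_norm_sq_ne_top
      (snd_eq ▸ (aestronglyMeasurable_indicator_iff measurableSet_Ici).2 hSu)
      (ne_top_of_le_ne_top hcost (lintegral_mono fun r => ENNReal.ofReal_le_ofReal ?_))
    gcongr
    exact WithLp.norm_snd_le _ _
  have trajectory_cont : ContinuousOn (trajectory Y B s x u) (Set.Ici s) :=
    (hB.continuousOn_trajectory hs x fun t => ((snd_memLp.locallyIntegrable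
      one_le_two).integrableOn_isCompact isCompact_uIcc).intervalIntegrable).congr
      fun t ht => (hf.trajectory_snd_costSignal hs x ht u).symm
  have hCz : AEStronglyMeasurable (fun r => C r (trajectory Y B s x u r))
      (volume.restrict (Set.Ici s)) :=
    ((hC.1.mono hsub).clm_apply trajectory_cont).aestronglyMeasurable measurableSet_Ici
  exact memLp_two_of_lintegral_norm_sq_ne_top
    ((aestronglyMeasurable_indicator_iff measurableSet_Ici).2
      ((WithLp.prod_continuous_toLp 2 G X).comp_aestronglyMeasurable (hCz.prodMk hSu))) hcost

end IsCostFactorization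

namespace IsOptimalSignal

variable [CompleteSpace H] {T : ℝ → H →L[𝕜] Lp (WithLp 2 (G × X)) 2 (volume : Measure ℝ)}

lemma norm_le (hT : IsOptimalSignal Y B C T) (hB : IsControlSystem Y B) {s : ℝ} (hs : 0 ≤ s)
    {x : H} {φ : Lp (WithLp 2 (G × X)) 2 (volume : Measure ℝ)}
    (hφ : IsOutputSignal Y B C s x φ) : ‖T s x‖ ≤ ‖φ‖ := by
  have hsub : IsOutputSignal Y B C s 0 (φ - T s x : Lp (WithLp 2 (G × X)) 2 volume) := by
    have hmem := (outputSignals hB C hs).sub_mem (x := (x, φ)) (y := (x, T s x))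
      hφ (hT.isOutputSignal s hs x)
    rwa [Prod.mk_sub_mk, sub_self] at hmem
  have hpyth := norm_add_sq_eq_norm_sq_add_norm_sq_of_inner_eq_zero _ _
    (hT.inner_eq_zero s hs x _ hsub)
  rw [add_sub_cancel] at hpyth
  exact le_of_sq_le_sq (by nlinarith [norm_nonneg (φ - T s x)]) (norm_nonneg φ)

theorem isOptimalCostOperator [CompleteSpace X] [CompleteSpace G]
    (hT : IsOptimalSignal Y (fun t => B t ∘L S' t) C T)
    (hB : IsControlSystem Y fun t => B t ∘L S' t) (hC : IsBoundedContinuous C)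
    (hS : IsBoundedContinuous S) (hS' : IsBoundedContinuous S')
    (hf : IsCostFactorization W R C S S') :
    IsOptimalCostOperator Y B W R fun s => (T s).adjoint ∘L T s := by
  intro s hs
  refine ⟨ContinuousLinearMap.isPositive_adjoint_comp_self _, fun x => ?_⟩
  rw [ContinuousLinearMap.comp_apply, ContinuousLinearMap.adjoint_inner_left,
    inner_self_eq_norm_sq]
  constructor
  · refine ⟨fun r => S' r (T s x r).snd, ?_,
      hf.infiniteCost_snd hs x (hT.isOutputSignal s hs x)⟩
    refine aestronglyMeasurable_clm_apply (fun v => ((hS'.1.mono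
      (Set.Ici_subset_Ici.2 hs)).clm_apply continuousOn_const).aestronglyMeasurable
        measurableSet_Ici) ?_
    exact (WithLp.sndL 2 𝕜 G X).continuous.comp_aestronglyMeasurable
      (Lp.aestronglyMeasurable (T s x)).restrict
  · rintro _ ⟨u, hu, rfl⟩
    by_cases hcost : infiniteCost Y B W R s x u = ⊤
    · exact hcost ▸ le_top
    have hLp := hf.memLp_costSignal hs x hB hC hS hu hcost
    have cost_eq : infiniteCost Y B W R s x u = ENNReal.ofReal (‖hLp.toLp‖ ^ 2) := by
      rw [hf.infiniteCost_eq_lintegral hs x, ofReal_norm_sq_eq_lintegral]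
      refine lintegral_congr_ae ?_
      filter_upwards [hLp.coeFn_toLp] with r hr
      rw [hr]
    rw [cost_eq]
    gcongr
    exact hT.norm_le hB hs ((hf.isOutputSignal_costSignal hs x u).congr hLp.coeFn_toLp.symm)

end IsOptimalSignal

end Cost

end InfiniteHorizonLQ

theorem mainTheorem4_general {𝕜 H X G : Type*} [RCLike 𝕜]
    [NormedAddCommGroup H] [InnerProductSpace 𝕜 H] [CompleteSpace H] [NormedSpace ℝ H]
    [NormedAddCommGroup X] [InnerProductSpace 𝕜 X] [CompleteSpace X]
    [NormedAddCommGroup G] [InnerProductSpace 𝕜 G] [CompleteSpace G]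
    (Y : ℝ → ℝ → H →L[𝕜] H) (B : ℝ → X →L[𝕜] H)
    (C : ℝ → H →L[𝕜] G) (W : ℝ → H →L[𝕜] H) (R : ℝ → X →L[𝕜] X)
    (hY : InfiniteHorizonLQ.IsEvolutionOperator Y)
    (hB : InfiniteHorizonLQ.IsBoundedContinuous B)
    (hC : InfiniteHorizonLQ.IsBoundedContinuous C)
    (hW : ∀ t, 0 ≤ t → W t = (C t).adjoint ∘L C t)
    (hR : InfiniteHorizonLQ.IsBoundedContinuous R)
    (hR_selfAdjoint : ∀ t, 0 ≤ t → IsSelfAdjoint (R t))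
    (hR_coercive : ∃ δ : ℝ, 0 < δ ∧ ∀ t, 0 ≤ t → ∀ v : X,
      δ * ‖v‖ ^ 2 ≤ RCLike.re (inner 𝕜 v (R t v)))
    (hstab : InfiniteHorizonLQ.IsUniformlyStabilizable Y B)
    (hdet : InfiniteHorizonLQ.IsUniformlyDetectable Y C) :
    (∃ P : ℝ → H →L[𝕜] H, InfiniteHorizonLQ.IsOptimalCostOperator Y B W R P) ∧
    ∀ P : ℝ → H →L[𝕜] H, InfiniteHorizonLQ.IsOptimalCostOperator Y B W R P →
      (∃ V : ℝ → ℝ → H →L[𝕜] H, InfiniteHorizonLQ.IsPerturbedEvolution Y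
        (fun t => -(B t ∘L InfiniteHorizonLQ.feedback B R P t)) V) ∧
      ∀ V : ℝ → ℝ → H →L[𝕜] H, InfiniteHorizonLQ.IsPerturbedEvolution Y
        (fun t => -(B t ∘L InfiniteHorizonLQ.feedback B R P t)) V →
        InfiniteHorizonLQ.IsExponentiallyStable V := by
  obtain ⟨δ, hδ, hδR⟩ := hR_coercive
  have hpos (t : ℝ) (ht : 0 ≤ t) : (R t).IsPositive :=
    InfiniteHorizonLQ.isPositive_of_coercive (hR_selfAdjoint t ht) hδ.le (hδR t ht)
  have hunit (t : ℝ) (ht : 0 ≤ t) : IsUnit (R t) :=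
    InfiniteHorizonLQ.isUnit_of_coercive hδ (hδR t ht)
  have hS := hR.posSqrt hpos
  have hS' := hR.inverseSqrt hpos hδ hδR
  have hf := InfiniteHorizonLQ.isCostFactorization_adjoint_comp_self hW hpos hunit
  have hstab' := hstab.comp_of_leftInverse hS hf.left_inv
  have hsys := hstab'.isControlSystem hY (hB.comp hS')
  obtain ⟨T, hT⟩ := hsys.exists_isOptimalSignal hC hstab'
  have hTT := hT.isOptimalCostOperator hsys hC hS hS' hf
  refine ⟨⟨_, hTT⟩, fun P hP =>
    hT.exists_isPerturbedEvolution_and_isExponentiallyStable hsys hC hdet fun t ht => ?_⟩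
  rw [InfiniteHorizonLQ.comp_feedback P (hpos t ht) (hunit t ht), hP.eq hTT ht]

theorem mainTheorem4 {𝕜 H X : Type*} [RCLike 𝕜]
    [NormedAddCommGroup H] [InnerProductSpace 𝕜 H] [CompleteSpace H]
    [NormedSpace ℝ H] [IsScalarTower ℝ 𝕜 H]
    [NormedAddCommGroup X] [InnerProductSpace 𝕜 X] [CompleteSpace X]
    (Y : ℝ → ℝ → H →L[𝕜] H) (B : ℝ → X →L[𝕜] H)
    (W : ℝ → H →L[𝕜] H) (R : ℝ → X →L[𝕜] X)
    (hY : InfiniteHorizonLQ.IsEvolutionOperator Y)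
    (hB : InfiniteHorizonLQ.IsBoundedContinuous B)
    (hW : InfiniteHorizonLQ.IsBoundedContinuous W)
    (hW_nonneg : ∀ t, 0 ≤ t → (W t).IsPositive)
    (hR : InfiniteHorizonLQ.IsBoundedContinuous R)
    (hR_selfAdjoint : ∀ t, 0 ≤ t → IsSelfAdjoint (R t))
    (hR_coercive : ∃ δ : ℝ, 0 < δ ∧ ∀ t, 0 ≤ t → ∀ v : X,
      δ * ‖v‖ ^ 2 ≤ RCLike.re (inner 𝕜 v (R t v)))
    (hstab : InfiniteHorizonLQ.IsUniformlyStabilizable Y B)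
    (hdet : InfiniteHorizonLQ.IsUniformlyDetectable Y
      (fun t => InfiniteHorizonLQ.posSqrt (W t))) :
    (∃ P : ℝ → H →L[𝕜] H, InfiniteHorizonLQ.IsOptimalCostOperator Y B W R P) ∧
    ∀ P : ℝ → H →L[𝕜] H, InfiniteHorizonLQ.IsOptimalCostOperator Y B W R P →
      (∃ V : ℝ → ℝ → H →L[𝕜] H, InfiniteHorizonLQ.IsPerturbedEvolution Y
        (fun t => -(B t ∘L InfiniteHorizonLQ.feedback B R P t)) V) ∧
      ∀ V : ℝ → ℝ → H →L[𝕜] H, InfiniteHorizonLQ.IsPerturbedEvolution Y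
        (fun t => -(B t ∘L InfiniteHorizonLQ.feedback B R P t)) V →
        InfiniteHorizonLQ.IsExponentiallyStable V := by
  exact mainTheorem4_general Y B _ W R hY hB (hW.posSqrt hW_nonneg)
    (fun t ht => (InfiniteHorizonLQ.adjoint_posSqrt_comp_self (hW_nonneg t ht)).symm)
    hR hR_selfAdjoint hR_coercive hstab hdet
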